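/- Consider an open, stable Jackson network with stations $1,\dots,d$: arrival rates $\lambda_i\ge 0$, service rates $\mu_i>0$, substochastic routing matrix $P=(P_{ij})$, $P_{i0}=1-\sum_j P_{ij}$, normalized by $\sum_i(\lambda_i+\mu_i)=1$. Open means that each station $i$ has $\lambda_i>0$ or $\lambda_{j_1}P_{j_1j_2}\cdots P_{j_ki}>0$ for some $j_1,\dots,j_k$, and has $P_{i0}>0$ or $P_{ij_1}P_{j_1j_2}\cdots P_{j_k0}>0$ for some $j_1,\dots,j_k$. The queue length chain $Q$ on $\mathbb{Z}_+^d$ is driven by i.i.d. events: with probability $\lambda_i$ a job arrives at $i$ (increment $e_i$), with probability $\mu_iP_{ij}$ a job moves from $i$ to $j$ (increment $-e_i+e_j$), with probability $\mu_iP_{i0}$ a job leaves the network from $i$ (increment $-e_i$); the last two kinds of events have no effect when station $i$ is empty. Stable means that $Q$ has a stationary distribution. Let $\rho_i=[\lambda^T(I-P)^{-1}]_i/\mu_i$ be the traffic intensities; $\rho_i\in(0,1)$. Let $S\subseteq\{1,\dots,d\}$ be non-empty with indicator vector $v$, $V(x)=v^Tx=\sum_{i\in S}x_i$, $\rho^V_*=\max_{i\in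 S}\rho_i$, and let $\beta_V=\#\{i\in S:\rho_i=\rho^V_*\}$ be the number of bottleneck stations in $S$. Fix a level size $\Delta\in(0,1]$, an integer $r>1$, and the importance function $$U(y)=\frac{\Delta}{\log r}\Big(\sum_{i=1}^d y_i\log\rho_i-\log\rho^V_*\Big).$$ For $n\ge1$ let $C^n_0=\{x\in\mathbb{Z}_+^d: V(x)\ge n\}$ be the target set, and for $j\ge1$ let $C^n_j=C^n_0\cup\{x\in\mathbb{Z}_+^d: U(x/n)\le \Delta j/n\}$; put $l_n(x)=\min\{j\ge0: x\in C^n_j\}$. The splitting algorithm started from $x\in\mathbb{Z}_+^d$ begins with one particle at $x$, at level $l_n(x)$. A particle at level $k\ge1$ moves as an independent copy of $Q$, from its current position, until it is at $0$ after at least one step, in which case it dies, or is in $C^n_{k-1}$, in which case it is replaced by $r$ particles at level $k-1$ at that position (so a particle that enters several level sets at once is split once for each of them); the procedure is repeated until all particles have died or are at level $0$, hence in $C^n_0$. Let $N_n(x)$ be the terminal number of particles, i.e. of those at level $0$. Then for every fixed $x\in\mathbb{Z}_+^d$, $$\mathbb{E}[N_n(x)]=\Theta\big(n^{\beta_V-1}\big)\qquad(n\to\infty),$$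 that is, there are $c_1,c_2,n_0\in(0,\infty)$ with $c_1n^{\beta_V-1}\le\mathbb{E}[N_n(x)]\le c_2n^{\beta_V-1}$ for all $n\ge n_0$. -/

import Mathlib

open MeasureTheory ProbabilityTheory Filter Asymptotics

noncomputable section

/-- The data of a Jackson network with `d` stations: arrival rates, service rates and routing
matrix, normalized so that the total rate is one. -/
structure JacksonNetwork (d : ℕ) where
  /-- external arrival rates `λ` -/
  arr : Fin d → ℝ
  /-- service rates `μ` -/
  srv : Fin d → ℝ
  /-- routing matrix `P` -/
  route : Matrix (Fin d) (Fin d) ℝ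
  arr_nonneg : ∀ i, 0 ≤ arr i
  srv_pos : ∀ i, 0 < srv i
  route_nonneg : ∀ i j, 0 ≤ route i j
  route_sum_le_one : ∀ i, ∑ j, route i j ≤ 1
  total_rate : ∑ i, (arr i + srv i) = 1

/-- The kinds of transitions of a Jackson network: an external arrival at `i` (increment `e_i`),
a service completion at `i` followed by a move to `j` (increment `-e_i + e_j`), and a service
completion at `i` followed by a departure from the network (increment `-e_i`). -/
inductive JacksonEvent (d : ℕ) : Type where
  | arrival (i : Fin d) : JacksonEvent d
  | transfer (i j : Fin d) : JacksonEvent d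
  | departure (i : Fin d) : JacksonEvent d

instance (d : ℕ) : MeasurableSpace (JacksonEvent d) := ⊤

/-- The constrained dynamics `x ↦ x + ζ(x, w)`: service completions at empty stations are void. -/
def JacksonEvent.step {d : ℕ} (x : Fin d → ℕ) : JacksonEvent d → (Fin d → ℕ)
  | .arrival i => x + Pi.single i 1
  | .transfer i j => if x i = 0 then x else x - Pi.single i 1 + Pi.single j 1
  | .departure i => if x i = 0 then x else x - Pi.single i 1

/-- The trajectory of the queue length chain started at `x` and driven by the events
`ξ 0, ξ 1, …`. -/
def jacksonPath {d : ℕ} (x : Fin d → ℕ) (ξ : ℕ → JacksonEvent d) : ℕ → (Fin d → ℕ)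
  | 0 => x
  | t + 1 => (ξ t).step (jacksonPath x ξ t)

namespace JacksonNetwork

variable {d : ℕ} (J : JacksonNetwork d)

/-- The probability `P_{i0}` that a job leaving station `i` leaves the network. -/
def exitProb (i : Fin d) : ℝ := 1 - ∑ j, J.route i j

/-- The law of a single driving event. -/
def eventProb : JacksonEvent d → ℝ
  | .arrival i => J.arr i
  | .transfer i j => J.srv i * J.route i j
  | .departure i => J.srv i * J.exitProb i

/-- The transition matrix of the queue length chain. -/
def transitionMatrix (x y : Fin d → ℕ) : ℝ :=
  (∑ i, if JacksonEvent.step x (.arrival i) = y then J.eventProb (.arrival i) else 0) +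
  (∑ i, ∑ j, if JacksonEvent.step x (.transfer i j) = y
    then J.eventProb (.transfer i j) else 0) +
  (∑ i, if JacksonEvent.step x (.departure i) = y then J.eventProb (.departure i) else 0)

/-- The network is open: every station receives jobs from outside, directly or through other
stations, and from every station jobs can leave the network, directly or through other
stations. -/
def IsOpenNetwork : Prop :=
  (∀ i, ∃ j, 0 < J.arr j ∧ Relation.ReflTransGen (fun a b => 0 < J.route a b) j i) ∧
  (∀ i, ∃ j, Relation.ReflTransGen (fun a b => 0 < J.route a b) i j ∧ 0 < J.exitProb j)

/-- The network is stable: the queue length chain has a stationary distribution. -/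
def IsStable : Prop :=
  ∃ π : (Fin d → ℕ) → ℝ, (∀ x, 0 ≤ π x) ∧ HasSum π 1 ∧
    ∀ y, HasSum (fun x => π x * J.transitionMatrix x y) (π y)

/-- The traffic intensities `ρ_i = [λᵀ (I - P)⁻¹]_i / μ_i`. -/
def rho (i : Fin d) : ℝ := (Matrix.vecMul J.arr (1 - J.route)⁻¹) i / J.srv i

/-- The largest traffic intensity among the stations of the target subset `S`. -/
def rhoStar (S : Finset (Fin d)) (hS : S.Nonempty) : ℝ := S.sup' hS J.rho

/-- The number of bottleneck stations of the target subset `S` (at least one). -/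
def beta (S : Finset (Fin d)) (hS : S.Nonempty) : ℕ :=
  Set.ncard {i : Fin d | i ∈ S ∧ J.rho i = J.rhoStar S hS}

/-- The subsolution `y ↦ ∑ i, (log ρ_i) y_i - log ρ_*`. -/
def subsolution (S : Finset (Fin d)) (hS : S.Nonempty) (y : Fin d → ℝ) : ℝ :=
  (∑ i, Real.log (J.rho i) * y i) - Real.log (J.rhoStar S hS)

/-- The importance function `U`. -/
def importance (S : Finset (Fin d)) (hS : S.Nonempty) (Δ : ℝ) (r : ℕ) (y : Fin d → ℝ) : ℝ :=
  Δ * J.subsolution S hS y / Real.log r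

/-- The nested level sets `C 0 ⊆ C 1 ⊆ …`: `C 0` is the target set, where the population of the
stations in `S` is at least `n`, and for `j ≥ 1` the set `C j` consists of the target set and of
the states `x` with `U (x / n) ≤ Δ j / n`. -/
def levelSet (S : Finset (Fin d)) (hS : S.Nonempty) (Δ : ℝ) (r n : ℕ) (j : ℕ) :
    Set (Fin d → ℕ) :=
  {x | n ≤ ∑ i ∈ S, x i ∨
    (1 ≤ j ∧ J.importance S hS Δ r (fun i => (x i : ℝ) / n) ≤ Δ * j / n)}

/-- The initial level of a particle at `x`: the least `j` such that `x` lies in the `j`-th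
level set. -/
def initialLevel (S : Finset (Fin d)) (hS : S.Nonempty) (Δ : ℝ) (r n : ℕ) (x : Fin d → ℕ) : ℕ :=
  sInf {j | x ∈ J.levelSet S hS Δ r n j}

end JacksonNetwork

open Classical in
/-- The state at which a trajectory first enters `A`, provided that it does so before it hits the
origin at some time `≥ 1`; `none` if the particle dies at the origin (or never enters `A`). -/
def firstEntry {d : ℕ} (A : Set (Fin d → ℕ)) (q : ℕ → (Fin d → ℕ)) : Option (Fin d → ℕ) :=
  if h : ∃ t, q t ∈ A ∧ ∀ s, 1 ≤ s → s ≤ t → q s ≠ 0 then some (q (Nat.find h)) else none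

/-- The splitting algorithm. A particle that has just reached (or started in) the level set `C k`
at state `x` evolves until it hits the origin or enters `C (k - 1)`; in the first case it dies, in
the second one it is replaced by `r` children placed at the entrance state, which then proceed
likewise. The value is the number of final particles, in `C 0`. Particles are labelled by words
over `Fin r`, and `ξ u` is the sequence of events that drives the particle with label `u`
(relative to the particle under consideration, whose label is `[]`). -/
def splitCount {d r : ℕ} (C : ℕ → Set (Fin d → ℕ)) :
    ℕ → (Fin d → ℕ) → (List (Fin r) → ℕ → JacksonEvent d) → ℕ
  | 0, _, _ => 1
  | k + 1, x, ξ =>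
    match firstEntry (C k) (jacksonPath x (ξ [])) with
    | none => 0
    | some z => ∑ c : Fin r, splitCount C k z (fun u => ξ (c :: u))

/-- The terminal number `N_n(x)` of particles of the splitting algorithm with level size `Δ` and
splitting factor `r`, started with a single particle at `x`. -/
def JacksonNetwork.terminalCount {d r : ℕ} (J : JacksonNetwork d) (S : Finset (Fin d))
    (hS : S.Nonempty) (Δ : ℝ) (n : ℕ) (x : Fin d → ℕ)
    (ξ : List (Fin r) → ℕ → JacksonEvent d) : ℕ :=
  splitCount (J.levelSet S hS Δ r n) (J.initialLevel S hS Δ r n x) x ξ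

end

/-! A path that reaches the target set is split exactly once per level, so independence and the
tower property give `E N = r ^ l * P_x(target before 0)`, where `l` is the initial level
(`lintegral_splitCount`). Off the target, `l` is the least `j ≥ 1` with `scaledSub ≤ j log r`; hence
for large `n` the factor `r ^ l` is `exp (∑ x_i log ρ_i) * ρ_* ^ (-n)` up to a factor in `[1, r]`
(`initialLevel_bounds`). It remains to see that the hitting probability is of order `n ^ (β - 1) *
ρ_* ^ n` (`hit_target_bounds`).

By openness and monotonicity the start may be moved to the origin. The product measure `ν x = ∏ ρ_i
^ x_i` is invariant with `ν 0 = 1` (`isInvariant_wt`). The hitting probability, set to zero at the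
origin, is harmonic off the target except for a defect at the origin equal to the probability
sought. Integration against `ν` gives `P_0 ≤ ν(target)` (`hit_zero_le`), and the tail of a product
of geometric weights with `β` equal dominant factors supplies the power of `n` (`wt_tail_le`,
`le_wt_slice`). The converse (`le_hit_zero`) needs states of the target, carrying enough mass, from
which a fixed event sequence makes a return to the target unlikely.

That is the hard point (`exists_hit_le_half`): from population at most `n - K` the network empties
before its population reaches `n` with probability at least `1/2`, uniformly in `n`. The chain is
coupled with a copy started empty and driven by the same events. The surplus of the first copy over
the second never grows, and whenever the second is in a bounded region, a fixed event sequence of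
positive probability empties it and lowers the surplus or kills the first copy. An exponential
Lyapunov function, available because `ρ_i < 1`, controls the second copy between such visits, and
the two combine into a supermartingale exponential in the surplus. -/

namespace JacksonEvent

variable {d : ℕ}

/-! ### Deterministic dynamics: monotonicity and comparison of two copies driven by the same events.
-/

/-- Events as a disjoint union of index types. -/
def equivSum (d : ℕ) : (Fin d ⊕ (Fin d × Fin d)) ⊕ Fin d ≃ JacksonEvent d where
  toFun
    | .inl (.inl i) => .arrival i
    | .inl (.inr p) => .transfer p.1 p.2
    | .inr i => .departure i
  invFun
    | .arrival i => .inl (.inl i)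
    | .transfer i j => .inl (.inr (i, j))
    | .departure i => .inr i
  left_inv := by rintro ((i | p) | i) <;> rfl
  right_inv := by rintro (i | ⟨i, j⟩ | i) <;> rfl

instance (d : ℕ) : Fintype (JacksonEvent d) := Fintype.ofEquiv _ (equivSum d)

instance (d : ℕ) : DiscreteMeasurableSpace (JacksonEvent d) := ⟨fun _ => trivial⟩

theorem sum_eq {M : Type*} [AddCommMonoid M] (f : JacksonEvent d → M) :
    ∑ e, f e = ∑ i, f (.arrival i) + ∑ i, ∑ j, f (.transfer i j) + ∑ i, f (.departure i) := by
  rw [← (equivSum d).sum_comp, Fintype.sum_sum_type, Fintype.sum_sum_type, Fintype.sum_prod_type]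
  rfl

theorem exists_eq_add_single {x : Fin d → ℕ} {i : Fin d} (h : x i ≠ 0) :
    ∃ z : Fin d → ℕ, x = z + Pi.single i 1 := by
  refine ⟨x - Pi.single i 1, (tsub_add_cancel_of_le ?_).symm⟩
  intro j
  by_cases hj : j = i
  · subst hj; simpa using Nat.one_le_iff_ne_zero.2 h
  · simp [hj]

theorem step_transfer_add (z : Fin d → ℕ) (i j : Fin d) :
    step (z + Pi.single i 1) (.transfer i j) = z + Pi.single j 1 := by
  simp [step]

theorem step_departure_add (z : Fin d → ℕ) (i : Fin d) :
    step (z + Pi.single i 1) (.departure i) = z := by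
  simp [step]

theorem step_transfer_of_eq_zero {x : Fin d → ℕ} {i : Fin d} (h : x i = 0) (j : Fin d) :
    step x (.transfer i j) = x := by simp [step, h]

theorem step_departure_of_eq_zero {x : Fin d → ℕ} {i : Fin d} (h : x i = 0) :
    step x (.departure i) = x := by simp [step, h]

theorem step_mono {x y : Fin d → ℕ} (h : y ≤ x) (e : JacksonEvent d) : step y e ≤ step x e := by
  intro k
  have hk : y k ≤ x k := h k
  rcases e with i | ⟨i, j⟩ | i
  · simp only [step, Pi.add_apply]; omega
  all_goals
    have hi : y i ≤ x i := h i
    by_cases h1 : y i = 0 <;> by_cases h2 : x i = 0 <;> simp only [step, h1, h2, if_true, if_false]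
    · exact hk
    · by_cases hki : k = i
      · subst hki; omega
      · simp only [Pi.add_apply, Pi.sub_apply, Pi.single_eq_of_ne hki]; omega
    · omega
    · simp only [Pi.add_apply, Pi.sub_apply]; omega

theorem sum_add_single (z : Fin d → ℕ) (i : Fin d) :
    ∑ k, (z + Pi.single i 1 : Fin d → ℕ) k = ∑ k, z k + 1 := by
  simp [Finset.sum_add_distrib]

/-- An event changes the two populations differently only if it is a departure from a station that
is busy in `x` and idle in `y`, and then only the larger population drops. So the surplus of `x`
over `y` never increases; the additive form avoids truncated subtraction. -/
theorem sum_step_add_le {x y : Fin d → ℕ} (h : y ≤ x) (e : JacksonEvent d) :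
    ∑ k, step x e k + ∑ k, y k ≤ ∑ k, x k + ∑ k, step y e k := by
  rcases e with i | ⟨i, j⟩ | i
  · simp only [step, sum_add_single]; omega
  · by_cases h1 : y i = 0 <;> by_cases h2 : x i = 0
    · simp [step, h1, h2]
    · obtain ⟨z, rfl⟩ := exists_eq_add_single h2
      simp only [step_transfer_add, step_transfer_of_eq_zero h1, sum_add_single]; omega
    · have : y i ≤ x i := h i
      omega
    · obtain ⟨z, rfl⟩ := exists_eq_add_single h2
      obtain ⟨u, rfl⟩ := exists_eq_add_single h1
      simp only [step_transfer_add, sum_add_single]; omega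
  · by_cases h1 : y i = 0 <;> by_cases h2 : x i = 0
    · simp [step, h1, h2]
    · obtain ⟨z, rfl⟩ := exists_eq_add_single h2
      simp only [step_departure_add, step_departure_of_eq_zero h1, sum_add_single]; omega
    · have : y i ≤ x i := h i
      omega
    · obtain ⟨z, rfl⟩ := exists_eq_add_single h2
      obtain ⟨u, rfl⟩ := exists_eq_add_single h1
      simp only [step_departure_add, sum_add_single]; omega

/-- The state reached from `x` after a finite sequence of events. -/
def run (x : Fin d → ℕ) (l : List (JacksonEvent d)) : Fin d → ℕ := l.foldl step x

@[simp] theorem run_nil (x : Fin d → ℕ) : run x [] = x := rfl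

@[simp] theorem run_cons (x : Fin d → ℕ) (e : JacksonEvent d) (l : List (JacksonEvent d)) :
    run x (e :: l) = run (step x e) l := rfl

theorem run_append (x : Fin d → ℕ) (l m : List (JacksonEvent d)) :
    run x (l ++ m) = run (run x l) m := List.foldl_append

theorem run_mono {x y : Fin d → ℕ} (h : y ≤ x) (l : List (JacksonEvent d)) :
    run y l ≤ run x l := by
  induction l generalizing x y with
  | nil => exact h
  | cons e l ih => exact ih (step_mono h e)

theorem sum_run_add_le {x y : Fin d → ℕ} (h : y ≤ x) (l : List (JacksonEvent d)) :
    ∑ k, run x l k + ∑ k, y k ≤ ∑ k, x k + ∑ k, run y l k := by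
  induction l generalizing x y with
  | nil => exact le_rfl
  | cons e l ih =>
    have h1 := sum_step_add_le h e
    have h2 := ih (step_mono h e)
    simp only [run_cons]; omega

theorem sum_pos_of_ne_zero {x : Fin d → ℕ} (h : x ≠ 0) : 0 < ∑ k, x k := by
  rw [Nat.pos_iff_ne_zero]
  intro h0
  exact h (funext fun k => (Finset.sum_eq_zero_iff.1 h0) k (Finset.mem_univ k))

theorem eq_zero_of_sum_eq_zero {x : Fin d → ℕ} (h : ∑ k, x k = 0) : x = 0 := by
  by_contra h0; exact (sum_pos_of_ne_zero h0).ne' h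

end JacksonEvent

/-! ### Event sequences of positive probability that drain the network. -/

namespace JacksonNetwork

open JacksonEvent

variable {d : ℕ} (J : JacksonNetwork d)

theorem exitProb_nonneg (i : Fin d) : 0 ≤ J.exitProb i := sub_nonneg.2 (J.route_sum_le_one i)

theorem eventProb_nonneg (e : JacksonEvent d) : 0 ≤ J.eventProb e := by
  rcases e with i | ⟨i, j⟩ | i
  · exact J.arr_nonneg i
  · exact mul_nonneg (J.srv_pos i).le (J.route_nonneg i j)
  · exact mul_nonneg (J.srv_pos i).le (J.exitProb_nonneg i)

theorem sum_eventProb : ∑ e, J.eventProb e = 1 := by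
  rw [JacksonEvent.sum_eq, ← J.total_rate, add_assoc, ← Finset.sum_add_distrib,
    ← Finset.sum_add_distrib]
  refine Finset.sum_congr rfl fun i _ => ?_
  simp only [eventProb, exitProb, ← Finset.mul_sum]
  ring

/-- The probability of a finite sequence of events. -/
def listProb (l : List (JacksonEvent d)) : ℝ := (l.map J.eventProb).prod

@[simp] theorem listProb_nil : J.listProb [] = 1 := rfl

@[simp] theorem listProb_cons (e : JacksonEvent d) (l : List (JacksonEvent d)) :
    J.listProb (e :: l) = J.eventProb e * J.listProb l := by simp [listProb]

theorem listProb_append (l m : List (JacksonEvent d)) :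
    J.listProb (l ++ m) = J.listProb l * J.listProb m := by simp [listProb]

theorem listProb_nonneg (l : List (JacksonEvent d)) : 0 ≤ J.listProb l := by
  induction l with
  | nil => simp
  | cons e l ih => rw [listProb_cons]; exact mul_nonneg (J.eventProb_nonneg e) ih

variable {J}

/-- A single job can be led out of an open network. -/
theorem IsOpenNetwork.exists_exit_list (h : J.IsOpenNetwork) (i : Fin d) :
    ∃ l, 0 < J.listProb l ∧ run (Pi.single i 1) l = 0 := by
  obtain ⟨j, hij, hj⟩ := h.2 i
  induction hij using Relation.ReflTransGen.head_induction_on with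
  | refl =>
    refine ⟨[.departure j], ?_, ?_⟩
    · simpa [eventProb] using mul_pos (J.srv_pos j) hj
    · have := step_departure_add 0 j
      rw [zero_add] at this
      simpa using this
  | @head a c hac _ ih =>
    obtain ⟨l, hl, hl'⟩ := ih
    refine ⟨.transfer a c :: l, ?_, ?_⟩
    · rw [listProb_cons]
      exact mul_pos (mul_pos (J.srv_pos a) hac) hl
    · have := step_transfer_add 0 a c
      rw [zero_add, zero_add] at this
      rw [run_cons, this, hl']

theorem sum_run_le_one (i : Fin d) (l : List (JacksonEvent d)) (h0 : run 0 l = 0) :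
    ∑ k, run (Pi.single i 1) l k ≤ 1 := by
  have := sum_run_add_le (zero_le (a := (Pi.single i 1 : Fin d → ℕ))) l
  rw [h0] at this
  simpa using this

theorem eq_single_of_sum_le_one {x : Fin d → ℕ} (h : ∑ k, x k ≤ 1) (h0 : x ≠ 0) :
    ∃ j, x = Pi.single j 1 := by
  obtain ⟨j, hj⟩ := Function.ne_iff.1 h0
  obtain ⟨z, rfl⟩ := exists_eq_add_single hj
  rw [sum_add_single] at h
  refine ⟨j, ?_⟩
  rw [eq_zero_of_sum_eq_zero (x := z) (by omega), zero_add]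

/-- One sequence must work for all starting stations. A sequence fixing the empty state turns a
single job into at most a single job, so if the job from the new station survives, it sits at one
station `j`; appending an exit route from `j` removes it, and by monotonicity that route leaves the
empty state empty. -/
theorem IsOpenNetwork.exists_sync_list_finset (h : J.IsOpenNetwork) (T : Finset (Fin d)) :
    ∃ l, 0 < J.listProb l ∧ run 0 l = 0 ∧ ∀ i ∈ T, run (Pi.single i 1) l = 0 := by
  induction T using Finset.induction_on with
  | empty => exact ⟨[], by simp⟩
  | insert i T _ ih =>
    obtain ⟨l, hl, h0, hT⟩ := ih
    by_cases hz : run (Pi.single i 1) l = 0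
    · refine ⟨l, hl, h0, fun k hk => ?_⟩
      rcases Finset.mem_insert.1 hk with rfl | hk
      · exact hz
      · exact hT k hk
    · obtain ⟨j, hj⟩ := eq_single_of_sum_le_one (sum_run_le_one i l h0) hz
      obtain ⟨m, hm, hm'⟩ := h.exists_exit_list j
      have hm0 : run 0 m = 0 := le_antisymm (hm' ▸ run_mono zero_le m) zero_le
      refine ⟨l ++ m, by rw [listProb_append]; exact mul_pos hl hm, by rw [run_append, h0, hm0],
        fun k hk => ?_⟩
      rw [run_append]
      rcases Finset.mem_insert.1 hk with rfl | hk
      · rw [hj, hm']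
      · rw [hT k hk, hm0]

/-- A finite sequence of events of positive probability which removes `k` jobs from every
state. -/
theorem IsOpenNetwork.exists_drain_list (h : J.IsOpenNetwork) (k : ℕ) :
    ∃ l, 0 < J.listProb l ∧ ∀ x, ∑ i, run x l i ≤ ∑ i, x i - k := by
  induction k with
  | zero => exact ⟨[], by simp⟩
  | succ k ih =>
    obtain ⟨l, hl, hx⟩ := ih
    obtain ⟨m, hm, hm0, hT⟩ := h.exists_sync_list_finset Finset.univ
    refine ⟨l ++ m, by rw [listProb_append]; exact mul_pos hl hm, fun x => ?_⟩
    rw [run_append]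
    have hxl := hx x
    by_cases hz : run x l = 0
    · rw [hz, hm0]; simp
    · obtain ⟨j, hj⟩ := Function.ne_iff.1 hz
      obtain ⟨z, hz'⟩ := exists_eq_add_single hj
      -- The remaining state dominates one job, which `m` removes. As the surplus over that job
      -- cannot grow, `m` lowers the population by at least one.
      have hle : (Pi.single j 1 : Fin d → ℕ) ≤ run x l := by rw [hz']; simp
      have h1 := sum_run_add_le hle m
      rw [hT j (Finset.mem_univ j)] at h1
      simp at h1
      omega

end JacksonNetwork

/-! ### Stationary distributions, the traffic equations and `0 < ρ < 1`. -/

noncomputable section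

namespace JacksonNetwork

open JacksonEvent
open scoped ENNReal

variable {d : ℕ} (J : JacksonNetwork d)

/-- The one-step expectation of a real function of the state. -/
def avg (f : (Fin d → ℕ) → ℝ) (x : Fin d → ℕ) : ℝ := ∑ e, J.eventProb e * f (step x e)

/-- The one-step expectation of a function of the state with values in `[0, ∞]`. -/
def eavg (f : (Fin d → ℕ) → ℝ≥0∞) (x : Fin d → ℕ) : ℝ≥0∞ :=
  ∑ e, ENNReal.ofReal (J.eventProb e) * f (step x e)

/-- Invariance of a measure on the state space, tested against functions. -/
def IsInvariant (ν : (Fin d → ℕ) → ℝ≥0∞) : Prop :=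
  ∀ f : (Fin d → ℕ) → ℝ≥0∞, ∑' x, ν x * J.eavg f x = ∑' x, ν x * f x

variable {J}

theorem avg_mono {f g : (Fin d → ℕ) → ℝ} (h : ∀ x, f x ≤ g x) (x : Fin d → ℕ) :
    J.avg f x ≤ J.avg g x :=
  Finset.sum_le_sum fun e _ => mul_le_mul_of_nonneg_left (h _) (J.eventProb_nonneg e)

theorem avg_const (c : ℝ) (x : Fin d → ℕ) : J.avg (fun _ => c) x = c := by
  rw [avg, ← Finset.sum_mul, J.sum_eventProb, one_mul]

theorem avg_nonneg {f : (Fin d → ℕ) → ℝ} (h : ∀ x, 0 ≤ f x) (x : Fin d → ℕ) : 0 ≤ J.avg f x :=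
  Finset.sum_nonneg fun e _ => mul_nonneg (J.eventProb_nonneg e) (h _)

theorem eavg_ofReal {f : (Fin d → ℕ) → ℝ} (h : ∀ x, 0 ≤ f x) (x : Fin d → ℕ) :
    J.eavg (fun z => ENNReal.ofReal (f z)) x = ENNReal.ofReal (J.avg f x) := by
  rw [eavg, avg, ENNReal.ofReal_sum_of_nonneg
    fun e _ => mul_nonneg (J.eventProb_nonneg e) (h _)]
  exact Finset.sum_congr rfl fun e _ => (ENNReal.ofReal_mul (J.eventProb_nonneg e)).symm

theorem avg_sub_self (f : (Fin d → ℕ) → ℝ) (x : Fin d → ℕ) :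
    J.avg f x - f x = ∑ e, J.eventProb e * (f (step x e) - f x) := by
  simp only [mul_sub, Finset.sum_sub_distrib, avg]
  rw [← Finset.sum_mul, J.sum_eventProb, one_mul]

theorem transitionMatrix_eq (x y : Fin d → ℕ) :
    J.transitionMatrix x y = ∑ e, if step x e = y then J.eventProb e else 0 := by
  rw [JacksonEvent.sum_eq]; rfl

/-- Passing to `[0, ∞]`-valued weights and test functions makes every later interchange of sums free
of summability conditions. -/
theorem IsStable.exists_isInvariant (h : J.IsStable) :
    ∃ ν : (Fin d → ℕ) → ℝ≥0∞, J.IsInvariant ν ∧ ∑' x, ν x = 1 := by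
  classical
  obtain ⟨π, h0, h1, h2⟩ := h
  have hT : ∀ x y, 0 ≤ J.transitionMatrix x y := fun x y => by
    rw [transitionMatrix_eq]
    exact Finset.sum_nonneg fun e _ => by split_ifs <;> simp [J.eventProb_nonneg e]
  refine ⟨fun x => ENNReal.ofReal (π x), fun f => ?_, ?_⟩
  · have hy : ∀ y, ENNReal.ofReal (π y) =
        ∑' x, ENNReal.ofReal (π x) * ENNReal.ofReal (J.transitionMatrix x y) := fun y => by
      rw [← (h2 y).tsum_eq, ENNReal.ofReal_tsum_of_nonneg
        (fun x => mul_nonneg (h0 x) (hT x y)) (h2 y).summable]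
      exact tsum_congr fun x => ENNReal.ofReal_mul (h0 x)
    have : ∀ y, ENNReal.ofReal (π y) * f y =
        ∑' x, ENNReal.ofReal (π x) * ENNReal.ofReal (J.transitionMatrix x y) * f y := fun y => by
      rw [hy, ENNReal.tsum_mul_right]
    rw [tsum_congr this, ENNReal.tsum_comm]
    refine tsum_congr fun x => ?_
    simp only [mul_assoc, ENNReal.tsum_mul_left]
    congr 1
    have hs : ∀ y, ENNReal.ofReal (J.transitionMatrix x y) * f y =
        ∑ e, if y = step x e then ENNReal.ofReal (J.eventProb e) * f y else 0 := fun y => by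
      rw [transitionMatrix_eq, ENNReal.ofReal_sum_of_nonneg
        (fun e _ => by split_ifs <;> simp [J.eventProb_nonneg e]), Finset.sum_mul]
      refine Finset.sum_congr rfl fun e _ => ?_
      by_cases hh : y = step x e
      · simp [hh]
      · simp [hh, Ne.symm hh]
    rw [tsum_congr hs, Summable.tsum_finsetSum fun _ _ => ENNReal.summable]
    exact Finset.sum_congr rfl fun e _ => (tsum_ite_eq (step x e)
      fun y => ENNReal.ofReal (J.eventProb e) * f y).symm
  · rw [← ENNReal.ofReal_tsum_of_nonneg h0 h1.summable, h1.tsum_eq, ENNReal.ofReal_one]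

theorem summable_mul {ν : (Fin d → ℕ) → ℝ≥0∞} (hfin : ∑' x, ν x ≠ ∞)
    {f : (Fin d → ℕ) → ℝ} {c : ℝ} (hf : ∀ x, |f x| ≤ c) :
    Summable fun x => (ν x).toReal * f x := by
  refine Summable.of_norm_bounded ((ENNReal.summable_toReal hfin).mul_right c) fun x => ?_
  rw [norm_mul, Real.norm_of_nonneg ENNReal.toReal_nonneg]
  exact mul_le_mul_of_nonneg_left (hf x) ENNReal.toReal_nonneg

theorem tsum_mul_ofReal {ν : (Fin d → ℕ) → ℝ≥0∞} (hfin : ∑' x, ν x ≠ ∞)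
    {f : (Fin d → ℕ) → ℝ} (h0 : ∀ x, 0 ≤ f x) :
    ∑' x, (ν x).toReal * f x = (∑' x, ν x * ENNReal.ofReal (f x)).toReal := by
  rw [ENNReal.tsum_toReal_eq
    fun x => ENNReal.mul_ne_top (ENNReal.ne_top_of_tsum_ne_top hfin x) ENNReal.ofReal_ne_top]
  exact tsum_congr fun x => by rw [ENNReal.toReal_mul, ENNReal.toReal_ofReal (h0 x)]

theorem IsInvariant.tsum_avg {ν : (Fin d → ℕ) → ℝ≥0∞} (hν : J.IsInvariant ν)
    (hfin : ∑' x, ν x ≠ ∞) {f : (Fin d → ℕ) → ℝ} (h0 : ∀ x, 0 ≤ f x) :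
    ∑' x, (ν x).toReal * J.avg f x = ∑' x, (ν x).toReal * f x := by
  rw [tsum_mul_ofReal hfin h0, tsum_mul_ofReal hfin (avg_nonneg h0),
    ← hν fun x => ENNReal.ofReal (f x)]
  simp only [eavg_ofReal h0]

/-- Invariance tested on the indicator of a point: the mass there is at least the mass carried to it
by one event. Iterating follows the list. -/
theorem IsInvariant.mul_listProb_le {ν : (Fin d → ℕ) → ℝ≥0∞} (hν : J.IsInvariant ν)
    (l : List (JacksonEvent d)) (x : Fin d → ℕ) :
    ν x * ENNReal.ofReal (J.listProb l) ≤ ν (run x l) := by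
  classical
  induction l generalizing x with
  | nil => simp
  | cons e l ih =>
    refine le_trans ?_ (ih (step x e))
    rw [listProb_cons, ENNReal.ofReal_mul (J.eventProb_nonneg e), ← mul_assoc]
    gcongr
    have h := hν (fun z => if z = step x e then 1 else 0)
    simp only [mul_ite, mul_one, mul_zero, tsum_ite_eq] at h
    rw [← h]
    refine le_trans ?_ (ENNReal.le_tsum x)
    gcongr
    rw [eavg]
    refine le_trans (le_of_eq ?_)
      (Finset.single_le_sum (fun _ _ => zero_le) (Finset.mem_univ e))
    simp

/-- The linear function with coefficients `c`. -/
def lin (c : Fin d → ℝ) (x : Fin d → ℕ) : ℝ := ∑ j, c j * x j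

theorem lin_add_single (c : Fin d → ℝ) (z : Fin d → ℕ) (i : Fin d) :
    lin c (z + Pi.single i 1) = lin c z + c i := by
  simp only [lin, Pi.add_apply, Nat.cast_add, mul_add, Finset.sum_add_distrib]
  congr 1
  rw [Finset.sum_eq_single i] <;> simp +contextual

theorem lin_step_arrival (c : Fin d → ℝ) (x : Fin d → ℕ) (i : Fin d) :
    lin c (step x (.arrival i)) - lin c x = c i := by
  simp [step, lin_add_single]

theorem lin_step_transfer (c : Fin d → ℝ) (x : Fin d → ℕ) (i j : Fin d) :
    lin c (step x (.transfer i j)) - lin c x = if x i = 0 then 0 else c j - c i := by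
  split_ifs with h
  · simp [step, h]
  · obtain ⟨z, rfl⟩ := exists_eq_add_single h
    rw [step_transfer_add, lin_add_single, lin_add_single]; ring

theorem lin_step_departure (c : Fin d → ℝ) (x : Fin d → ℕ) (i : Fin d) :
    lin c (step x (.departure i)) - lin c x = if x i = 0 then 0 else - c i := by
  split_ifs with h
  · simp [step, h]
  · obtain ⟨z, rfl⟩ := exists_eq_add_single h
    rw [step_departure_add, lin_add_single]; ring

theorem drift_lin (c : Fin d → ℝ) (x : Fin d → ℕ) :
    ∑ e, J.eventProb e * (lin c (step x e) - lin c x) =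
      ∑ k, J.arr k * c k +
        ∑ k, if x k = 0 then 0 else J.srv k * (∑ j, J.route k j * c j - c k) := by
  rw [JacksonEvent.sum_eq, add_assoc, ← Finset.sum_add_distrib]
  simp only [lin_step_arrival, lin_step_transfer, lin_step_departure, eventProb]
  congr 1
  refine Finset.sum_congr rfl fun k _ => ?_
  split_ifs with h
  · simp
  · have h1 : ∑ j, J.srv k * J.route k j * (c j - c k) =
        J.srv k * ∑ j, J.route k j * c j - J.srv k * (∑ j, J.route k j) * c k := by
      rw [Finset.mul_sum, Finset.mul_sum, Finset.sum_mul, ← Finset.sum_sub_distrib]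
      exact Finset.sum_congr rfl fun j _ => by ring
    simp only [h1, exitProb]
    ring

theorem abs_lin_step_le {c : Fin d → ℝ} {B : ℝ} (hB : ∀ i, |c i| ≤ B) (x : Fin d → ℕ)
    (e : JacksonEvent d) : |lin c (step x e) - lin c x| ≤ 2 * B := by
  have hB0 : ∀ _ : Fin d, 0 ≤ B := fun i => (abs_nonneg _).trans (hB i)
  rcases e with i | ⟨i, j⟩ | i
  · rw [lin_step_arrival]; linarith [hB i, hB0 i]
  · rw [lin_step_transfer]
    split_ifs
    · rw [abs_zero]; linarith [hB0 i]
    · linarith [abs_sub (c j) (c i), hB i, hB j]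
  · rw [lin_step_departure]
    split_ifs
    · rw [abs_zero]; linarith [hB0 i]
    · rw [abs_neg]; linarith [hB i, hB0 i]

theorem abs_min_sub_min_le (a b c : ℝ) : |min a c - min b c| ≤ |a - b| := by
  simpa using abs_min_sub_min_le_max a c b c

/-- Flow balance at station `i` under an invariant distribution. -/
theorem IsInvariant.flow_balance {ν : (Fin d → ℕ) → ℝ≥0∞} (hν : J.IsInvariant ν)
    (hfin : ∑' x, ν x ≠ ∞) (c : Fin d → ℝ) (hc : ∀ i, 0 ≤ c i) :
    ∑' x, (ν x).toReal * ∑ e, J.eventProb e * (lin c (step x e) - lin c x) = 0 := by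
  obtain ⟨B, hB⟩ : ∃ B, ∀ i, |c i| ≤ B :=
    ⟨∑ i, |c i|, fun i =>
      Finset.single_le_sum (f := fun i => |c i|) (fun _ _ => abs_nonneg _) (Finset.mem_univ i)⟩
  have hl : ∀ x, 0 ≤ lin c x := fun x =>
    Finset.sum_nonneg fun j _ => mul_nonneg (hc j) (Nat.cast_nonneg _)
  -- A linear function need not be integrable under `ν`, so it is truncated at `N`. The truncation
  -- is bounded and has mean drift zero; the drift is bounded by `2 * B` uniformly in `N`, so
  -- dominated convergence removes the truncation.
  have hzero : ∀ N : ℕ, ∑' x, (ν x).toReal *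
      ∑ e, J.eventProb e * (min (lin c (step x e)) N - min (lin c x) N) = 0 := fun N => by
    have h0 : ∀ x, 0 ≤ min (lin c x) (N : ℝ) := fun x => le_min (hl x) (Nat.cast_nonneg _)
    have hb : ∀ x, |min (lin c x) (N : ℝ)| ≤ N := fun x => by
      rw [abs_of_nonneg (h0 x)]; exact min_le_right _ _
    have hb' : ∀ x, |J.avg (fun z => min (lin c z) (N : ℝ)) x| ≤ N := fun x => by
      rw [abs_of_nonneg (avg_nonneg h0 x)]
      exact (avg_mono (fun z => min_le_right _ _) x).trans_eq (avg_const (J := J) (N : ℝ) x)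
    have h1 := hν.tsum_avg hfin h0
    rw [← sub_eq_zero, ← (summable_mul hfin hb').tsum_sub (summable_mul hfin hb)] at h1
    rw [← h1]
    refine tsum_congr fun x => ?_
    rw [← mul_sub, avg_sub_self]
  have hlim : Tendsto (fun N : ℕ => ∑' x, (ν x).toReal *
      ∑ e, J.eventProb e * (min (lin c (step x e)) N - min (lin c x) N)) atTop
      (nhds (∑' x, (ν x).toReal * ∑ e, J.eventProb e * (lin c (step x e) - lin c x))) := by
    refine tendsto_tsum_of_dominated_convergence
      (bound := fun x => (ν x).toReal * (2 * B))
      ((ENNReal.summable_toReal hfin).mul_right _) (fun x => ?_) (Eventually.of_forall fun N x => ?_)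
    · refine tendsto_const_nhds.mul (tendsto_finsetSum _ fun e _ => tendsto_const_nhds.mul ?_)
      have hev : ∀ y : ℝ, Tendsto (fun N : ℕ => min y (N : ℝ)) atTop (nhds y) := fun y =>
        tendsto_const_nhds.congr' <| by
          filter_upwards [eventually_ge_atTop ⌈y⌉₊] with N hN
          exact (min_eq_left ((Nat.le_ceil y).trans (by exact_mod_cast hN))).symm
      exact (hev _).sub (hev _)
    · rw [norm_mul, Real.norm_of_nonneg ENNReal.toReal_nonneg]
      refine mul_le_mul_of_nonneg_left ?_ ENNReal.toReal_nonneg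
      refine (Finset.abs_sum_le_sum_abs _ _).trans ?_
      calc _ ≤ ∑ e, J.eventProb e * (2 * B) := by
            refine Finset.sum_le_sum fun e _ => ?_
            rw [abs_mul, abs_of_nonneg (J.eventProb_nonneg e)]
            exact mul_le_mul_of_nonneg_left
              ((abs_min_sub_min_le _ _ _).trans (abs_lin_step_le hB x e)) (J.eventProb_nonneg e)
        _ = 2 * B := by rw [← Finset.sum_mul, J.sum_eventProb, one_mul]
  simp only [hzero] at hlim
  exact (tendsto_nhds_unique hlim tendsto_const_nhds)

/-- Maximum principle: for a null vector `v`, the substochastic average can attain the maximum of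
`|v|` at a station only if that station has no exit and all its successors attain the maximum too.
Following routes from a maximiser contradicts the existence of an exit. -/
theorem IsOpenNetwork.det_ne_zero (h : J.IsOpenNetwork) : (1 - J.route).det ≠ 0 := by
  intro hdet
  obtain ⟨v, hv, hv0⟩ := Matrix.exists_mulVec_eq_zero_iff.2 hdet
  have heq : ∀ i, v i = ∑ j, J.route i j * v j := fun i => by
    have := congrFun hv0 i
    rw [Matrix.sub_mulVec, Matrix.one_mulVec] at this
    simpa [Matrix.mulVec, dotProduct, sub_eq_zero] using this
  obtain ⟨i₀, hi₀⟩ := Function.ne_iff.1 hv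
  have : Nonempty (Fin d) := ⟨i₀⟩
  obtain ⟨m, hm⟩ := Finite.exists_max fun i => |v i|
  have hpos : 0 < |v m| := lt_of_lt_of_le (abs_pos.2 hi₀) (hm i₀)
  have key : ∀ i, |v i| = |v m| → J.exitProb i = 0 ∧ ∀ j, 0 < J.route i j → |v j| = |v m| := by
    intro i hi
    have h1 : |v m| ≤ ∑ j, J.route i j * |v j| := by
      rw [← hi, heq i]
      refine (Finset.abs_sum_le_sum_abs _ _).trans (le_of_eq ?_)
      exact Finset.sum_congr rfl fun j _ => by rw [abs_mul, abs_of_nonneg (J.route_nonneg i j)]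
    have h2 : ∑ j, J.route i j * (|v m| - |v j|) + J.exitProb i * |v m| ≤ 0 := by
      simp only [mul_sub, Finset.sum_sub_distrib, ← Finset.sum_mul, exitProb]
      linarith
    have h3 : ∀ j, 0 ≤ J.route i j * (|v m| - |v j|) := fun j =>
      mul_nonneg (J.route_nonneg i j) (sub_nonneg.2 (hm j))
    have h4 : 0 ≤ J.exitProb i * |v m| := mul_nonneg (J.exitProb_nonneg i) hpos.le
    have h5 : 0 ≤ ∑ j, J.route i j * (|v m| - |v j|) := Finset.sum_nonneg fun j _ => h3 j
    refine ⟨?_, fun j hj => ?_⟩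
    · have : J.exitProb i * |v m| = 0 := by linarith
      exact (mul_eq_zero.1 this).resolve_right hpos.ne'
    · have h6 : ∑ j, J.route i j * (|v m| - |v j|) = 0 := by linarith
      have h7 := (Finset.sum_eq_zero_iff_of_nonneg fun j _ => h3 j).1 h6 j (Finset.mem_univ j)
      have := (mul_eq_zero.1 h7).resolve_left hj.ne'
      linarith
  have reach : ∀ j, Relation.ReflTransGen (fun a b => 0 < J.route a b) m j → |v j| = |v m| := by
    intro j hj
    induction hj with
    | refl => rfl
    | tail _ hbc ih => exact (key _ ih).2 _ hbc
  obtain ⟨j, hj, hex⟩ := h.2 m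
  exact hex.ne' (key j (reach j hj)).1

/-- This is flow balance for the coordinate `x i`, whose drift is the arrival rate plus what busy
stations send to `i` minus what a busy `i` serves. -/
theorem IsInvariant.traffic_equation {ν : (Fin d → ℕ) → ℝ≥0∞} (hν : J.IsInvariant ν)
    (h1 : ∑' x, ν x = 1) :
    Matrix.vecMul (fun i => J.srv i * ∑' x, (ν x).toReal * if x i = 0 then 0 else 1)
      (1 - J.route) = J.arr := by
  have hfin : ∑' x, ν x ≠ ∞ := by rw [h1]; exact ENNReal.one_ne_top
  funext i
  have h := hν.flow_balance hfin (Pi.single i 1) fun j => by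
    by_cases hj : j = i
    · subst hj; simp
    · simp [hj]
  have hs : ∀ k : Fin d, Summable fun x : Fin d → ℕ =>
      (ν x).toReal * if x k = 0 then (0 : ℝ) else 1 := fun k =>
    summable_mul hfin (c := 1) fun x => by split_ifs <;> simp
  have hterm : ∀ x : Fin d → ℕ, (ν x).toReal *
      ∑ e, J.eventProb e * (lin (Pi.single i 1) (step x e) - lin (Pi.single i 1) x) =
      (ν x).toReal * J.arr i + ∑ k, J.srv k * (J.route k i - if k = i then 1 else 0) *
        ((ν x).toReal * if x k = 0 then 0 else 1) := fun x => by
    rw [drift_lin, mul_add, Finset.mul_sum Finset.univ (fun k => ite (x k = 0) _ _)]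
    congr 1
    · simp [Pi.single_apply]
    · refine Finset.sum_congr rfl fun k _ => ?_
      split_ifs <;> simp_all [Pi.single_apply] <;> ring
  rw [tsum_congr hterm, Summable.tsum_add ((ENNReal.summable_toReal hfin).mul_right _)
    (summable_sum fun k _ => (hs k).mul_left _), tsum_mul_right,
    ← ENNReal.tsum_toReal_eq (ENNReal.ne_top_of_tsum_ne_top hfin), h1, ENNReal.toReal_one, one_mul,
    Summable.tsum_finsetSum fun k _ => (hs k).mul_left _] at h
  simp only [tsum_mul_left] at h
  rw [Matrix.vecMul_sub, Matrix.vecMul_one, Pi.sub_apply]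
  simp only [Matrix.vecMul, dotProduct]
  have key : ∀ b : Fin d → ℝ,
      J.arr i + ∑ k, J.srv k * (J.route k i - if k = i then 1 else 0) * b k = 0 →
      J.srv i * b i - ∑ k, J.srv k * b k * J.route k i = J.arr i := fun b hb => by
    have h2 : ∑ k, J.srv k * (J.route k i - if k = i then 1 else 0) * b k =
        ∑ k, J.srv k * b k * J.route k i - ∑ k, if k = i then J.srv k * b k else 0 := by
      rw [← Finset.sum_sub_distrib]
      exact Finset.sum_congr rfl fun k _ => by split_ifs <;> ring
    rw [h2, Finset.sum_ite_eq', if_pos (Finset.mem_univ i)] at hb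
    linarith
  exact key _ h

/-- The traffic intensity is the stationary probability that the station is busy. -/
theorem IsInvariant.rho_eq {ν : (Fin d → ℕ) → ℝ≥0∞} (hν : J.IsInvariant ν)
    (h1 : ∑' x, ν x = 1) (hopen : J.IsOpenNetwork) (i : Fin d) :
    J.rho i = ∑' x, (ν x).toReal * if x i = 0 then 0 else 1 := by
  rw [rho, ← hν.traffic_equation h1, Matrix.vecMul_vecMul,
    Matrix.mul_nonsing_inv _ hopen.det_ne_zero.isUnit, Matrix.vecMul_one,
    mul_div_cancel_left₀ _ (J.srv_pos i).ne']

theorem vecMul_rho (hopen : J.IsOpenNetwork) :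
    Matrix.vecMul (fun i => J.srv i * J.rho i) (1 - J.route) = J.arr := by
  have : (fun i => J.srv i * J.rho i) = Matrix.vecMul J.arr (1 - J.route)⁻¹ := by
    funext i
    rw [rho, mul_div_cancel₀ _ (J.srv_pos i).ne']
  rw [this, Matrix.vecMul_vecMul, Matrix.nonsing_inv_mul _ hopen.det_ne_zero.isUnit,
    Matrix.vecMul_one]

theorem traffic_rho (hopen : J.IsOpenNetwork) (i : Fin d) :
    J.srv i * J.rho i = J.arr i + ∑ j, J.srv j * J.rho j * J.route j i := by
  have h := congrFun (vecMul_rho hopen) i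
  rw [Matrix.vecMul_sub, Matrix.vecMul_one, Pi.sub_apply] at h
  simp only [Matrix.vecMul, dotProduct] at h
  linarith

theorem rho_nonneg (hopen : J.IsOpenNetwork) (hst : J.IsStable) (i : Fin d) : 0 ≤ J.rho i := by
  obtain ⟨ν, hν, h1⟩ := hst.exists_isInvariant
  rw [hν.rho_eq h1 hopen]
  exact tsum_nonneg fun x => mul_nonneg ENNReal.toReal_nonneg (by split_ifs <;> simp)

/-- Through the traffic equation, positivity starts at a station with external arrivals and
propagates along the routes. -/
theorem rho_pos (hopen : J.IsOpenNetwork) (hst : J.IsStable) (i : Fin d) : 0 < J.rho i := by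
  have hnn := rho_nonneg hopen hst
  have hterm : ∀ i j, 0 ≤ J.srv j * J.rho j * J.route j i := fun i j =>
    mul_nonneg (mul_nonneg (J.srv_pos j).le (hnn j)) (J.route_nonneg j i)
  have hpos : ∀ i, 0 < J.srv i * J.rho i → 0 < J.rho i := fun i h =>
    (pos_iff_pos_of_mul_pos h).1 (J.srv_pos i)
  obtain ⟨j, hj, hji⟩ := hopen.1 i
  induction hji with
  | refl =>
    refine hpos _ ?_
    rw [traffic_rho hopen]
    exact add_pos_of_pos_of_nonneg hj (Finset.sum_nonneg fun k _ => hterm _ k)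
  | @tail b c _ hbc ih =>
    refine hpos _ ?_
    rw [traffic_rho hopen]
    refine add_pos_of_nonneg_of_pos (J.arr_nonneg _) ?_
    exact Finset.sum_pos' (fun k _ => hterm _ k)
      ⟨b, Finset.mem_univ b, mul_pos (mul_pos (J.srv_pos b) ih) hbc⟩

/-- Some state carries mass, and a sequence of positive probability drains it to the origin. -/
theorem IsInvariant.pos_zero {ν : (Fin d → ℕ) → ℝ≥0∞} (hν : J.IsInvariant ν)
    (h1 : ∑' x, ν x = 1) (hopen : J.IsOpenNetwork) : 0 < ν 0 := by
  obtain ⟨x, hx⟩ : ∃ x, ν x ≠ 0 := by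
    by_contra! hcon
    simp [hcon] at h1
  obtain ⟨l, hl, hrun⟩ := hopen.exists_drain_list (∑ i, x i)
  have h0 : run x l = 0 := eq_zero_of_sum_eq_zero (by simpa using hrun x)
  rw [← h0]
  exact lt_of_lt_of_le (ENNReal.mul_pos hx (ENNReal.ofReal_pos.2 hl).ne') (hν.mul_listProb_le l x)

/-- The intensity is the stationary busy probability, and the origin, where every station is idle,
has positive mass. -/
theorem rho_lt_one (hopen : J.IsOpenNetwork) (hst : J.IsStable) (i : Fin d) : J.rho i < 1 := by
  obtain ⟨ν, hν, h1⟩ := hst.exists_isInvariant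
  have hfin : ∑' x, ν x ≠ ∞ := by rw [h1]; exact ENNReal.one_ne_top
  have hone : ∑' x, (ν x).toReal = 1 := by
    rw [← ENNReal.tsum_toReal_eq (ENNReal.ne_top_of_tsum_ne_top hfin), h1, ENNReal.toReal_one]
  rw [hν.rho_eq h1 hopen]
  refine lt_of_lt_of_eq (b := ∑' x, (ν x).toReal) ?_ hone
  refine Summable.tsum_lt_tsum (i := (0 : Fin d → ℕ)) (fun x => ?_) ?_
    (summable_mul hfin (c := 1) fun x => by split_ifs <;> simp) (ENNReal.summable_toReal hfin)
  · exact mul_le_of_le_one_right ENNReal.toReal_nonneg (by split_ifs <;> simp)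
  · simpa using ENNReal.toReal_pos (hν.pos_zero h1 hopen).ne'
      (ENNReal.ne_top_of_tsum_ne_top hfin 0)

end JacksonNetwork
end

/-! ### The chain killed at the origin: hitting probabilities as least supersolutions. -/

noncomputable section

namespace JacksonNetwork

open JacksonEvent
open scoped ENNReal

variable {d : ℕ} (J : JacksonNetwork d)

open Classical in
/-- The one-step expectation for the chain killed at the origin. -/
def killedAvg (f : (Fin d → ℕ) → ℝ≥0∞) (x : Fin d → ℕ) : ℝ≥0∞ :=
  ∑ e, ENNReal.ofReal (J.eventProb e) * if step x e = 0 then 0 else f (step x e)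

open Classical in
/-- The expectation of `f` at the first entry into `A`, if this happens within `k` steps and
before the killing at the origin. -/
def entryIter (A : Set (Fin d → ℕ)) (f : (Fin d → ℕ) → ℝ≥0∞) : ℕ → (Fin d → ℕ) → ℝ≥0∞
  | 0, z => if z ∈ A then f z else 0
  | k + 1, z => if z ∈ A then f z else J.killedAvg (entryIter A f k) z

/-- The expectation of `f` at the first entry into `A`, if this happens before the killing at the
origin. -/
def entryVal (A : Set (Fin d → ℕ)) (f : (Fin d → ℕ) → ℝ≥0∞) (z : Fin d → ℕ) : ℝ≥0∞ :=
  ⨆ k, J.entryIter A f k z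

/-- The probability of hitting `A` before the origin. -/
def hit (A : Set (Fin d → ℕ)) : (Fin d → ℕ) → ℝ≥0∞ := J.entryVal A fun _ => 1

variable {J}

theorem sum_ofReal_eventProb : ∑ e, ENNReal.ofReal (J.eventProb e) = 1 := by
  rw [← ENNReal.ofReal_sum_of_nonneg fun e _ => J.eventProb_nonneg e, J.sum_eventProb,
    ENNReal.ofReal_one]

theorem killedAvg_mono {f g : (Fin d → ℕ) → ℝ≥0∞} (h : ∀ x, f x ≤ g x) (x : Fin d → ℕ) :
    J.killedAvg f x ≤ J.killedAvg g x := by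
  refine Finset.sum_le_sum fun e _ => ?_
  gcongr
  split_ifs
  · exact le_rfl
  · exact h _

theorem entryIter_mono (A : Set (Fin d → ℕ)) (f : (Fin d → ℕ) → ℝ≥0∞) (z : Fin d → ℕ) :
    Monotone fun k => J.entryIter A f k z := by
  refine monotone_nat_of_le_succ fun k => ?_
  induction k generalizing z with
  | zero =>
    by_cases hz : z ∈ A <;> simp [entryIter, hz]
  | succ k ih =>
    by_cases hz : z ∈ A
    · simp [entryIter, hz]
    · rw [entryIter, entryIter, if_neg hz, if_neg hz]
      exact killedAvg_mono ih z

theorem entryVal_of_mem {A : Set (Fin d → ℕ)} (f : (Fin d → ℕ) → ℝ≥0∞) {z : Fin d → ℕ}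
    (hz : z ∈ A) : J.entryVal A f z = f z := by
  refine le_antisymm (iSup_le fun k => ?_) (le_iSup_of_le 0 ?_)
  · cases k <;> simp [entryIter, hz]
  · simp [entryIter, hz]

theorem entryVal_of_notMem {A : Set (Fin d → ℕ)} (f : (Fin d → ℕ) → ℝ≥0∞) {z : Fin d → ℕ}
    (hz : z ∉ A) : J.entryVal A f z = J.killedAvg (J.entryVal A f) z := by
  have h1 : J.entryVal A f z = ⨆ k, J.killedAvg (J.entryIter A f k) z := by
    rw [entryVal, ← (entryIter_mono A f z).iSup_nat_add 1]
    exact iSup_congr fun k => by rw [entryIter, if_neg hz]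
  rw [h1]
  simp only [killedAvg]
  rw [← ENNReal.finsetSum_iSup_of_monotone]
  · refine Finset.sum_congr rfl fun e _ => ?_
    rw [← ENNReal.mul_iSup]
    congr 1
    split_ifs
    · simp
    · rfl
  · intro e k l hkl
    dsimp only
    gcongr
    split_ifs
    · exact le_rfl
    · exact entryIter_mono A f _ hkl

open Classical in
/-- Comparison with a supersolution, which may depend on a larger state. -/
theorem entryVal_le_of_super {A : Set (Fin d → ℕ)} {f : (Fin d → ℕ) → ℝ≥0∞} {Z : Type*}
    (φ : Z → Fin d → ℕ) (s : Z → JacksonEvent d → Z) (hs : ∀ z e, φ (s z e) = step (φ z) e)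
    (g : Z → ℝ≥0∞) (hA : ∀ z, φ z ∈ A → f (φ z) ≤ g z)
    (hg : ∀ z, φ z ∉ A → ∑ e, ENNReal.ofReal (J.eventProb e) *
      (if step (φ z) e = 0 then 0 else g (s z e)) ≤ g z) (z : Z) :
    J.entryVal A f (φ z) ≤ g z := by
  refine iSup_le fun k => ?_
  induction k generalizing z with
  | zero =>
    rw [entryIter]
    split_ifs with hz
    · exact hA z hz
    · exact zero_le
  | succ k ih =>
    rw [entryIter]
    split_ifs with hz
    · exact hA z hz
    · refine le_trans (Finset.sum_le_sum fun e _ => ?_) (hg z hz)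
      gcongr
      split_ifs
      · exact le_rfl
      · rw [← hs]; exact ih _

theorem killedAvg_le_one {f : (Fin d → ℕ) → ℝ≥0∞} (h : ∀ x, f x ≤ 1) (x : Fin d → ℕ) :
    J.killedAvg f x ≤ 1 := by
  rw [← sum_ofReal_eventProb (J := J)]
  refine Finset.sum_le_sum fun e _ => ?_
  refine mul_le_of_le_one_right' ?_
  split_ifs
  · exact zero_le
  · exact h _

theorem hit_of_mem {A : Set (Fin d → ℕ)} {z : Fin d → ℕ} (hz : z ∈ A) : J.hit A z = 1 :=
  entryVal_of_mem _ hz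

theorem hit_of_notMem {A : Set (Fin d → ℕ)} {z : Fin d → ℕ} (hz : z ∉ A) :
    J.hit A z = J.killedAvg (J.hit A) z := entryVal_of_notMem _ hz

theorem hit_le_one (A : Set (Fin d → ℕ)) (z : Fin d → ℕ) : J.hit A z ≤ 1 :=
  entryVal_le_of_super (J := J) id step (fun _ _ => rfl) (fun _ => 1) (fun _ _ => le_rfl)
    (fun z _ => killedAvg_le_one (J := J) (fun _ => le_rfl) z) z

theorem hit_ne_top (A : Set (Fin d → ℕ)) (z : Fin d → ℕ) : J.hit A z ≠ ∞ :=
  ne_top_of_le_ne_top ENNReal.one_ne_top (hit_le_one A z)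

theorem killedAvg_hit_le (A : Set (Fin d → ℕ)) (z : Fin d → ℕ) :
    J.killedAvg (J.hit A) z ≤ J.hit A z := by
  by_cases hz : z ∈ A
  · rw [hit_of_mem hz]; exact killedAvg_le_one (hit_le_one A) z
  · rw [hit_of_notMem hz]

/-- On ordered pairs driven by the same events, the hitting probability of the larger copy is a
supersolution for the smaller one: the smaller copy is killed whenever the larger is, and the larger
is in the upper set `A` whenever the smaller is. -/
theorem hit_mono_state {A : Set (Fin d → ℕ)} (hA : IsUpperSet A) {x y : Fin d → ℕ} (h : y ≤ x) :
    J.hit A y ≤ J.hit A x := by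
  classical
  refine entryVal_le_of_super (J := J) (Z := {p : (Fin d → ℕ) × (Fin d → ℕ) // p.2 ≤ p.1})
    (fun p => p.1.2) (fun p e => ⟨(step p.1.1 e, step p.1.2 e), step_mono p.2 e⟩)
    (fun _ _ => rfl) (fun p => J.hit A p.1.1) (fun p hp => (hit_of_mem (hA p.2 hp)).ge)
    (fun p _ => ?_) ⟨(x, y), h⟩
  refine le_trans (Finset.sum_le_sum fun e _ => ?_) (killedAvg_hit_le A p.1.1)
  gcongr
  by_cases h1 : step p.1.1 e = 0
  · have h2 : step p.1.2 e = 0 := le_antisymm (h1 ▸ step_mono p.2 e) zero_le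
    simp [h1, h2]
  · rw [if_neg h1]
    split_ifs
    · exact zero_le
    · exact le_rfl

/-- The tower property for nested target sets. -/
theorem entryVal_hit {A B : Set (Fin d → ℕ)} (h : B ⊆ A) (z : Fin d → ℕ) :
    J.entryVal A (J.hit B) z = J.hit B z := by
  refine le_antisymm ?_ ?_
  · exact entryVal_le_of_super (J := J) id step (fun _ _ => rfl) (J.hit B) (fun _ _ => le_rfl)
      (fun z _ => killedAvg_hit_le B z) z
  · refine entryVal_le_of_super (J := J) id step (fun _ _ => rfl) (J.entryVal A (J.hit B))
      (fun z hz => ?_) (fun z hz => ?_) z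
    · change z ∈ B at hz
      rw [entryVal_of_mem _ (h hz), hit_of_mem hz]
    · change z ∉ B at hz
      change J.killedAvg (J.entryVal A (J.hit B)) z ≤ J.entryVal A (J.hit B) z
      by_cases hzA : z ∈ A
      · rw [entryVal_of_mem _ hzA, hit_of_notMem hz]
        refine killedAvg_mono (fun y => ?_) z
        by_cases hy : y ∈ A
        · rw [entryVal_of_mem _ hy]
        · exact entryVal_le_of_super (J := J) id step (fun _ _ => rfl) (J.hit B)
            (fun _ _ => le_rfl) (fun z _ => killedAvg_hit_le B z) y
      · rw [entryVal_of_notMem _ hzA]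

theorem mul_hit_step_le (A : Set (Fin d → ℕ)) (z : Fin d → ℕ) {e : JacksonEvent d}
    (h : step z e ≠ 0) : ENNReal.ofReal (J.eventProb e) * J.hit A (step z e) ≤ J.hit A z := by
  refine le_trans ?_ (killedAvg_hit_le A z)
  rw [killedAvg]
  refine le_trans (le_of_eq ?_) (Finset.single_le_sum (fun _ _ => zero_le) (Finset.mem_univ e))
  rw [if_neg h]

theorem add_single_ne_zero (z : Fin d → ℕ) (i : Fin d) : z + Pi.single i 1 ≠ 0 := fun h => by
  have := congrFun h i
  simp at this

/-- An extra job can be brought to `i` by an external arrival followed by transfers. All states on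
the way contain that job, so no killing occurs, and the cost depends neither on the set nor on the
state. -/
theorem IsOpenNetwork.exists_mul_hit_add_single_le (h : J.IsOpenNetwork) (i : Fin d) :
    ∃ c : ℝ≥0∞, c ≠ 0 ∧ ∀ A z, c * J.hit A (z + Pi.single i 1) ≤ J.hit A z := by
  obtain ⟨j, hj, hji⟩ := h.1 i
  induction hji with
  | refl =>
    refine ⟨_, (ENNReal.ofReal_pos.2 hj).ne', fun A z => ?_⟩
    exact mul_hit_step_le (e := .arrival j) A z (add_single_ne_zero z j)
  | @tail b c _ hbc ih =>
    obtain ⟨t, ht, hA⟩ := ih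
    refine ⟨t * ENNReal.ofReal (J.eventProb (.transfer b c)), mul_ne_zero ht
      (ENNReal.ofReal_pos.2 (mul_pos (J.srv_pos b) hbc)).ne', fun A z => ?_⟩
    refine le_trans ?_ (hA A z)
    rw [mul_assoc]
    gcongr
    have := mul_hit_step_le (J := J) A (z + Pi.single b 1) (e := .transfer b c)
      (by rw [step_transfer_add]; exact add_single_ne_zero z c)
    rwa [step_transfer_add] at this

/-- Building `x` job by job transfers upper bounds from the origin to `x`; uniformity in `A` is what
matters, as the target varies with `n`. -/
theorem IsOpenNetwork.exists_mul_hit_le (h : J.IsOpenNetwork) (x : Fin d → ℕ) :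
    ∃ c : ℝ≥0∞, c ≠ 0 ∧ ∀ A, c * J.hit A x ≤ J.hit A 0 := by
  obtain ⟨n, hn⟩ : ∃ n, ∑ i, x i = n := ⟨_, rfl⟩
  induction n generalizing x with
  | zero => exact ⟨1, one_ne_zero, fun A => by rw [eq_zero_of_sum_eq_zero hn, one_mul]⟩
  | succ n ih =>
    obtain ⟨i, hi⟩ := Function.ne_iff.1 (show x ≠ 0 by rintro rfl; simp at hn)
    obtain ⟨z, rfl⟩ := exists_eq_add_single hi
    rw [sum_add_single] at hn
    obtain ⟨c, hc, hA⟩ := ih z (by omega)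
    obtain ⟨t, ht, hA'⟩ := h.exists_mul_hit_add_single_le i
    refine ⟨c * t, mul_ne_zero hc ht, fun A => ?_⟩
    rw [mul_assoc]
    exact (mul_le_mul_right (hA' A z) c).trans (hA A)

end JacksonNetwork
end

/-! ### Linear and exponential Lyapunov functions. -/

noncomputable section

namespace JacksonNetwork

open JacksonEvent
open scoped ENNReal

variable {d : ℕ} {J : JacksonNetwork d}

/-- Only `b ≥ 0` needs proof. The negative parts of `b` are dominated by their own image under
routing, strictly where `b` is negative; summing over all stations contradicts row sums at most one.
-/
theorem one_le_of_eq_one_add {b : Fin d → ℝ} (hb : ∀ i, b i = 1 + ∑ j, b j * J.route j i)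
    (i : Fin d) : 1 ≤ b i := by
  have hnn : ∀ i, 0 ≤ b i := by
    by_contra! hcon
    obtain ⟨i₀, hi₀⟩ := hcon
    have hle : ∀ i, max (-b i) 0 ≤ ∑ j, max (-b j) 0 * J.route j i := fun i => by
      have h0 : 0 ≤ ∑ j, max (-b j) 0 * J.route j i :=
        Finset.sum_nonneg fun j _ => mul_nonneg (le_max_right _ _) (J.route_nonneg j i)
      refine max_le ?_ h0
      have : ∑ j, -b j * J.route j i ≤ ∑ j, max (-b j) 0 * J.route j i :=
        Finset.sum_le_sum fun j _ =>
          mul_le_mul_of_nonneg_right (le_max_left _ _) (J.route_nonneg j i)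
      simp only [neg_mul, Finset.sum_neg_distrib] at this
      linarith [hb i]
    have hlt : max (-b i₀) 0 < ∑ j, max (-b j) 0 * J.route j i₀ := by
      rw [max_eq_left (by linarith)]
      have : ∑ j, -b j * J.route j i₀ ≤ ∑ j, max (-b j) 0 * J.route j i₀ :=
        Finset.sum_le_sum fun j _ =>
          mul_le_mul_of_nonneg_right (le_max_left _ _) (J.route_nonneg j i₀)
      simp only [neg_mul, Finset.sum_neg_distrib] at this
      linarith [hb i₀]
    have h1 : ∑ i, max (-b i) 0 < ∑ i, ∑ j, max (-b j) 0 * J.route j i :=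
      Finset.sum_lt_sum (fun i _ => hle i) ⟨i₀, Finset.mem_univ _, hlt⟩
    rw [Finset.sum_comm] at h1
    have h2 : ∑ j, ∑ i, max (-b j) 0 * J.route j i ≤ ∑ j, max (-b j) 0 :=
      Finset.sum_le_sum fun j _ => by
        rw [← Finset.mul_sum]
        exact mul_le_of_le_one_right (le_max_right _ _) (J.route_sum_le_one j)
    linarith
  rw [hb i]
  linarith [Finset.sum_nonneg (s := Finset.univ) fun j (_ : j ∈ Finset.univ) =>
    mul_nonneg (hnn j) (J.route_nonneg j i)]

/-- Second-order expansion of the exponential, valid because the increments of `t * lin c` are at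
most one in absolute value. -/
theorem avg_exp_lin_le {c : Fin d → ℝ} {B t : ℝ} (hB : ∀ i, |c i| ≤ B) (ht : 0 ≤ t)
    (htB : t * (2 * B) ≤ 1) (x : Fin d → ℕ) :
    J.avg (fun z => Real.exp (t * lin c z)) x ≤ Real.exp (t * lin c x) *
      (1 + t * ∑ e, J.eventProb e * (lin c (step x e) - lin c x) + (t * (2 * B)) ^ 2) := by
  have h1 : 1 + t * ∑ e, J.eventProb e * (lin c (step x e) - lin c x) + (t * (2 * B)) ^ 2 =
      ∑ e, J.eventProb e * (1 + t * (lin c (step x e) - lin c x) + (t * (2 * B)) ^ 2) := by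
    simp only [mul_add, Finset.sum_add_distrib, ← Finset.sum_mul, J.sum_eventProb, one_mul,
      Finset.mul_sum]
    congr 2
    exact Finset.sum_congr rfl fun e _ => by ring
  rw [h1, Finset.mul_sum, avg]
  refine Finset.sum_le_sum fun e _ => ?_
  have h2 : Real.exp (t * lin c (step x e)) =
      Real.exp (t * lin c x) * Real.exp (t * (lin c (step x e) - lin c x)) := by
    rw [← Real.exp_add]; congr 1; ring
  have h3 : |t * (lin c (step x e) - lin c x)| ≤ t * (2 * B) := by
    rw [abs_mul, abs_of_nonneg ht]
    exact mul_le_mul_of_nonneg_left (abs_lin_step_le hB x e) ht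
  have h4 := (abs_le.1 (Real.abs_exp_sub_one_sub_id_le (h3.trans htB))).2
  have h5 : (t * (lin c (step x e) - lin c x)) ^ 2 ≤ (t * (2 * B)) ^ 2 :=
    sq_le_sq' (abs_le.1 h3).1 (abs_le.1 h3).2
  rw [h2, mul_left_comm]
  refine mul_le_mul_of_nonneg_left ?_ (Real.exp_pos _).le
  exact mul_le_mul_of_nonneg_left (by linarith) (J.eventProb_nonneg e)

theorem avg_finset_sum {ι : Type*} (s : Finset ι) (f : ι → (Fin d → ℕ) → ℝ) (x : Fin d → ℕ) :
    J.avg (fun z => ∑ i ∈ s, f i z) x = ∑ i ∈ s, J.avg (f i) x := by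
  simp only [avg, Finset.mul_sum]
  exact Finset.sum_comm

/-- Linear functions whose maximum is a Lyapunov function of the network: each of them decreases
unless its station is empty, and then it is not close to the maximum. -/
theorem exists_lyapunov_lin [Nonempty (Fin d)] (hopen : J.IsOpenNetwork)
    (hst : J.IsStable) : ∃ (c : Fin d → Fin d → ℝ) (γ δ : ℝ), 0 < γ ∧ 0 < δ ∧ δ ≤ 1 ∧
      (∀ i x, x i ≠ 0 → ∑ e, J.eventProb e * (lin (c i) (step x e) - lin (c i) x) ≤ -γ) ∧
      (∀ x m, (∀ i, lin (c i) x ≤ m) → ∑ i, (x i : ℝ) ≤ d * m ∧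
        ∀ i, x i = 0 → lin (c i) x ≤ (1 - δ) * m) := by
  have hunit := hopen.det_ne_zero.isUnit
  set G := (1 - J.route)⁻¹ with hG
  set b : Fin d → ℝ := Matrix.vecMul (fun _ => 1) G with hbdef
  have hb : ∀ i, b i = 1 + ∑ j, b j * J.route j i := fun i => by
    have h1 : Matrix.vecMul b (1 - J.route) = fun _ => 1 := by
      rw [hbdef, Matrix.vecMul_vecMul, hG, Matrix.nonsing_inv_mul _ hunit, Matrix.vecMul_one]
    have h2 := congrFun h1 i
    rw [Matrix.vecMul_sub, Matrix.vecMul_one, Pi.sub_apply] at h2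
    simp only [Matrix.vecMul, dotProduct] at h2
    linarith
  have hb1 := one_le_of_eq_one_add hb
  have hb0 : ∀ i, 0 < b i := fun i => zero_lt_one.trans_le (hb1 i)
  -- With the `i`-th column of `(1 - P)⁻¹` as coefficients, service at any station other than `i` is
  -- neutral on average, so the drift depends only on whether `i` is busy. Dividing by the column
  -- sum `b i` makes the functions comparable with one another.
  let c : Fin d → Fin d → ℝ := fun i j => G j i / b i
  have hdrift : ∀ i x, ∑ e, J.eventProb e * (lin (c i) (step x e) - lin (c i) x) =
      J.srv i / b i * (J.rho i - if x i = 0 then 0 else 1) := fun i x => by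
    have hIG : ∀ k, ∑ j, J.route k j * c i j - c i k = - (if k = i then 1 else 0) / b i :=
      fun k => by
        have h1 := congrFun (congrFun (Matrix.mul_nonsing_inv _ hunit) k) i
        rw [← hG, sub_mul, one_mul, Matrix.sub_apply, Matrix.mul_apply, Matrix.one_apply] at h1
        have h2 : ∑ j, J.route k j * c i j = (∑ j, J.route k j * G j i) / b i := by
          rw [Finset.sum_div]
          exact Finset.sum_congr rfl fun j _ => (mul_div_assoc _ _ _).symm
        rw [h2, ← h1]
        simp only [c]
        ring
    have harr : ∑ k, J.arr k * c i k = J.srv i * J.rho i / b i := by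
      have h2 : ∑ k, J.arr k * c i k = (∑ k, J.arr k * G k i) / b i := by
        rw [Finset.sum_div]
        exact Finset.sum_congr rfl fun j _ => (mul_div_assoc _ _ _).symm
      rw [h2, rho, mul_div_cancel₀ _ (J.srv_pos i).ne']
      rfl
    rw [drift_lin, harr]
    simp only [hIG]
    rw [Finset.sum_eq_single i]
    · simp only [if_true]; split_ifs <;> ring
    · intro k _ hk; simp [hk]
    · simp
  have hsum : ∀ x : Fin d → ℕ, ∀ i, b i * lin (c i) x = Matrix.vecMul (fun j => (x j : ℝ)) G i :=
    fun x i => by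
      simp only [lin, Finset.mul_sum, Matrix.vecMul, dotProduct, c]
      refine Finset.sum_congr rfl fun j _ => ?_
      field_simp [(hb0 i).ne']
  -- Recovering `x` from these functions gives both final bounds: summed over `i`, it controls the
  -- population by their maximum; at an empty station, it forces `b i * lin (c i) x ≤ (b i - 1) *
  -- m`.
  have hinv : ∀ x : Fin d → ℕ, ∀ i,
      (x i : ℝ) = b i * lin (c i) x - ∑ j, b j * lin (c j) x * J.route j i := fun x i => by
    have h1 : Matrix.vecMul (Matrix.vecMul (fun j => (x j : ℝ)) G) (1 - J.route) =
        fun j => (x j : ℝ) := by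
      rw [Matrix.vecMul_vecMul, hG, Matrix.nonsing_inv_mul _ hunit, Matrix.vecMul_one]
    have h2 := congrFun h1 i
    rw [Matrix.vecMul_sub, Matrix.vecMul_one, Pi.sub_apply] at h2
    have h3 : ∑ j, b j * lin (c j) x * J.route j i =
        Matrix.vecMul (Matrix.vecMul (fun j => (x j : ℝ)) G) J.route i :=
      Finset.sum_congr rfl fun j _ => by rw [hsum]
    rw [← h2, hsum, h3]
  obtain ⟨i₁, hi₁⟩ := Finite.exists_min fun i => J.srv i / b i * (1 - J.rho i)
  have hcoef : ∀ i, 0 < J.srv i / b i := fun i => div_pos (J.srv_pos i) (hb0 i)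
  have hbsum : ∀ i, b i ≤ ∑ j, b j := fun i =>
    Finset.single_le_sum (f := b) (fun j _ => (hb0 j).le) (Finset.mem_univ i)
  obtain ⟨i₂⟩ := ‹Nonempty (Fin d)›
  have hbs1 : 1 ≤ ∑ j, b j := (hb1 i₂).trans (hbsum i₂)
  -- Here `γ` is the weakest of the busy-station drifts, and `δ` is a common lower bound for the
  -- gaps `1 / b i`.
  refine ⟨c, J.srv i₁ / b i₁ * (1 - J.rho i₁), (∑ j, b j)⁻¹,
    mul_pos (hcoef _) (sub_pos.2 (rho_lt_one hopen hst _)), by positivity, inv_le_one_of_one_le₀ hbs1,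
    fun i x hx => ?_, fun x m hm => ?_⟩
  · rw [hdrift, if_neg hx]
    linarith [hi₁ i]
  · have hle : ∑ i, (x i : ℝ) ≤ d * m := by
      have h1 : ∑ i, (x i : ℝ) = ∑ i, b i * lin (c i) x * J.exitProb i := by
        rw [Finset.sum_congr rfl fun i _ => hinv x i, Finset.sum_sub_distrib, Finset.sum_comm,
          ← Finset.sum_sub_distrib]
        refine Finset.sum_congr rfl fun i _ => ?_
        rw [← Finset.mul_sum, exitProb]; ring
      have h2 : (d : ℝ) = ∑ i, b i * J.exitProb i := by
        have : ∑ i, (b i - ∑ j, b j * J.route j i) = ∑ _i : Fin d, (1 : ℝ) :=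
          Finset.sum_congr rfl fun i _ => by linarith [hb i]
        rw [Finset.sum_sub_distrib, Finset.sum_comm, ← Finset.sum_sub_distrib] at this
        simp only [Finset.sum_const, Finset.card_univ, Fintype.card_fin, nsmul_eq_mul,
          mul_one] at this
        rw [← this]
        refine Finset.sum_congr rfl fun i _ => ?_
        rw [← Finset.mul_sum, exitProb]; ring
      rw [h1, h2, Finset.sum_mul]
      refine Finset.sum_le_sum fun i _ => ?_
      have := mul_le_mul_of_nonneg_left (hm i) (mul_nonneg (hb0 i).le (J.exitProb_nonneg i))
      linarith
    refine ⟨hle, fun i hi => ?_⟩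
    have hd : (0 : ℝ) < d := by exact_mod_cast Fin.pos i₂
    have hm0 : 0 ≤ m := by
      by_contra! hneg
      have : 0 ≤ ∑ i, (x i : ℝ) := Finset.sum_nonneg fun i _ => Nat.cast_nonneg _
      linarith [mul_neg_of_pos_of_neg hd hneg]
    have h1 := hinv x i
    rw [hi, Nat.cast_zero] at h1
    have h2 : ∑ j, b j * lin (c j) x * J.route j i ≤ ∑ j, b j * J.route j i * m :=
      Finset.sum_le_sum fun j _ => by
        have := mul_le_mul_of_nonneg_left (hm j) (mul_nonneg (hb0 j).le (J.route_nonneg j i))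
        linarith
    rw [← Finset.sum_mul] at h2
    have h3 : b i * lin (c i) x ≤ (b i - 1) * m := by
      have := hb i
      have h4 : ∑ j, b j * J.route j i = b i - 1 := by linarith
      rw [h4] at h2; linarith
    have h5 : lin (c i) x ≤ (1 - (b i)⁻¹) * m := by
      have := mul_le_mul_of_nonneg_left h3 (inv_pos.2 (hb0 i)).le
      rw [inv_mul_cancel_left₀ (hb0 i).ne'] at this
      refine this.trans_eq ?_
      field_simp [(hb0 i).ne']
    refine h5.trans (mul_le_mul_of_nonneg_right ?_ hm0)
    have := inv_anti₀ (hb0 i) (hbsum i)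
    linarith

/-- A Lyapunov function with exponential growth and geometric drift. -/
theorem exists_lyapunov [Nonempty (Fin d)] (hopen : J.IsOpenNetwork) (hst : J.IsStable) :
    ∃ (w : (Fin d → ℕ) → ℝ) (θ ε C : ℝ), 0 < θ ∧ 0 < ε ∧ ε < 1 ∧ 0 < C ∧
      (∀ x, Real.exp (θ * ∑ i, (x i : ℝ)) ≤ w x) ∧ ∀ x, J.avg w x ≤ (1 - ε) * w x + C := by
  obtain ⟨c, γ, δ, hγ, hδ, hδ1, hneg, hmax⟩ := exists_lyapunov_lin hopen hst
  have hd : (0 : ℝ) < d := by exact_mod_cast Fin.pos (Classical.arbitrary (Fin d))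
  obtain ⟨B, hB0, hB⟩ : ∃ B : ℝ, 0 < B ∧ ∀ i j, |c i j| ≤ B := by
    refine ⟨1 + ∑ i, ∑ j, |c i j|, by positivity, fun i j => ?_⟩
    have h1 : |c i j| ≤ ∑ j, |c i j| :=
      Finset.single_le_sum (f := fun j => |c i j|) (fun _ _ => abs_nonneg _) (Finset.mem_univ j)
    have h2 : ∑ j, |c i j| ≤ ∑ i, ∑ j, |c i j| :=
      Finset.single_le_sum (f := fun i => ∑ j, |c i j|)
        (fun _ _ => Finset.sum_nonneg fun _ _ => abs_nonneg _) (Finset.mem_univ i)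
    linarith
  -- The three conditions allow the expansion of the exponential, keep the contraction factor
  -- nonnegative, and make the quadratic error at most half of the linear gain.
  obtain ⟨t, ht, ht1, ht2, ht3⟩ : ∃ t : ℝ, 0 < t ∧ t * (2 * B) ≤ 1 ∧ t * γ ≤ 1 ∧
      (t * (2 * B)) ^ 2 ≤ t * γ / 2 := by
    refine ⟨min (1 / (2 * B)) (min (1 / γ) (γ / (8 * B ^ 2))), by positivity, ?_, ?_, ?_⟩
    · rw [← le_div_iff₀ (by positivity)]; exact min_le_left _ _
    · rw [← le_div_iff₀ hγ]; exact (min_le_right _ _).trans (min_le_left _ _)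
    · set t := min (1 / (2 * B)) (min (1 / γ) (γ / (8 * B ^ 2)))
      have ht0 : 0 < t := by positivity
      have : t ≤ γ / (8 * B ^ 2) := (min_le_right _ _).trans (min_le_right _ _)
      rw [le_div_iff₀ (by positivity)] at this
      nlinarith
  -- Beyond `m₀` the terms of empty stations, being of order `exp (t * (1 - δ) * m)`, are absorbed
  -- by half of the contraction of the maximal term; below `m₀` they are bounded by the constant
  -- `C`.
  obtain ⟨m₀, hm₀, hm₀'⟩ : ∃ m₀ : ℝ, 0 ≤ m₀ ∧
      3 * d * Real.exp (-(t * δ * m₀)) ≤ t * γ / 4 := by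
    have h1 : Tendsto (fun m : ℝ => 3 * d * Real.exp (-(t * δ * m))) atTop (nhds (3 * d * 0)) :=
      (Real.tendsto_exp_neg_atTop_nhds_zero.comp
        (tendsto_id.const_mul_atTop (by positivity : 0 < t * δ))).const_mul _
    rw [mul_zero] at h1
    obtain ⟨m, h2, h3⟩ := ((h1.eventually (gt_mem_nhds (by positivity : 0 < t * γ / 4))).and
      (eventually_ge_atTop 0)).exists
    exact ⟨m, h3, h2.le⟩
  refine ⟨fun x => ∑ i, Real.exp (t * lin (c i) x), t / d, t * γ / 4, 3 * d * Real.exp (t * m₀),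
    by positivity, by positivity, by linarith, by positivity, fun x => ?_, fun x => ?_⟩
  all_goals
    obtain ⟨i₀, hi₀⟩ := Finite.exists_max fun i => lin (c i) x
    have hw : Real.exp (t * lin (c i₀) x) ≤ ∑ i, Real.exp (t * lin (c i) x) :=
      Finset.single_le_sum (f := fun i => Real.exp (t * lin (c i) x))
        (fun _ _ => (Real.exp_pos _).le) (Finset.mem_univ i₀)
    obtain ⟨hM1, hM2⟩ := hmax x _ hi₀
    set m := lin (c i₀) x with hm
  · refine le_trans (Real.exp_le_exp.2 ?_) hw
    rw [div_mul_eq_mul_div, div_le_iff₀ hd]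
    have := mul_le_mul_of_nonneg_left hM1 ht.le
    linarith
  · have hm0 : 0 ≤ m := by
      by_contra! hcon
      have : 0 ≤ ∑ i, (x i : ℝ) := Finset.sum_nonneg fun i _ => Nat.cast_nonneg _
      linarith [mul_neg_of_pos_of_neg hd hcon]
    -- A busy station contracts its own exponential. For an empty one a step costs at most a factor
    -- `e < 3`, harmless since its value is far below the maximum.
    have hi : ∀ i, J.avg (fun z => Real.exp (t * lin (c i) z)) x ≤
        (1 - t * γ / 2) * Real.exp (t * lin (c i) x) + 3 * Real.exp (t * ((1 - δ) * m)) := by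
      intro i
      have hE := Real.exp_pos (t * lin (c i) x)
      have hE' := Real.exp_pos (t * ((1 - δ) * m))
      by_cases hxi : x i = 0
      · have h1 : J.avg (fun z => Real.exp (t * lin (c i) z)) x ≤
            3 * Real.exp (t * lin (c i) x) := by
          rw [← avg_const (J := J) (3 * Real.exp (t * lin (c i) x)) x]
          refine Finset.sum_le_sum fun e _ =>
            mul_le_mul_of_nonneg_left ?_ (J.eventProb_nonneg e)
          have h3 : t * lin (c i) (step x e) ≤ 1 + t * lin (c i) x := by
            have := mul_le_mul_of_nonneg_left (abs_le.1 (abs_lin_step_le (hB i) x e)).2 ht.le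
            linarith
          refine (Real.exp_le_exp.2 h3).trans ?_
          rw [Real.exp_add]
          exact mul_le_mul_of_nonneg_right Real.exp_one_lt_three.le hE.le
        have h2 : Real.exp (t * lin (c i) x) ≤ Real.exp (t * ((1 - δ) * m)) :=
          Real.exp_le_exp.2 (mul_le_mul_of_nonneg_left (hM2 i hxi) ht.le)
        have h3 : 0 ≤ (1 - t * γ / 2) * Real.exp (t * lin (c i) x) :=
          mul_nonneg (by linarith) hE.le
        linarith
      · have h1 := avg_exp_lin_le (J := J) (hB i) ht.le ht1 x
        have h2 := mul_le_mul_of_nonneg_left (hneg i x hxi) ht.le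
        have h3 : 1 + t * ∑ e, J.eventProb e * (lin (c i) (step x e) - lin (c i) x) +
            (t * (2 * B)) ^ 2 ≤ 1 - t * γ / 2 := by linarith
        have h4 := mul_le_mul_of_nonneg_left h3 hE.le
        linarith
    have hrest : 3 * d * Real.exp (t * ((1 - δ) * m)) ≤
        t * γ / 4 * Real.exp (t * m) + 3 * d * Real.exp (t * m₀) := by
      rcases le_total m₀ m with h | h
      · have h1 : Real.exp (t * ((1 - δ) * m)) =
            Real.exp (-(t * δ * m)) * Real.exp (t * m) := by
          rw [← Real.exp_add]; congr 1; ring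
        have h2 : Real.exp (-(t * δ * m)) ≤ Real.exp (-(t * δ * m₀)) :=
          Real.exp_le_exp.2 (neg_le_neg (mul_le_mul_of_nonneg_left h (by positivity)))
        have h3 : 3 * d * Real.exp (-(t * δ * m)) ≤ t * γ / 4 :=
          (mul_le_mul_of_nonneg_left h2 (by positivity)).trans hm₀'
        have h4 := mul_le_mul_of_nonneg_right h3 (Real.exp_pos (t * m)).le
        have h5 : 0 < 3 * d * Real.exp (t * m₀) := by positivity
        rw [h1]; linarith
      · have h1 : Real.exp (t * ((1 - δ) * m)) ≤ Real.exp (t * m₀) := by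
          refine Real.exp_le_exp.2 (mul_le_mul_of_nonneg_left ?_ ht.le)
          nlinarith
        have h2 : 0 < t * γ / 4 * Real.exp (t * m) := by positivity
        have := mul_le_mul_of_nonneg_left h1 (by positivity : (0 : ℝ) ≤ 3 * d)
        linarith
    rw [avg_finset_sum]
    have hsum := Finset.sum_le_sum fun i (_ : i ∈ Finset.univ) => hi i
    rw [Finset.sum_add_distrib, ← Finset.mul_sum, Finset.sum_const, Finset.card_univ,
      Fintype.card_fin, nsmul_eq_mul] at hsum
    have := mul_le_mul_of_nonneg_left hw (by positivity : 0 ≤ t * γ / 4)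
    linarith

end JacksonNetwork
end

/-! ### Coupling with an initially empty copy: the network empties before its population climbs. -/

noncomputable section

namespace JacksonNetwork

open JacksonEvent
open scoped ENNReal

variable {d : ℕ} (J : JacksonNetwork d)

open Classical in
/-- The one-step expectation for two copies of the chain driven by the same events, killed when the
first copy is at the origin. -/
def pairAvg (g : (Fin d → ℕ) → (Fin d → ℕ) → ℝ) (x y : Fin d → ℕ) : ℝ :=
  ∑ e, J.eventProb e * if step x e = 0 then 0 else g (step x e) (step y e)

variable {J}

/-- The exponential of the difference of the populations, times a function of the second state. -/
def expDiff (θ : ℝ) (u : (Fin d → ℕ) → ℝ) (x y : Fin d → ℕ) : ℝ :=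
  Real.exp (θ * (∑ i, (x i : ℝ) - ∑ i, (y i : ℝ))) * u y

theorem exp_diff_step_le {θ : ℝ} (hθ : 0 ≤ θ) {x y : Fin d → ℕ} (h : y ≤ x) (e : JacksonEvent d) :
    Real.exp (θ * (∑ i, (step x e i : ℝ) - ∑ i, (step y e i : ℝ))) ≤
      Real.exp (θ * (∑ i, (x i : ℝ) - ∑ i, (y i : ℝ))) := by
  refine Real.exp_le_exp.2 (mul_le_mul_of_nonneg_left ?_ hθ)
  have := sum_step_add_le h e
  have : (∑ i, (step x e i : ℝ)) + ∑ i, (y i : ℝ) ≤ ∑ i, (x i : ℝ) + ∑ i, (step y e i : ℝ) := by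
    exact_mod_cast this
  linarith

theorem avg_iterate_nonneg {u : (Fin d → ℕ) → ℝ} (hu : ∀ x, 0 ≤ u x) (n : ℕ) (x : Fin d → ℕ) :
    0 ≤ (J.avg)^[n] u x := by
  induction n generalizing x with
  | zero => exact hu x
  | succ n ih => rw [Function.iterate_succ_apply']; exact avg_nonneg ih x

theorem pairAvg_iterate_nonneg {g : (Fin d → ℕ) → (Fin d → ℕ) → ℝ} (hg : ∀ x y, 0 ≤ g x y) (n : ℕ)
    (x y : Fin d → ℕ) : 0 ≤ (J.pairAvg)^[n] g x y := by
  induction n generalizing x y with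
  | zero => exact hg x y
  | succ n ih =>
    rw [Function.iterate_succ_apply']
    refine Finset.sum_nonneg fun e _ => mul_nonneg (J.eventProb_nonneg e) ?_
    split_ifs
    · exact le_rfl
    · exact ih _ _

/-- The surplus never grows and killing only lowers the value, so the exponential factor can be
frozen while the second copy is averaged. -/
theorem pairAvg_iterate_expDiff_le {θ : ℝ} (hθ : 0 ≤ θ) {u : (Fin d → ℕ) → ℝ}
    (hu : ∀ x, 0 ≤ u x) (n : ℕ) {x y : Fin d → ℕ} (h : y ≤ x) :
    (J.pairAvg)^[n] (expDiff θ u) x y ≤ expDiff θ ((J.avg)^[n] u) x y := by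
  induction n generalizing x y with
  | zero => exact le_rfl
  | succ n ih =>
    rw [Function.iterate_succ_apply', Function.iterate_succ_apply', pairAvg, expDiff, avg,
      Finset.mul_sum]
    refine Finset.sum_le_sum fun e _ => ?_
    rw [mul_left_comm]
    refine mul_le_mul_of_nonneg_left ?_ (J.eventProb_nonneg e)
    have hn := avg_iterate_nonneg (J := J) hu n (step y e)
    split_ifs
    · exact mul_nonneg (Real.exp_pos _).le hn
    · exact (ih (step_mono h e)).trans (mul_le_mul_of_nonneg_right (exp_diff_step_le hθ h e) hn)

/-- The gain from one sequence of events, of probability `listProb l`, along which the population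
difference drops. -/
theorem pairAvg_iterate_expDiff_le_of_list {θ : ℝ} (hθ : 0 ≤ θ) {u : (Fin d → ℕ) → ℝ}
    (hu : ∀ x, 0 ≤ u x) (l : List (JacksonEvent d)) {x y : Fin d → ℕ} (h : y ≤ x)
    (hxl : x ≠ 0 ∨ l ≠ []) {R : ℝ} (hR0 : 0 ≤ R)
    (hR : run x l ≠ 0 → expDiff θ u (run x l) (run y l) ≤ R) :
    (J.pairAvg)^[l.length] (expDiff θ u) x y ≤
      expDiff θ ((J.avg)^[l.length] u) x y
        - J.listProb l * Real.exp (θ * (∑ i, (x i : ℝ) - ∑ i, (y i : ℝ))) * u (run y l)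
        + J.listProb l * R := by
  classical
  induction l generalizing x y with
  | nil =>
    have := hR (hxl.resolve_right (by simp))
    simp only [List.length_nil, Function.iterate_zero, id, listProb_nil, run_nil, one_mul,
      expDiff] at this ⊢
    linarith
  | cons e l ih =>
    set D := Real.exp (θ * (∑ i, (x i : ℝ) - ∑ i, (y i : ℝ))) with hD
    have hD0 : 0 < D := Real.exp_pos _
    set n := l.length with hn
    have hav : ∀ e, 0 ≤ (J.avg)^[n] u (step y e) := fun e => avg_iterate_nonneg hu n _
    have hgen : ∀ e', (if step x e' = 0 then 0 else
        (J.pairAvg)^[n] (expDiff θ u) (step x e') (step y e')) ≤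
        D * (J.avg)^[n] u (step y e') := fun e' => by
      split_ifs
      · exact mul_nonneg hD0.le (hav e')
      · exact (pairAvg_iterate_expDiff_le hθ hu n (step_mono h e')).trans
          (mul_le_mul_of_nonneg_right (exp_diff_step_le hθ h e') (hav e'))
    have hlow : ∀ v, J.listProb l * u (run v l) ≤ (J.avg)^[n] u v := by
      rw [hn]
      clear * - hu
      induction l with
      | nil => intro v; simp
      | cons e l ih =>
        intro v
        rw [List.length_cons, Function.iterate_succ_apply', listProb_cons, mul_assoc]
        refine le_trans ?_ (Finset.single_le_sum
          (f := fun e => J.eventProb e * (J.avg)^[l.length] u (step v e))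
          (fun e _ => mul_nonneg (J.eventProb_nonneg e) (avg_iterate_nonneg hu _ _))
          (Finset.mem_univ e))
        exact mul_le_mul_of_nonneg_left (ih _) (J.eventProb_nonneg e)
    -- The branch of the prescribed event carries the gain. If the first copy dies there, its value
    -- is zero and `hlow` shows that subtracting the weight of the remaining list leaves a
    -- nonnegative bound; otherwise induction applies.
    have hspec : (if step x e = 0 then 0 else
        (J.pairAvg)^[n] (expDiff θ u) (step x e) (step y e)) ≤
        D * (J.avg)^[n] u (step y e) - J.listProb l * D * u (run (step y e) l)
          + J.listProb l * R := by
      have hpl := J.listProb_nonneg l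
      split_ifs with hx
      · have h1 := mul_le_mul_of_nonneg_left (hlow (step y e)) hD0.le
        have h2 := mul_nonneg hpl hR0
        linarith
      · have h1 := ih (step_mono h e) (Or.inl hx) hR
        have h2 := exp_diff_step_le hθ h e
        rw [← hD] at h2
        have h3 : 0 ≤ (J.avg)^[n] u (step y e) - J.listProb l * u (run (step y e) l) :=
          sub_nonneg.2 (hlow _)
        have h4 := mul_le_mul_of_nonneg_right h2 h3
        rw [expDiff] at h1
        linarith
    -- All branches have nonnegative deficit, so the deficit of the branch `e` bounds their sum from
    -- below.
    have hsum : ∑ e', J.eventProb e' * (D * (J.avg)^[n] u (step y e') -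
        if step x e' = 0 then 0 else (J.pairAvg)^[n] (expDiff θ u) (step x e') (step y e')) ≥
        J.eventProb e * (J.listProb l * D * u (run (step y e) l) - J.listProb l * R) := by
      refine le_trans ?_ (Finset.single_le_sum (f := fun e' => J.eventProb e' *
        (D * (J.avg)^[n] u (step y e') - if step x e' = 0 then 0 else
          (J.pairAvg)^[n] (expDiff θ u) (step x e') (step y e')))
        (fun e' _ => mul_nonneg (J.eventProb_nonneg e') (sub_nonneg.2 (hgen e')))
        (Finset.mem_univ e))
      exact mul_le_mul_of_nonneg_left (by linarith) (J.eventProb_nonneg e)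
    rw [List.length_cons, ← hn, Function.iterate_succ_apply', Function.iterate_succ_apply', pairAvg,
      expDiff, ← hD, avg, Finset.mul_sum, listProb_cons]
    simp only [mul_sub, Finset.sum_sub_distrib, run_cons] at hsum ⊢
    have h5 : ∀ e', D * (J.eventProb e' * (J.avg)^[n] u (step y e')) =
        J.eventProb e' * (D * (J.avg)^[n] u (step y e')) := fun e' => by ring
    simp only [h5]
    linarith

theorem avg_iterate_le {u : (Fin d → ℕ) → ℝ} {ε a : ℝ} (hε : ε ≤ 1)
    (hu : ∀ x, J.avg u x ≤ (1 - ε) * u x + ε * a) (n : ℕ) (x : Fin d → ℕ) :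
    (J.avg)^[n] u x ≤ (1 - ε) ^ n * u x + (1 - (1 - ε) ^ n) * a := by
  induction n generalizing x with
  | zero => simp
  | succ n ih =>
    rw [Function.iterate_succ_apply']
    have h1 : J.avg ((J.avg)^[n] u) x ≤
        J.avg (fun z => (1 - ε) ^ n * u z + (1 - (1 - ε) ^ n) * a) x := avg_mono ih x
    have h2 : J.avg (fun z => (1 - ε) ^ n * u z + (1 - (1 - ε) ^ n) * a) x =
        (1 - ε) ^ n * J.avg u x + (1 - (1 - ε) ^ n) * a := by
      conv_rhs => rw [← avg_const (J := J) ((1 - (1 - ε) ^ n) * a) x]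
      simp only [avg, mul_add, Finset.sum_add_distrib, Finset.mul_sum]
      congr 1
      exact Finset.sum_congr rfl fun e _ => by ring
    have h3 := mul_le_mul_of_nonneg_left (hu x) (pow_nonneg (sub_nonneg.2 hε) n)
    rw [pow_succ]
    linarith

/-- From a state whose population is well below `n`, the network becomes empty before its
population reaches `n`, with probability at least `1 / 2`. -/
theorem exists_hit_le_half [Nonempty (Fin d)] (hopen : J.IsOpenNetwork) (hst : J.IsStable) :
    ∃ K : ℕ, ∀ (n : ℕ) (A : Set (Fin d → ℕ)), (∀ x ∈ A, n ≤ ∑ i, x i) →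
      ∀ x : Fin d → ℕ, ∑ i, x i + K ≤ n → J.hit A x ≤ ENNReal.ofReal (1 / 2) := by
  classical
  obtain ⟨w, θ, ε, C, hθ, hε, hε1, hC, hw, hdrift⟩ := exists_lyapunov hopen hst
  obtain ⟨κ, hκ⟩ : ∃ κ : ℕ, ∀ y : Fin d → ℕ, w y < C / ε → ∑ i, y i ≤ κ := by
    refine ⟨⌈(C / ε) / θ⌉₊, fun y hy => ?_⟩
    have h1 := (Real.add_one_le_exp (θ * ∑ i, (y i : ℝ))).trans (hw y)
    have h2 : (∑ i, (y i : ℝ)) ≤ C / ε / θ := by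
      rw [le_div_iff₀ hθ]; linarith
    have h3 : ((∑ i, y i : ℕ) : ℝ) ≤ ⌈(C / ε) / θ⌉₊ := by
      push_cast; exact h2.trans (Nat.le_ceil _)
    exact_mod_cast h3
  obtain ⟨l₁, hl₁, hdrain₁⟩ := hopen.exists_drain_list κ
  obtain ⟨l₂, hl₂, hdrain₂⟩ := hopen.exists_drain_list 1
  -- The first part empties every second copy with small Lyapunov value, so that what is left of the
  -- first copy is at most the old surplus; the second part then removes one more job, if any is
  -- left.
  set l := l₁ ++ l₂ with hl
  have hlp : 0 < J.listProb l := by rw [hl, listProb_append]; exact mul_pos hl₁ hl₂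
  have hdrop : ∀ x y : Fin d → ℕ, y ≤ x → w y < C / ε → run y l = 0 ∧
      (run x l = 0 ∨ ∑ i, run x l i + ∑ i, y i + 1 ≤ ∑ i, x i) := by
    intro x y hxy hwy
    have hy1 : run y l₁ = 0 := eq_zero_of_sum_eq_zero (by have := hdrain₁ y; have := hκ y hwy; omega)
    have h0 : run 0 l₂ = 0 := eq_zero_of_sum_eq_zero (by simpa using hdrain₂ 0)
    refine ⟨by rw [hl, run_append, hy1, h0], ?_⟩
    by_cases hx : run x l₁ = 0
    · left; rw [hl, run_append, hx, h0]
    · right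
      have h1 := sum_run_add_le hxy l₁
      rw [hy1] at h1
      have h2 := hdrain₂ (run x l₁)
      have h3 := sum_pos_of_ne_zero hx
      rw [hl, run_append]
      simp only [Pi.zero_apply, Finset.sum_const_zero] at h1
      omega
  set q := J.listProb l * (1 - Real.exp (-θ)) with hq
  have hexpθ : Real.exp (-θ) < 1 := by
    rw [← Real.exp_zero]; exact Real.exp_lt_exp.2 (neg_neg_of_pos hθ)
  have hq0 : 0 < q := mul_pos hlp (sub_pos.2 hexpθ)
  -- Here `q` is the relative gain from one run of `l`. This `η` makes `u = 1 + η * w` relax towards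
  -- `1 + q`, so its averages rise by at most `q`, exactly what the gain can pay for.
  set η := q * ε / C with hη
  have hη0 : 0 < η := by positivity
  have hηC : η * C = ε * q := by rw [hη]; field_simp
  set u : (Fin d → ℕ) → ℝ := fun y => 1 + η * w y with hu
  have hw0 : ∀ y, 0 < w y := fun y => (Real.exp_pos _).trans_le (hw y)
  have hu1 : ∀ y, 1 ≤ u y := fun y => by
    have := mul_pos hη0 (hw0 y)
    simp only [hu]; linarith
  have hu0 : ∀ y, 0 ≤ u y := fun y => zero_le_one.trans (hu1 y)
  have hudrift : ∀ y, J.avg u y ≤ (1 - ε) * u y + ε * (1 + q) := fun y => by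
    have h1 : J.avg u y = 1 + η * J.avg w y := by
      conv_rhs => rw [← avg_const (J := J) 1 y]
      simp only [avg, hu, mul_add, Finset.sum_add_distrib, Finset.mul_sum]
      congr 1
      exact Finset.sum_congr rfl fun e _ => by ring
    have h2 := mul_le_mul_of_nonneg_left (hdrift y) hη0.le
    rw [h1]
    simp only [hu]
    linarith
  have hiter := avg_iterate_le hε1.le hudrift
  set M := l.length with hM
  have hpow : ∀ n, 0 ≤ (1 - ε) ^ n ∧ (1 - ε) ^ n ≤ 1 := fun n =>
    ⟨pow_nonneg (by linarith) n, pow_le_one₀ (by linarith) (by linarith)⟩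
  have hlnil : l ≠ [] := by
    intro hnil
    rw [hl, List.append_eq_nil_iff] at hnil
    have h1 := hdrain₂ (Pi.single (Classical.arbitrary _) 1)
    rw [hnil.2] at h1
    simp at h1
  have hM0 : 0 < M := List.length_pos_iff.2 hlnil
  -- If `w y` is small, the possible rise `q` of `u` is offset by the drop of the surplus along `l`.
  -- Otherwise `u y ≥ 1 + q`, and averaging does not increase it.
  have hsuper : ∀ x y, y ≤ x → (J.pairAvg)^[M] (expDiff θ u) x y ≤ expDiff θ u x y := by
    intro x y hxy
    have hD : 0 < Real.exp (θ * (∑ i, (x i : ℝ) - ∑ i, (y i : ℝ))) := Real.exp_pos _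
    by_cases hy : w y < C / ε
    · obtain ⟨hy0, hx0⟩ := hdrop x y hxy hy
      have h1 := pairAvg_iterate_expDiff_le_of_list (J := J) hθ.le hu0 l hxy (Or.inr hlnil)
        (R := Real.exp (-θ) * Real.exp (θ * (∑ i, (x i : ℝ) - ∑ i, (y i : ℝ))) * u 0)
        (mul_nonneg (mul_nonneg (Real.exp_pos _).le (Real.exp_pos _).le) (hu0 0))
        (fun h0 => by
          have h3 := hx0.resolve_left h0
          have h4 : (∑ i, (run x l i : ℝ)) + ∑ i, (y i : ℝ) + 1 ≤ ∑ i, (x i : ℝ) := by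
            exact_mod_cast h3
          rw [expDiff, hy0, ← Real.exp_add]
          refine mul_le_mul_of_nonneg_right (Real.exp_le_exp.2 ?_) (hu0 0)
          simp only [Pi.zero_apply, Nat.cast_zero, Finset.sum_const_zero]
          nlinarith)
      rw [hy0] at h1
      have h4 : (J.avg)^[M] u y ≤ u y + q := by
        refine (hiter M y).trans ?_
        obtain ⟨hp0, hp1⟩ := hpow M
        have := hu1 y
        nlinarith
      have h5 := mul_le_mul_of_nonneg_left h4 hD.le
      have h6 : 0 ≤ J.listProb l * (1 - Real.exp (-θ)) *
          Real.exp (θ * (∑ i, (x i : ℝ) - ∑ i, (y i : ℝ))) * (u 0 - 1) :=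
        mul_nonneg (mul_nonneg hq0.le hD.le) (sub_nonneg.2 (hu1 0))
      refine h1.trans ?_
      simp only [expDiff] at h5 ⊢
      rw [hq] at h5
      linarith
    · refine (pairAvg_iterate_expDiff_le hθ.le hu0 M hxy).trans ?_
      refine mul_le_mul_of_nonneg_left ((hiter M y).trans ?_) hD.le
      have h1 : 1 + q ≤ u y := by
        have h2 := mul_le_mul_of_nonneg_left (not_lt.1 hy) hη0.le
        have h3 : η * (C / ε) = q := by rw [← mul_div_assoc, hηC]; field_simp
        simp only [hu]; linarith
      obtain ⟨hp0, hp1⟩ := hpow M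
      nlinarith
  have hexpu : ∀ x y, 0 ≤ expDiff θ u x y := fun x y => mul_nonneg (Real.exp_pos _).le (hu0 y)
  -- Summing the first `M` iterates turns an `M`-step supersolution into a one-step one: the sum
  -- telescopes, and the difference is the `M`-step inequality.
  set Ψ : (Fin d → ℕ) → (Fin d → ℕ) → ℝ := fun x y =>
    ∑ i ∈ Finset.range M, (J.pairAvg)^[i] (expDiff θ u) x y with hΨ
  have hΨ0 : ∀ x y, 0 ≤ Ψ x y := fun x y =>
    Finset.sum_nonneg fun i _ => pairAvg_iterate_nonneg hexpu i x y
  have hΨsuper : ∀ x y, y ≤ x → J.pairAvg Ψ x y ≤ Ψ x y := by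
    intro x y hxy
    have h1 : J.pairAvg Ψ x y =
        ∑ i ∈ Finset.range M, (J.pairAvg)^[i + 1] (expDiff θ u) x y := by
      simp only [Function.iterate_succ_apply']
      simp only [pairAvg, hΨ]
      rw [Finset.sum_comm]
      refine Finset.sum_congr rfl fun e _ => ?_
      rw [← Finset.mul_sum]
      congr 1
      split_ifs <;> simp
    have h2 := Finset.sum_range_succ (fun i => (J.pairAvg)^[i] (expDiff θ u) x y) M
    have h3 := Finset.sum_range_succ' (fun i => (J.pairAvg)^[i] (expDiff θ u) x y) M
    have h4 := hsuper x y hxy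
    rw [h1]
    simp only [Function.iterate_zero, id] at h3
    simp only [hΨ]
    linarith
  have hΨlow : ∀ x y, η * Real.exp (θ * ∑ i, (x i : ℝ)) ≤ Ψ x y := by
    intro x y
    refine le_trans ?_ (Finset.single_le_sum (f := fun i => (J.pairAvg)^[i] (expDiff θ u) x y)
      (fun i _ => pairAvg_iterate_nonneg hexpu i x y) (Finset.mem_range.2 hM0))
    simp only [Function.iterate_zero, id, expDiff]
    have h1 : η * Real.exp (θ * ∑ i, (y i : ℝ)) ≤ u y := by
      have := mul_le_mul_of_nonneg_left (hw y) hη0.le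
      simp only [hu]; linarith
    refine le_trans (le_of_eq ?_) (mul_le_mul_of_nonneg_left h1 (Real.exp_pos _).le)
    rw [mul_left_comm, ← Real.exp_add]
    congr 2; ring
  have hΨup : ∀ x, Ψ x 0 ≤ M * (u 0 + (1 + q)) * Real.exp (θ * ∑ i, (x i : ℝ)) := by
    intro x
    have h1 : ∀ i ∈ Finset.range M, (J.pairAvg)^[i] (expDiff θ u) x 0 ≤
        (u 0 + (1 + q)) * Real.exp (θ * ∑ i, (x i : ℝ)) := fun i _ => by
      refine (pairAvg_iterate_expDiff_le hθ.le hu0 i zero_le).trans ?_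
      simp only [expDiff, Pi.zero_apply, Nat.cast_zero, Finset.sum_const_zero, sub_zero]
      rw [mul_comm]
      refine mul_le_mul_of_nonneg_right ((hiter i 0).trans ?_) (Real.exp_pos _).le
      obtain ⟨hp0, hp1⟩ := hpow i
      have := hu1 0
      nlinarith
    refine (Finset.sum_le_sum h1).trans_eq ?_
    rw [Finset.sum_const, Finset.card_range, nsmul_eq_mul]; ring
  have hub : 0 < M * (u 0 + (1 + q)) := by
    have := hu1 0
    positivity
  obtain ⟨K, hK⟩ : ∃ K : ℕ, M * (u 0 + (1 + q)) * Real.exp (-(θ * K)) ≤ η / 2 := by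
    have h1 : Tendsto (fun K : ℕ => M * (u 0 + (1 + q)) * Real.exp (-(θ * K))) atTop
        (nhds (M * (u 0 + (1 + q)) * 0)) :=
      (Real.tendsto_exp_neg_atTop_nhds_zero.comp
        (tendsto_natCast_atTop_atTop.const_mul_atTop hθ)).const_mul _
    rw [mul_zero] at h1
    obtain ⟨K, h2⟩ := (h1.eventually (gt_mem_nhds (half_pos hη0))).exists
    exact ⟨K, h2.le⟩
  refine ⟨K, fun n A hA x hx => ?_⟩
  set c := η * Real.exp (θ * n) with hc
  have hc0 : 0 < c := by positivity
  -- The second copy starts empty. On `A`, `Ψ` is at least `η * exp (θ * n)` whatever the second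
  -- copy is, because `u y` dominates `η * exp (θ * ∑ y)` and restores the population subtracted in
  -- the surplus.
  have hbound : J.hit A x ≤ ENNReal.ofReal (Ψ x 0 / c) := by
    refine entryVal_le_of_super (J := J) (Z := {p : (Fin d → ℕ) × (Fin d → ℕ) // p.2 ≤ p.1})
      (fun p => p.1.1) (fun p e => ⟨(step p.1.1 e, step p.1.2 e), step_mono p.2 e⟩)
      (fun _ _ => rfl) (fun p => ENNReal.ofReal (Ψ p.1.1 p.1.2 / c)) (fun p hp => ?_)
      (fun p _ => ?_) ⟨(x, 0), zero_le⟩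
    · rw [← ENNReal.ofReal_one]
      refine ENNReal.ofReal_le_ofReal ((one_le_div hc0).2 ((hΨlow _ p.1.2).trans' ?_))
      refine mul_le_mul_of_nonneg_left (Real.exp_le_exp.2 ?_) hη0.le
      refine mul_le_mul_of_nonneg_left ?_ hθ.le
      exact_mod_cast hA _ hp
    · have h1 := div_le_div_of_nonneg_right (hΨsuper _ _ p.2) hc0.le
      refine le_trans (le_of_eq ?_) (ENNReal.ofReal_le_ofReal h1)
      rw [pairAvg, Finset.sum_div, ENNReal.ofReal_sum_of_nonneg]
      · refine Finset.sum_congr rfl fun e _ => ?_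
        rw [mul_div_assoc, ENNReal.ofReal_mul (J.eventProb_nonneg e)]
        congr 1
        split_ifs <;> simp
      · intro e _
        refine div_nonneg (mul_nonneg (J.eventProb_nonneg e) ?_) hc0.le
        split_ifs
        · exact le_rfl
        · exact hΨ0 _ _
  refine hbound.trans (ENNReal.ofReal_le_ofReal ?_)
  rw [div_le_iff₀ hc0]
  refine (hΨup x).trans ?_
  have hxK : (∑ i, (x i : ℝ)) ≤ n - K := by
    have : (∑ i, (x i : ℝ)) + K ≤ n := by exact_mod_cast hx
    linarith
  have h1 : Real.exp (θ * ∑ i, (x i : ℝ)) ≤ Real.exp (-(θ * K)) * Real.exp (θ * n) := by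
    rw [← Real.exp_add]
    exact Real.exp_le_exp.2 (by nlinarith)
  have h2 := mul_le_mul_of_nonneg_left h1 hub.le
  have h3 := mul_le_mul_of_nonneg_right hK (Real.exp_pos (θ * n)).le
  rw [hc]
  linarith

end JacksonNetwork
end

/-! ### The product-form measure and its tails. -/

noncomputable section

namespace JacksonNetwork

open JacksonEvent
open scoped ENNReal

variable {d : ℕ} {J : JacksonNetwork d}

/-- The product weight with factors `a`. -/
def wt (a : Fin d → ℝ≥0∞) (x : Fin d → ℕ) : ℝ≥0∞ := ∏ i, a i ^ x i

theorem wt_add (a : Fin d → ℝ≥0∞) (x y : Fin d → ℕ) : wt a (x + y) = wt a x * wt a y := by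
  simp [wt, pow_add, Finset.prod_mul_distrib]

theorem wt_single (a : Fin d → ℝ≥0∞) (i : Fin d) (k : ℕ) : wt a (Pi.single i k) = a i ^ k := by
  rw [wt, Finset.prod_eq_single i] <;> simp +contextual

theorem wt_zero (a : Fin d → ℝ≥0∞) : wt a 0 = 1 := by simp [wt]

theorem add_single_injective (i : Fin d) (k : ℕ) :
    Function.Injective fun z : Fin d → ℕ => z + Pi.single i k := fun _ _ h => add_right_cancel h

theorem tsum_shift (F : (Fin d → ℕ) → ℝ≥0∞) (i : Fin d) (k : ℕ) :
    ∑' z : Fin d → ℕ, F (z + Pi.single i k) = ∑' x : Fin d → ℕ, if k ≤ x i then F x else 0 := by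
  have h : ∀ z : Fin d → ℕ, F (z + Pi.single i k) =
      (fun x : Fin d → ℕ => if k ≤ x i then F x else 0) (z + Pi.single i k) := fun z => by simp
  rw [tsum_congr h]
  refine (add_single_injective i k).tsum_eq
    (f := fun x : Fin d → ℕ => if k ≤ x i then F x else 0) fun x hx => ?_
  have hk : k ≤ x i := by by_contra hcon; simp [hcon] at hx
  refine ⟨x - Pi.single i k, tsub_add_cancel_of_le fun j => ?_⟩
  by_cases hj : j = i
  · subst hj; simpa using hk
  · simp [hj]

theorem tsum_split_zero (F : (Fin d → ℕ) → ℝ≥0∞) (i : Fin d) :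
    ∑' x, F x = (∑' x : Fin d → ℕ, if x i = 0 then F x else 0) +
      ∑' z : Fin d → ℕ, F (z + Pi.single i 1) := by
  rw [tsum_shift, ← ENNReal.tsum_add]
  refine tsum_congr fun x => ?_
  by_cases h : x i = 0
  · simp [h]
  · simp [h, Nat.one_le_iff_ne_zero.2 h]

theorem tsum_split_coord (F : (Fin d → ℕ) → ℝ≥0∞) (i : Fin d) :
    ∑' x, F x = ∑' k : ℕ, ∑' x : Fin d → ℕ, if x i = 0 then F (x + Pi.single i k) else 0 := by
  have h : ∀ x : Fin d → ℕ, F x = ∑' k : ℕ, if k = x i then F x else 0 := fun x => by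
    rw [tsum_ite_eq]
  rw [tsum_congr h, ENNReal.tsum_comm]
  refine tsum_congr fun k => ?_
  have h2 := tsum_shift (fun x : Fin d → ℕ => if x i = k then F x else 0) i k
  simp only [Pi.add_apply, Pi.single_eq_same, Nat.add_eq_right] at h2
  rw [h2]
  refine tsum_congr fun x => ?_
  by_cases hx : x i = k
  · simp [hx]
  · simp [hx, Ne.symm hx]

/-- The traffic intensities as elements of `[0, ∞]`. -/
def erho (J : JacksonNetwork d) (i : Fin d) : ℝ≥0∞ := ENNReal.ofReal (J.rho i)

/-- The product form measure is invariant. -/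
theorem isInvariant_wt (hopen : J.IsOpenNetwork) (hst : J.IsStable) :
    J.IsInvariant (wt J.erho) := by
  intro g
  have hρ := rho_nonneg hopen hst
  set M : Fin d → ℝ≥0∞ := fun i => ENNReal.ofReal (J.srv i) with hM
  set Λ : Fin d → ℝ≥0∞ := fun i => ENNReal.ofReal (J.arr i) with hΛ
  set P : Fin d → Fin d → ℝ≥0∞ := fun i j => ENNReal.ofReal (J.route i j) with hP
  set X : Fin d → ℝ≥0∞ := fun i => ENNReal.ofReal (J.exitProb i) with hX
  set R := J.erho with hR
  have hPX : ∀ i, ∑ j, P i j + X i = 1 := fun i => by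
    simp only [hP, hX]
    rw [← ENNReal.ofReal_sum_of_nonneg fun j _ => J.route_nonneg i j,
      ← ENNReal.ofReal_add (Finset.sum_nonneg fun j _ => J.route_nonneg i j) (J.exitProb_nonneg i)]
    simp [exitProb]
  have htot : ∑ i, Λ i + ∑ i, M i = 1 := by
    simp only [hΛ, hM]
    rw [← ENNReal.ofReal_sum_of_nonneg fun j _ => J.arr_nonneg j,
      ← ENNReal.ofReal_sum_of_nonneg fun j _ => (J.srv_pos j).le,
      ← ENNReal.ofReal_add (Finset.sum_nonneg fun j _ => J.arr_nonneg j)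
        (Finset.sum_nonneg fun j _ => (J.srv_pos j).le), ← Finset.sum_add_distrib, J.total_rate,
      ENNReal.ofReal_one]
  have htraf : ∀ i, M i * R i = Λ i + ∑ j, M j * R j * P j i := fun i => by
    simp only [hM, hR, erho, hΛ, hP]
    rw [← ENNReal.ofReal_mul (J.srv_pos i).le, traffic_rho hopen, ENNReal.ofReal_add
      (J.arr_nonneg i) (Finset.sum_nonneg fun j _ =>
        mul_nonneg (mul_nonneg (J.srv_pos j).le (hρ j)) (J.route_nonneg j i)),
      ENNReal.ofReal_sum_of_nonneg fun j _ =>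
        mul_nonneg (mul_nonneg (J.srv_pos j).le (hρ j)) (J.route_nonneg j i)]
    congr 1
    refine Finset.sum_congr rfl fun j _ => ?_
    rw [ENNReal.ofReal_mul (mul_nonneg (J.srv_pos j).le (hρ j)), ENNReal.ofReal_mul (J.srv_pos j).le]
  have hMR : ∀ i, M i * R i ≠ ∞ := fun i =>
    ENNReal.mul_ne_top ENNReal.ofReal_ne_top ENNReal.ofReal_ne_top
  -- The traffic equations are summed over all stations; the internal flow appears on both sides
  -- and, being finite, cancels in `[0, ∞]`.
  have hflow : ∑ i, Λ i = ∑ i, M i * R i * X i := by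
    have h1 : ∑ i, M i * R i = ∑ i, Λ i + ∑ i, ∑ j, M i * R i * P i j := by
      rw [Finset.sum_congr rfl fun i _ => htraf i, Finset.sum_add_distrib, Finset.sum_comm]
    have h2 : ∑ i, M i * R i = ∑ i, M i * R i * X i + ∑ i, ∑ j, M i * R i * P i j := by
      rw [← Finset.sum_add_distrib]
      refine Finset.sum_congr rfl fun i _ => ?_
      rw [← Finset.mul_sum, ← mul_add, add_comm (X i), hPX, mul_one]
    have hfin : ∑ i, ∑ j, M i * R i * P i j ≠ ∞ :=
      ENNReal.sum_ne_top.2 fun i _ => ENNReal.sum_ne_top.2 fun j _ =>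
        ENNReal.mul_ne_top (hMR i) ENNReal.ofReal_ne_top
    rw [h1] at h2
    exact (ENNReal.add_left_inj hfin).1 h2
  -- Everything is expressed by the mean `G`, the means `T j` with one job added at `j`, and the
  -- parts `Z i` with station `i` empty. Shifting a job out of `i` costs the factor `R i`, so `G = Z
  -- i + R i * T i`, and invariance becomes linear algebra with the traffic equations.
  set G := ∑' x, wt R x * g x with hG
  set T : Fin d → ℝ≥0∞ := fun j => ∑' z, wt R z * g (z + Pi.single j 1) with hT
  set Z : Fin d → ℝ≥0∞ := fun i => ∑' x : Fin d → ℕ, if x i = 0 then wt R x * g x else 0 with hZ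
  have hwt : ∀ z i, wt R (z + Pi.single i 1) = R i * wt R z := fun z i => by
    rw [wt_add, wt_single, pow_one, mul_comm]
  have hGi : ∀ i, G = Z i + R i * T i := fun i => by
    rw [hG, tsum_split_zero _ i]
    congr 1
    rw [hT, ← ENNReal.tsum_mul_left]
    exact tsum_congr fun z => by rw [hwt, mul_assoc]
  have htr : ∀ i j, ∑' x, wt R x * g (step x (.transfer i j)) = Z i + R i * T j := fun i j => by
    rw [tsum_split_zero _ i]
    congr 1
    · refine tsum_congr fun x => ?_
      split_ifs with h
      · rw [step_transfer_of_eq_zero h]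
      · rfl
    · rw [hT, ← ENNReal.tsum_mul_left]
      exact tsum_congr fun z => by rw [hwt, step_transfer_add, mul_assoc]
  have hdp : ∀ i, ∑' x, wt R x * g (step x (.departure i)) = Z i + R i * G := fun i => by
    rw [tsum_split_zero _ i]
    congr 1
    · refine tsum_congr fun x => ?_
      split_ifs with h
      · rw [step_departure_of_eq_zero h]
      · rfl
    · rw [hG, ← ENNReal.tsum_mul_left]
      exact tsum_congr fun z => by rw [hwt, step_departure_add, mul_assoc]
  have hexp : ∑' x, wt R x * J.eavg g x =
      ∑ e, ENNReal.ofReal (J.eventProb e) * ∑' x, wt R x * g (step x e) := by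
    simp only [← ENNReal.tsum_mul_left]
    rw [← Summable.tsum_finsetSum fun _ _ => ENNReal.summable]
    refine tsum_congr fun x => ?_
    rw [eavg, Finset.mul_sum]
    exact Finset.sum_congr rfl fun e _ => by ring
  have harr : ∀ i, ∑' x, wt R x * g (step x (.arrival i)) = T i := fun i => rfl
  rw [hexp, JacksonEvent.sum_eq]
  simp only [htr, hdp, harr, eventProb, ENNReal.ofReal_mul (J.srv_pos _).le]
  change ∑ i, Λ i * T i + ∑ i, ∑ j, M i * P i j * (Z i + R i * T j) +
    ∑ i, M i * X i * (Z i + R i * G) = G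
  have e1 : ∑ i, ∑ j, M i * P i j * (Z i + R i * T j) =
      ∑ i, M i * (∑ j, P i j) * Z i + ∑ j, (∑ i, M i * R i * P i j) * T j := by
    simp only [mul_add, Finset.sum_add_distrib, Finset.mul_sum, Finset.sum_mul]
    congr 1
    rw [Finset.sum_comm]
    exact Finset.sum_congr rfl fun j _ => Finset.sum_congr rfl fun i _ => by ring
  have e2 : ∑ i, M i * X i * (Z i + R i * G) =
      ∑ i, M i * X i * Z i + (∑ i, M i * R i * X i) * G := by
    simp only [mul_add, Finset.sum_add_distrib, Finset.sum_mul]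
    congr 1
    exact Finset.sum_congr rfl fun j _ => by ring
  calc _ = (∑ i, Λ i * T i + ∑ j, (∑ i, M i * R i * P i j) * T j) +
        (∑ i, M i * (∑ j, P i j) * Z i + ∑ i, M i * X i * Z i) + (∑ i, Λ i) * G := by
          rw [e1, e2, hflow]; ring
    _ = ∑ i, M i * R i * T i + ∑ i, M i * Z i + (∑ i, Λ i) * G := by
          rw [← Finset.sum_add_distrib, ← Finset.sum_add_distrib]
          congr 3
          · funext i; rw [htraf i]; ring
          · funext i; rw [← add_mul, ← mul_add, hPX, mul_one]
    _ = (∑ i, Λ i + ∑ i, M i) * G := by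
          rw [← Finset.sum_add_distrib, add_mul, add_comm, Finset.sum_mul (f := M)]
          congr 1
          exact Finset.sum_congr rfl fun i _ => by rw [hGi i]; ring
    _ = G := by rw [htot, one_mul]

open Classical in
/-- The factors `R`, restricted to a subset of the stations. -/
def restr (R : Fin d → ℝ≥0∞) (T : Finset (Fin d)) (i : Fin d) : ℝ≥0∞ := if i ∈ T then R i else 0

/-- Since `0 ^ 0 = 1`, the restricted weight lives exactly on states that vanish off `T`. Admitting
one more station adds an independent coordinate with geometric weights, so tails can be treated one
station at a time. -/
theorem wt_restr_insert (R : Fin d → ℝ≥0∞) {T : Finset (Fin d)} {i : Fin d} (hi : i ∉ T)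
    (g : (Fin d → ℕ) → ℝ≥0∞) :
    ∑' x, wt (restr R (insert i T)) x * g x =
      ∑' k : ℕ, R i ^ k * ∑' x, wt (restr R T) x * g (x + Pi.single i k) := by
  rw [tsum_split_coord _ i]
  refine tsum_congr fun k => ?_
  rw [← ENNReal.tsum_mul_left]
  refine tsum_congr fun x => ?_
  split_ifs with h
  · rw [wt_add, wt_single]
    have h1 : wt (restr R (insert i T)) x = wt (restr R T) x := by
      refine Finset.prod_congr rfl fun j _ => ?_
      by_cases hj : j = i
      · subst hj; simp [h]
      · simp [restr, hj]
    rw [h1]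
    simp only [restr, Finset.mem_insert_self, if_true]
    ring
  · have : wt (restr R T) x = 0 :=
      Finset.prod_eq_zero (Finset.mem_univ i) (by simp [restr, hi, h])
    rw [this]; simp

/-- The tail of the product weight restricted to the stations in `T`. -/
def tail (R : Fin d → ℝ≥0∞) (S T : Finset (Fin d)) (n : ℕ) : ℝ≥0∞ :=
  ∑' x : Fin d → ℕ, wt (restr R T) x * if n ≤ ∑ i ∈ S, x i then 1 else 0

/-- The truncated difference is right: for `k ≥ n` the new station alone meets the threshold, and
the tail at `0` is the total mass. -/
theorem tail_insert_of_mem (R : Fin d → ℝ≥0∞) {S T : Finset (Fin d)} {i : Fin d} (hi : i ∉ T)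
    (hS : i ∈ S) (n : ℕ) : tail R S (insert i T) n = ∑' k : ℕ, R i ^ k * tail R S T (n - k) := by
  rw [tail, wt_restr_insert R hi]
  refine tsum_congr fun k => ?_
  congr 1
  refine tsum_congr fun x => ?_
  have : ∑ j ∈ S, (x + Pi.single i k : Fin d → ℕ) j = ∑ j ∈ S, x j + k := by
    simp [Finset.sum_add_distrib, hS]
  rw [this]
  simp only [tsub_le_iff_right]

theorem tail_insert_of_notMem (R : Fin d → ℝ≥0∞) {S T : Finset (Fin d)} {i : Fin d} (hi : i ∉ T)
    (hS : i ∉ S) (n : ℕ) : tail R S (insert i T) n = (∑' k : ℕ, R i ^ k) * tail R S T n := by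
  rw [tail, wt_restr_insert R hi, ← ENNReal.tsum_mul_right]
  refine tsum_congr fun k => ?_
  congr 1
  refine tsum_congr fun x => ?_
  have : ∑ j ∈ S, (x + Pi.single i k : Fin d → ℕ) j = ∑ j ∈ S, x j := by
    simp [Finset.sum_add_distrib, hS]
  rw [this]

theorem tsum_geometric_ne_top {a : ℝ≥0∞} (h : a < 1) : ∑' k : ℕ, a ^ k ≠ ∞ := by
  rw [ENNReal.tsum_geometric]
  exact ENNReal.inv_ne_top.2 (tsub_pos_of_lt h).ne'

/-- The exponent is `max k n`: `n` terms equal to `a ^ n`, then a geometric series. This is how each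
further bottleneck contributes a factor of order `n`. -/
theorem tsum_pow_max_le {a : ℝ≥0∞} (n : ℕ) :
    ∑' k : ℕ, a ^ (k + (n - k)) ≤ (n + 1) * a ^ n * (1 + ∑' k : ℕ, a ^ k) := by
  rw [← Summable.sum_add_tsum_nat_add' (k := n) ENNReal.summable]
  have h1 : ∑ k ∈ Finset.range n, a ^ (k + (n - k)) = n * a ^ n := by
    rw [Finset.sum_congr rfl (g := fun _ => a ^ n), Finset.sum_const, Finset.card_range,
      nsmul_eq_mul]
    intro k hk
    rw [Nat.add_sub_cancel' (Finset.mem_range.1 hk).le]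
  have h2 : ∑' k : ℕ, a ^ (k + n + (n - (k + n))) = a ^ n * ∑' k : ℕ, a ^ k := by
    rw [← ENNReal.tsum_mul_left]
    refine tsum_congr fun k => ?_
    rw [← pow_add]; congr 1; omega
  rw [h1, h2, mul_add, mul_one]
  gcongr
  · exact le_self_add
  · exact le_mul_of_one_le_left zero_le le_add_self

/-- Stations are added to the dominant one. A station outside `S` costs a geometric constant; one in
`S` with smaller factor costs the convergent series in `R i / R i₀`; one with equal factor costs a
constant times `n + 1`. -/
theorem tail_bound {R : Fin d → ℝ≥0∞} (hR : ∀ i, R i < 1) {S : Finset (Fin d)} {i₀ : Fin d}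
    (hi₀ : i₀ ∈ S) (hmax : ∀ i ∈ S, R i ≤ R i₀) (h0 : R i₀ ≠ 0) (T : Finset (Fin d))
    (hT : i₀ ∉ T) :
    ∃ C : ℝ≥0∞, C ≠ ∞ ∧ ∀ n : ℕ, tail R S (insert i₀ T) n ≤
      C * (n + 1) ^ (T.filter fun i => i ∈ S ∧ R i = R i₀).card * R i₀ ^ n := by
  have hpow : ∀ {a : ℝ≥0∞} {m n : ℕ}, a < 1 → n ≤ m → a ^ m ≤ a ^ n := fun ha h =>
    pow_le_pow_of_le_one zero_le ha.le h
  induction T using Finset.induction_on with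
  | empty =>
    refine ⟨∑' k : ℕ, R i₀ ^ k, tsum_geometric_ne_top (hR i₀), fun n => ?_⟩
    rw [tail_insert_of_mem R (Finset.notMem_empty _) hi₀]
    have h1 : ∀ m : ℕ, tail R S ∅ m = if m = 0 then 1 else 0 := fun m => by
      rw [tail, tsum_eq_single 0]
      · simp [wt_zero]
      · intro x hx
        obtain ⟨i, hi⟩ := Function.ne_iff.1 hx
        have : wt (restr R ∅) x = 0 :=
          Finset.prod_eq_zero (Finset.mem_univ i) (by simpa [restr] using hi)
        rw [this, zero_mul]
    simp only [h1, Finset.filter_empty, Finset.card_empty, pow_zero, mul_one]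
    rw [← Summable.sum_add_tsum_nat_add' (k := n) ENNReal.summable, Finset.sum_eq_zero, zero_add,
      ← ENNReal.tsum_mul_right]
    · refine ENNReal.tsum_le_tsum fun k => ?_
      rw [pow_add]
      exact mul_le_of_le_one_right' (by split_ifs <;> simp)
    · intro k hk
      rw [if_neg, mul_zero]
      have := Finset.mem_range.1 hk
      omega
  | insert i T hi ih =>
    rw [Finset.mem_insert, not_or] at hT
    obtain ⟨C, hC, hbound⟩ := ih hT.2
    have hi' : i ∉ insert i₀ T := by
      rw [Finset.mem_insert, not_or]; exact ⟨Ne.symm hT.1, hi⟩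
    rw [Finset.insert_comm]
    set p := (T.filter fun i => i ∈ S ∧ R i = R i₀).card with hp
    by_cases hS : i ∈ S
    · have hterm : ∀ n k : ℕ, tail R S (insert i₀ T) (n - k) ≤
          C * (n + 1) ^ p * R i₀ ^ (n - k) := fun n k => by
        refine (hbound (n - k)).trans ?_
        gcongr
        exact Nat.sub_le n k
      by_cases hb : R i = R i₀
      · refine ⟨C * (1 + ∑' k : ℕ, R i₀ ^ k), ENNReal.mul_ne_top hC
          (ENNReal.add_ne_top.2 ⟨ENNReal.one_ne_top, tsum_geometric_ne_top (hR i₀)⟩), fun n => ?_⟩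
        rw [tail_insert_of_mem R hi' hS, Finset.filter_insert, if_pos ⟨hS, hb⟩,
          Finset.card_insert_of_notMem (fun h => hi (Finset.mem_filter.1 h).1), ← hp]
        calc _ ≤ ∑' k : ℕ, C * (n + 1) ^ p * R i₀ ^ (k + (n - k)) := by
              refine ENNReal.tsum_le_tsum fun k => ?_
              rw [hb, pow_add, mul_left_comm]
              gcongr
              exact hterm n k
          _ ≤ C * (n + 1) ^ p * ((n + 1) * R i₀ ^ n * (1 + ∑' k : ℕ, R i₀ ^ k)) := by
              rw [ENNReal.tsum_mul_left]
              gcongr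
              exact tsum_pow_max_le n
          _ = _ := by ring
      · have hlt : R i < R i₀ := lt_of_le_of_ne (hmax i hS) hb
        have htop : R i₀ ≠ ∞ := ((hR i₀).trans ENNReal.one_lt_top).ne
        have hs : R i / R i₀ < 1 :=
          (ENNReal.div_lt_iff (Or.inl h0) (Or.inl htop)).2 (by rwa [one_mul])
        refine ⟨C * ∑' k : ℕ, (R i / R i₀) ^ k, ENNReal.mul_ne_top hC
          (tsum_geometric_ne_top hs), fun n => ?_⟩
        rw [tail_insert_of_mem R hi' hS, Finset.filter_insert, if_neg (fun h => hb h.2), ← hp]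
        calc _ ≤ ∑' k : ℕ, C * (n + 1) ^ p * R i₀ ^ n * (R i / R i₀) ^ k := by
              refine ENNReal.tsum_le_tsum fun k => ?_
              calc R i ^ k * tail R S (insert i₀ T) (n - k) ≤
                  ((R i / R i₀) * R i₀) ^ k * (C * (n + 1) ^ p * R i₀ ^ (n - k)) := by
                    rw [ENNReal.div_mul_cancel h0 htop]
                    gcongr
                    exact hterm n k
                _ = C * (n + 1) ^ p * R i₀ ^ (k + (n - k)) * (R i / R i₀) ^ k := by
                    rw [mul_pow, pow_add]; ring
                _ ≤ _ := by
                    have := hpow (hR i₀) (show n ≤ k + (n - k) by omega)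
                    gcongr
          _ = _ := by rw [ENNReal.tsum_mul_left]; ring
    · refine ⟨C * ∑' k : ℕ, R i ^ k, ENNReal.mul_ne_top hC (tsum_geometric_ne_top (hR i)),
        fun n => ?_⟩
      rw [tail_insert_of_notMem R hi' hS, Finset.filter_insert, if_neg (fun h => hS h.1), ← hp]
      calc _ ≤ (∑' k : ℕ, R i ^ k) * (C * (n + 1) ^ p * R i₀ ^ n) := by
            gcongr
            exact hbound n
        _ = _ := by ring

theorem restr_univ (R : Fin d → ℝ≥0∞) : restr R Finset.univ = R := by
  funext i; simp [restr]

theorem wt_tail_le {R : Fin d → ℝ≥0∞} (hR : ∀ i, R i < 1) {S : Finset (Fin d)} {i₀ : Fin d}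
    (hi₀ : i₀ ∈ S) (hmax : ∀ i ∈ S, R i ≤ R i₀) (h0 : R i₀ ≠ 0) :
    ∃ C : ℝ≥0∞, C ≠ ∞ ∧ ∀ n : ℕ,
      ∑' x : Fin d → ℕ, wt R x * (if n ≤ ∑ i ∈ S, x i then 1 else 0) ≤
        C * (n + 1) ^ ((S.filter fun i => R i = R i₀).card - 1) * R i₀ ^ n := by
  obtain ⟨C, hC, h⟩ := tail_bound hR hi₀ hmax h0 (Finset.univ.erase i₀) (by simp)
  refine ⟨C, hC, fun n => ?_⟩
  have h1 := h n
  rw [Finset.insert_erase (Finset.mem_univ _), tail, restr_univ] at h1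
  have h2 : ((Finset.univ.erase i₀).filter fun i => i ∈ S ∧ R i = R i₀) =
      (S.filter fun i => R i = R i₀).erase i₀ := by
    ext i; simp
  rwa [h2, Finset.card_erase_of_mem (by simp [hi₀])] at h1

/-- A lower bound for the weight of the states whose whole population, of size `n`, is in `S`. -/
theorem le_wt_slice (R : Fin d → ℝ≥0∞) {S : Finset (Fin d)} {i₀ : Fin d} (hi₀ : i₀ ∈ S) (n : ℕ) :
    (n : ℝ≥0∞) ^ ((S.filter fun i => R i = R i₀).card - 1) * R i₀ ^ n ≤
      (S.filter fun i => R i = R i₀).card ^ ((S.filter fun i => R i = R i₀).card - 1) *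
        ∑' x : Fin d → ℕ, wt R x * if ∑ i, x i = n ∧ ∑ i ∈ S, x i = n then 1 else 0 := by
  classical
  set B := S.filter fun i => R i = R i₀ with hB
  have hiB : i₀ ∈ B := by simp [hB, hi₀]
  set b := B.card with hb
  have hb0 : 0 < b := Finset.card_pos.2 ⟨i₀, hiB⟩
  -- Putting at most `q` jobs at each bottleneck other than `i₀` and the rest at `i₀` yields `(q +
  -- 1) ^ (b - 1)` distinct states, each of weight `R i₀ ^ n`; finally `n ≤ b * (q + 1)`.
  set q := n / b with hq
  set Φ : Finset (Fin d → ℕ) :=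
    Fintype.piFinset fun i => if i ∈ B.erase i₀ then Finset.range (q + 1) else {0} with hΦ
  have hmem : ∀ y ∈ Φ, (∀ i ∈ B.erase i₀, y i ≤ q) ∧ ∀ i ∉ B.erase i₀, y i = 0 := by
    intro y hy
    rw [hΦ, Fintype.mem_piFinset] at hy
    refine ⟨fun i hi => ?_, fun i hi => ?_⟩
    · have := hy i
      rw [if_pos hi, Finset.mem_range] at this
      omega
    · have := hy i
      rwa [if_neg hi, Finset.mem_singleton] at this
  have hcard : Φ.card = (q + 1) ^ (b - 1) := by
    rw [hΦ, Fintype.card_piFinset]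
    have : ∀ i : Fin d, (if i ∈ B.erase i₀ then Finset.range (q + 1) else {0}).card =
        if i ∈ B.erase i₀ then q + 1 else 1 := fun i => by split_ifs <;> simp
    simp only [this]
    rw [Finset.prod_ite_mem, Finset.univ_inter, Finset.prod_const, Finset.card_erase_of_mem hiB]
  have hsumle : ∀ y ∈ Φ, ∑ i, y i ≤ n := by
    intro y hy
    obtain ⟨h1, h2⟩ := hmem y hy
    have h3 : ∑ i, y i = ∑ i ∈ B.erase i₀, y i :=
      (Finset.sum_subset (Finset.subset_univ _) fun i _ hi => h2 i hi).symm
    rw [h3]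
    refine (Finset.sum_le_card_nsmul _ _ q h1).trans ?_
    rw [Finset.card_erase_of_mem hiB, smul_eq_mul]
    calc (b - 1) * q ≤ b * q := Nat.mul_le_mul_right _ (Nat.sub_le _ _)
      _ ≤ n := Nat.mul_div_le n b
  set F : (Fin d → ℕ) → (Fin d → ℕ) := fun y => y + Pi.single i₀ (n - ∑ i, y i) with hF
  have hFsum : ∀ y ∈ Φ, ∑ i, F y i = n := by
    intro y hy
    have := hsumle y hy
    simp [hF, Finset.sum_add_distrib]
    omega
  have hFB : ∀ y ∈ Φ, ∀ i ∉ B, F y i = 0 := by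
    intro y hy i hi
    have h1 := (hmem y hy).2 i (fun h => hi (Finset.mem_of_mem_erase h))
    have h2 : i ≠ i₀ := fun h => hi (h ▸ hiB)
    simp [hF, h1, h2]
  have hFS : ∀ y ∈ Φ, ∑ i ∈ S, F y i = n := by
    intro y hy
    rw [← hFsum y hy]
    refine Finset.sum_subset (Finset.subset_univ _) fun i _ hi => hFB y hy i fun h => hi ?_
    exact (Finset.mem_filter.1 h).1
  have hFinj : Set.InjOn F Φ := by
    intro y hy z hz hyz
    funext i
    by_cases hi : i = i₀
    · have h1 := (hmem y hy).2 i (by simp [hi])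
      have h2 := (hmem z hz).2 i (by simp [hi])
      rw [h1, h2]
    · have := congrFun hyz i
      simpa [hF, hi] using this
  have hwt : ∀ y ∈ Φ, wt R (F y) = R i₀ ^ n := by
    intro y hy
    rw [← hFsum y hy, ← Finset.prod_pow_eq_pow_sum]
    refine Finset.prod_congr rfl fun i _ => ?_
    by_cases hi : i ∈ B
    · rw [(Finset.mem_filter.1 hi).2]
    · rw [hFB y hy i hi, pow_zero, pow_zero]
  have hlow : ((q + 1 : ℕ) : ℝ≥0∞) ^ (b - 1) * R i₀ ^ n ≤
      ∑' x : Fin d → ℕ, wt R x * if ∑ i, x i = n ∧ ∑ i ∈ S, x i = n then 1 else 0 := by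
    refine le_trans (le_of_eq ?_) (ENNReal.sum_le_tsum (Φ.image F))
    rw [Finset.sum_image hFinj, Finset.sum_congr rfl (g := fun _ => R i₀ ^ n), Finset.sum_const,
      hcard, nsmul_eq_mul, Nat.cast_pow]
    intro y hy
    rw [if_pos ⟨hFsum y hy, hFS y hy⟩, mul_one, hwt y hy]
  refine le_trans ?_ (mul_le_mul_right hlow _)
  rw [← mul_assoc, ← mul_pow]
  gcongr
  have : n ≤ b * (q + 1) := by
    rw [hq]; exact (Nat.lt_mul_div_succ n hb0).le
  exact_mod_cast this

end JacksonNetwork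
end

/-! ### Order of the hitting probability, by integration against the invariant measure. -/

noncomputable section

namespace JacksonNetwork

open JacksonEvent
open scoped ENNReal

variable {d : ℕ} {J : JacksonNetwork d}

/-- The hitting probability, set to zero at the origin. -/
def hitOff (J : JacksonNetwork d) (A : Set (Fin d → ℕ)) (x : Fin d → ℕ) : ℝ≥0∞ :=
  if x = 0 then 0 else J.hit A x

theorem eavg_hitOff (A : Set (Fin d → ℕ)) (x : Fin d → ℕ) :
    J.eavg (J.hitOff A) x = J.killedAvg (J.hit A) x := by
  simp only [eavg, killedAvg, hitOff]

theorem hitOff_le (A : Set (Fin d → ℕ)) (x : Fin d → ℕ) : J.hitOff A x ≤ J.hit A x := by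
  rw [hitOff]; split_ifs <;> simp

/-- Setting the value to zero at the origin replaces killing by a defect at that one state, so
ordinary invariance can be used. -/
theorem eavg_hitOff_le (A : Set (Fin d → ℕ)) (x : Fin d → ℕ) :
    J.eavg (J.hitOff A) x ≤ J.hitOff A x + if x = 0 then J.hit A 0 else 0 := by
  rw [eavg_hitOff]
  refine (killedAvg_hit_le A x).trans ?_
  rw [hitOff]
  split_ifs with h
  · rw [h, zero_add]
  · rw [add_zero]

theorem IsInvariant.tsum_mul_iterate {ν : (Fin d → ℕ) → ℝ≥0∞} (hν : J.IsInvariant ν)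
    (f : (Fin d → ℕ) → ℝ≥0∞) (m : ℕ) :
    ∑' x, ν x * (J.eavg)^[m] f x = ∑' x, ν x * f x := by
  induction m with
  | zero => rfl
  | succ m ih => rw [Function.iterate_succ_apply', hν, ih]

theorem eavg_mono {f g : (Fin d → ℕ) → ℝ≥0∞} (h : ∀ x, f x ≤ g x) (x : Fin d → ℕ) :
    J.eavg f x ≤ J.eavg g x :=
  Finset.sum_le_sum fun _ _ => mul_le_mul_right (h _) _

theorem eavg_add (f g : (Fin d → ℕ) → ℝ≥0∞) (x : Fin d → ℕ) :
    J.eavg (fun z => f z + g z) x = J.eavg f x + J.eavg g x := by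
  simp only [eavg, mul_add, Finset.sum_add_distrib]

theorem eavg_iterate_le_one {f : (Fin d → ℕ) → ℝ≥0∞} (h : ∀ x, f x ≤ 1) (m : ℕ) (x : Fin d → ℕ) :
    (J.eavg)^[m] f x ≤ 1 := by
  induction m generalizing x with
  | zero => exact h x
  | succ m ih =>
    rw [Function.iterate_succ_apply', ← sum_ofReal_eventProb (J := J)]
    exact Finset.sum_le_sum fun e _ => mul_le_of_le_one_right' (ih _)

/-- With probability `listProb l` the prescribed events occur and `f` is evaluated at `run x l`;
otherwise it is at most one. The additive form avoids subtraction in `[0, ∞]`. -/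
theorem eavg_iterate_add_listProb_le {f : (Fin d → ℕ) → ℝ≥0∞} (h : ∀ x, f x ≤ 1)
    (l : List (JacksonEvent d)) (x : Fin d → ℕ) :
    (J.eavg)^[l.length] f x + ENNReal.ofReal (J.listProb l) ≤
      1 + ENNReal.ofReal (J.listProb l) * f (run x l) := by
  classical
  induction l generalizing x with
  | nil => simp [add_comm]
  | cons e l ih =>
    have key : ∀ (P : JacksonEvent d → ℝ≥0∞) (c : ℝ≥0∞),
        ∑ e', P e' * (if e' = e then c else 0) = P e * c := fun P c => by
      simp [Finset.sum_ite_eq']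
    rw [List.length_cons, Function.iterate_succ_apply', listProb_cons,
      ENNReal.ofReal_mul (J.eventProb_nonneg e), mul_assoc, run_cons]
    calc _ = ∑ e', ENNReal.ofReal (J.eventProb e') * ((J.eavg)^[l.length] f (step x e') +
          if e' = e then ENNReal.ofReal (J.listProb l) else 0) := by
          simp only [mul_add, Finset.sum_add_distrib]
          rw [key]; rfl
      _ ≤ ∑ e', ENNReal.ofReal (J.eventProb e') * (1 +
          if e' = e then ENNReal.ofReal (J.listProb l) * f (run (step x e) l) else 0) := by
          refine Finset.sum_le_sum fun e' _ => ?_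
          refine mul_le_mul_right ?_ _
          split_ifs with he
          · subst he; exact ih _
          · rw [add_zero, add_zero]; exact eavg_iterate_le_one h _ _
      _ = _ := by
          simp only [mul_add, mul_one, Finset.sum_add_distrib]
          rw [key, sum_ofReal_eventProb]

/-- The probability of hitting `A` during a busy cycle is at most the invariant weight of `A`. -/
theorem hit_zero_le {ν : (Fin d → ℕ) → ℝ≥0∞} (hν : J.IsInvariant ν) (h0 : ν 0 = 1)
    (hfin : ∑' x, ν x ≠ ∞) {A : Set (Fin d → ℕ)} [DecidablePred (· ∈ A)] (hA : (0 : Fin d → ℕ) ∉ A) :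
    J.hit A 0 ≤ ∑' x, ν x * if x ∈ A then 1 else 0 := by
  have hle : ∀ x, J.hitOff A x ≤ 1 := fun x => (hitOff_le A x).trans (hit_le_one A x)
  have htop : ∑' x, ν x * J.hitOff A x ≠ ∞ :=
    ne_top_of_le_ne_top hfin (ENNReal.tsum_le_tsum fun x => mul_le_of_le_one_right' (hle x))
  -- Off `A` this is an equality, and on `A` the indicator covers it. Integrated against `ν`, the
  -- terms in `hitOff` cancel by invariance, which requires the finiteness `htop`.
  have hpt : ∀ x, J.hitOff A x + (if x = 0 then J.hit A 0 else 0) ≤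
      J.eavg (J.hitOff A) x + if x ∈ A then 1 else 0 := by
    intro x
    rw [eavg_hitOff]
    by_cases hx : x ∈ A
    · have hx0 : x ≠ 0 := fun h => hA (h ▸ hx)
      rw [if_pos hx, if_neg hx0, add_zero]
      exact (hle x).trans le_add_self
    · rw [if_neg hx, add_zero, ← hit_of_notMem hx, hitOff]
      split_ifs with h
      · rw [h, zero_add]
      · rw [add_zero]
  have hsum := ENNReal.tsum_le_tsum fun x => mul_le_mul_right (hpt x) (ν x)
  simp only [mul_add, ENNReal.tsum_add] at hsum
  rw [hν] at hsum
  have h1 := (ENNReal.add_le_add_iff_left htop).1 hsum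
  simpa only [mul_ite, mul_zero, tsum_ite_eq, h0, one_mul] using h1

/-- A lower bound for the hitting probability from the origin, by the weight of states from which
the hitting probability becomes small after a fixed sequence of events. -/
theorem le_hit_zero {ν : (Fin d → ℕ) → ℝ≥0∞} (hν : J.IsInvariant ν) (h0 : ν 0 = 1)
    (hfin : ∑' x, ν x ≠ ∞) {A B : Set (Fin d → ℕ)} [DecidablePred (· ∈ B)] (hBA : B ⊆ A)
    (hA : (0 : Fin d → ℕ) ∉ A) (l : List (JacksonEvent d)) {a b : ℝ≥0∞}
    (hab : a + b = ENNReal.ofReal (J.listProb l))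
    (hB : ∀ x ∈ B, ENNReal.ofReal (J.listProb l) * J.hit A (run x l) ≤ b) :
    a * ∑' x, ν x * (if x ∈ B then 1 else 0) ≤ l.length * J.hit A 0 := by
  have hle : ∀ x, J.hitOff A x ≤ 1 := fun x => (hitOff_le A x).trans (hit_le_one A x)
  have htop : ∑' x, ν x * J.hitOff A x ≠ ∞ :=
    ne_top_of_le_ne_top hfin (ENNReal.tsum_le_tsum fun x => mul_le_of_le_one_right' (hle x))
  have hbtop : b ≠ ∞ := ne_top_of_le_ne_top ENNReal.ofReal_ne_top (hab ▸ le_add_self)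
  -- `v` collects the defects at the origin over the steps; by invariance and `ν 0 = 1`, each step
  -- contributes exactly `J.hit A 0` in mean.
  obtain ⟨v, hv, hνv⟩ : ∃ v : (Fin d → ℕ) → ℝ≥0∞,
      (∀ x, (J.eavg)^[l.length] (J.hitOff A) x ≤ J.hitOff A x + v x) ∧
      ∑' x, ν x * v x = l.length * J.hit A 0 := by
    generalize l.length = m
    induction m with
    | zero => exact ⟨fun _ => 0, by simp, by simp⟩
    | succ m ih =>
      obtain ⟨v, hv, hνv⟩ := ih
      refine ⟨fun x => (if x = 0 then J.hit A 0 else 0) + J.eavg v x, fun x => ?_, ?_⟩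
      · rw [Function.iterate_succ_apply', ← add_assoc]
        refine (eavg_mono hv x).trans ?_
        rw [eavg_add]
        gcongr
        exact eavg_hitOff_le A x
      · simp only [mul_add, ENNReal.tsum_add]
        rw [hν, hνv]
        simp only [mul_ite, mul_zero, tsum_ite_eq, h0, one_mul]
        push_cast; ring
  -- On `B` the function equals one, while its average after `l.length` steps is at most `1 - a`: a
  -- strict loss that only the defects at the origin can compensate in mean.
  have hpt : ∀ x, (J.eavg)^[l.length] (J.hitOff A) x + a * (if x ∈ B then 1 else 0) ≤
      J.hitOff A x + v x := by
    intro x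
    split_ifs with hx
    · have h1 : J.hitOff A x = 1 := by
        rw [hitOff, if_neg (fun h : x = 0 => hA (h ▸ hBA hx)), hit_of_mem (hBA hx)]
      have h2 := eavg_iterate_add_listProb_le (J := J) hle l x
      rw [← hab, ← add_assoc] at h2
      have h3 : 1 + (a + b) * J.hitOff A (run x l) ≤ 1 + b := by
        gcongr
        rw [hab]
        exact (mul_le_mul_right (hitOff_le A _) _).trans (hB x hx)
      rw [mul_one, h1]
      exact ((ENNReal.add_le_add_iff_right hbtop).1 (h2.trans h3)).trans le_self_add
    · rw [mul_zero, add_zero]; exact hv x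
  have hsum := ENNReal.tsum_le_tsum fun x => mul_le_mul_right (hpt x) (ν x)
  simp only [mul_add, ENNReal.tsum_add] at hsum
  rw [hν.tsum_mul_iterate, hνv] at hsum
  have := (ENNReal.add_le_add_iff_left htop).1 hsum
  refine le_trans (le_of_eq ?_) this
  rw [← ENNReal.tsum_mul_left]
  exact tsum_congr fun x => by ring

/-- The states in which the population of the stations in `S` is at least `n`. -/
def target (S : Finset (Fin d)) (n : ℕ) : Set (Fin d → ℕ) := {x | n ≤ ∑ i ∈ S, x i}

theorem isUpperSet_target (S : Finset (Fin d)) (n : ℕ) : IsUpperSet (target S n) :=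
  fun _ _ h hx => le_trans (show n ≤ _ from hx) (Finset.sum_le_sum fun i _ => h i)

theorem erho_lt_one (hopen : J.IsOpenNetwork) (hst : J.IsStable) (i : Fin d) : J.erho i < 1 := by
  rw [erho, ENNReal.ofReal_lt_one]; exact rho_lt_one hopen hst i

theorem beta_eq (S : Finset (Fin d)) (hS : S.Nonempty) {i₀ : Fin d}
    (hi₀ : J.rhoStar S hS = J.rho i₀) (hopen : J.IsOpenNetwork) (hst : J.IsStable) :
    J.beta S hS = (S.filter fun i => J.erho i = J.erho i₀).card := by
  rw [beta, ← Set.ncard_coe_finset]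
  congr 1
  ext i
  rw [Finset.mem_coe, Finset.mem_filter, erho, erho,
    ENNReal.ofReal_eq_ofReal_iff (rho_nonneg hopen hst _) (rho_nonneg hopen hst _), ← hi₀]
  rfl

/-- The probability of reaching the target set before the origin is of order
`n ^ (β - 1) ρ_* ^ n`. -/
theorem hit_target_bounds (hopen : J.IsOpenNetwork) (hst : J.IsStable) (S : Finset (Fin d))
    (hS : S.Nonempty) (x : Fin d → ℕ) :
    ∃ c C : ℝ, 0 < c ∧ 0 < C ∧ ∀ᶠ n : ℕ in atTop,
      c * (n : ℝ) ^ (J.beta S hS - 1) * J.rhoStar S hS ^ n ≤ (J.hit (target S n) x).toReal ∧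
      (J.hit (target S n) x).toReal ≤ C * (n : ℝ) ^ (J.beta S hS - 1) * J.rhoStar S hS ^ n := by
  classical
  obtain ⟨i₀, hi₀, hstar⟩ := Finset.exists_mem_eq_sup' hS J.rho
  change J.rhoStar S hS = J.rho i₀ at hstar
  have : Nonempty (Fin d) := ⟨i₀⟩
  have hR := erho_lt_one hopen hst
  have hmax : ∀ i ∈ S, J.erho i ≤ J.erho i₀ := fun i hi =>
    ENNReal.ofReal_le_ofReal (hstar ▸ Finset.le_sup' J.rho hi)
  have hR0 : J.erho i₀ ≠ 0 := (ENNReal.ofReal_pos.2 (rho_pos hopen hst i₀)).ne'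
  have hρ := rho_nonneg hopen hst i₀
  have hinv := isInvariant_wt hopen hst
  obtain ⟨C, hC, htail⟩ := wt_tail_le hR hi₀ hmax hR0
  have hslice := le_wt_slice J.erho hi₀
  rw [← beta_eq S hS hstar hopen hst] at htail hslice
  rw [hstar]
  set p := J.beta S hS - 1 with hp
  have hRtop : J.erho i₀ ≠ ∞ := ENNReal.ofReal_ne_top
  have hfin : ∑' x, wt J.erho x ≠ ∞ := by
    refine ne_top_of_le_ne_top ?_ (le_trans (le_of_eq ?_) (htail 0))
    · finiteness
    · simp
  have hnot : ∀ n : ℕ, 1 ≤ n → (0 : Fin d → ℕ) ∉ target S n := fun n hn h => by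
    have : n ≤ ∑ i ∈ S, (0 : Fin d → ℕ) i := h
    simp at this; omega
  obtain ⟨c, hc, hcx⟩ := hopen.exists_mul_hit_le x
  obtain ⟨K, hK⟩ := exists_hit_le_half hopen hst
  obtain ⟨l, hl, hdrain⟩ := hopen.exists_drain_list K
  -- Capping at one rules out `c = ∞`, whose real part would be zero.
  have hc1 : 0 < (min c 1).toReal :=
    ENNReal.toReal_pos (by simp [hc]) (ne_top_of_le_ne_top ENNReal.one_ne_top (min_le_right _ _))
  have hbeta : 0 < ((J.beta S hS : ℝ) ^ p) := by
    have : 0 < J.beta S hS := by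
      rw [beta_eq S hS hstar hopen hst]
      exact Finset.card_pos.2 ⟨i₀, by simp [hi₀]⟩
    positivity
  refine ⟨J.listProb l / 2 / ((J.beta S hS : ℝ) ^ p * (l.length + 1)),
    (C.toReal + 1) * 2 ^ p / (min c 1).toReal, by positivity, by positivity, ?_⟩
  filter_upwards [eventually_ge_atTop K, eventually_ge_atTop 1] with n hnK hn1
  have hx1 : (J.hit (target S n) x) ≠ ∞ := hit_ne_top _ _
  constructor
  -- On the slice the whole population is `n` and lies in `S`. After `l` at most `n - K` jobs
  -- remain, so a return to the target has probability at most `1/2`, and half of `listProb l` is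
  -- gained.
  · have h1 := le_hit_zero (J := J) hinv (wt_zero _) hfin (A := target S n)
      (B := {x | ∑ i, x i = n ∧ ∑ i ∈ S, x i = n}) (fun x hx => hx.2.ge) (hnot n hn1) l
      (a := ENNReal.ofReal (J.listProb l / 2)) (b := ENNReal.ofReal (J.listProb l / 2))
      (by rw [← ENNReal.ofReal_add (by positivity) (by positivity), add_halves])
      (fun x hx => by
        have h2 := hK n (target S n) (fun x hx => le_trans (show n ≤ _ from hx)
          (Finset.sum_le_sum_of_subset (Finset.subset_univ S))) (run x l) (by
            have h3 := hdrain x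
            have h4 : ∑ i, x i = n := hx.1
            omega)
        refine (mul_le_mul_right h2 _).trans (le_of_eq ?_)
        rw [← ENNReal.ofReal_mul hl.le]; congr 1; ring)
    have h2 : ENNReal.ofReal (J.listProb l / 2) * ((n : ℝ≥0∞) ^ p * J.erho i₀ ^ n) ≤
        (J.beta S hS : ℝ≥0∞) ^ p * (l.length * J.hit (target S n) x) := by
      refine (mul_le_mul_right (hslice n) _).trans ?_
      rw [mul_left_comm]
      refine mul_le_mul_right (le_trans (le_of_eq ?_) (h1.trans (mul_le_mul_right ?_ _))) _
      · exact congrArg _ (tsum_congr fun x => congrArg _ (if_congr Iff.rfl rfl rfl))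
      · exact hit_mono_state (isUpperSet_target S n) zero_le
    have h3 := ENNReal.toReal_mono (by finiteness) h2
    simp only [ENNReal.toReal_mul, ENNReal.toReal_pow, ENNReal.toReal_natCast, erho,
      ENNReal.toReal_ofReal hρ, ENNReal.toReal_ofReal (half_pos hl).le] at h3
    rw [div_mul_eq_mul_div, div_mul_eq_mul_div, div_le_iff₀ (by positivity)]
    have h4 : (J.beta S hS : ℝ) ^ p * (l.length * (J.hit (target S n) x).toReal) ≤
        (J.beta S hS : ℝ) ^ p * ((l.length + 1) * (J.hit (target S n) x).toReal) := by
      have : 0 ≤ (J.hit (target S n) x).toReal := ENNReal.toReal_nonneg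
      gcongr
      linarith
    linarith
  · have h1 : min c 1 * J.hit (target S n) x ≤ C * (n + 1) ^ p * J.erho i₀ ^ n := by
      refine (mul_le_mul_left (min_le_left c 1) _).trans ((hcx _).trans ?_)
      have h7 := hit_zero_le (J := J) hinv (wt_zero _) hfin (hnot n hn1)
      refine h7.trans (le_trans (le_of_eq ?_) (htail n))
      exact tsum_congr fun x => congrArg _ (if_congr Iff.rfl rfl rfl)
    have h2 := ENNReal.toReal_mono (by finiteness) h1
    have h5 : ((n : ℝ≥0∞) + 1).toReal = (n : ℝ) + 1 := by
      rw [ENNReal.toReal_add (by finiteness) (by finiteness)]; simp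
    simp only [ENNReal.toReal_mul, ENNReal.toReal_pow, h5, erho, ENNReal.toReal_ofReal hρ] at h2
    rw [div_mul_eq_mul_div, div_mul_eq_mul_div, le_div_iff₀ hc1, mul_comm]
    refine h2.trans ?_
    have h3 : ((n : ℝ) + 1) ^ p ≤ 2 ^ p * (n : ℝ) ^ p := by
      rw [← mul_pow]
      have : (1 : ℝ) ≤ n := by exact_mod_cast hn1
      gcongr
      linarith
    have h4 : C.toReal ≤ C.toReal + 1 := by linarith
    have h6 : 0 ≤ C.toReal := ENNReal.toReal_nonneg
    calc _ ≤ (C.toReal + 1) * (2 ^ p * (n : ℝ) ^ p) * J.rho i₀ ^ n := by gcongr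
      _ = _ := by ring

end JacksonNetwork
end

/-! ### From event sequences to the law of the first entry. -/

noncomputable section

theorem MeasurableSpace.comap_pi_le {ι Ω β κ : Type*} [MeasurableSpace β] (f : ι → Ω → β)
    (c : κ → ι) : MeasurableSpace.comap (fun ω k => f (c k) ω) MeasurableSpace.pi ≤
      ⨆ i ∈ Set.range c, MeasurableSpace.comap (f i) inferInstance := by
  rw [MeasurableSpace.pi, MeasurableSpace.comap_iSup]
  refine iSup_le fun k => ?_
  rw [MeasurableSpace.comap_comp]
  exact le_iSup₂_of_le (c k) ⟨k, rfl⟩ le_rfl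

theorem ProbabilityTheory.iIndepFun.indepFun_of_disjoint_range {ι Ω β κ κ' : Type*}
    [MeasurableSpace Ω] [MeasurableSpace β] {μ : Measure Ω} {f : ι → Ω → β} (hf : iIndepFun f μ)
    (hm : ∀ i, Measurable (f i)) (a : κ → ι) (b : κ' → ι) (hab : ∀ k k', a k ≠ b k') :
    IndepFun (fun ω k => f (a k) ω) (fun ω k => f (b k) ω) μ := by
  have h := indep_iSup_of_disjoint (fun i => (hm i).comap_le) hf.iIndep
    (S := Set.range a) (T := Set.range b) (by
      rw [Set.disjoint_left]
      rintro _ ⟨k, rfl⟩ ⟨k', hk'⟩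
      exact hab k k' hk'.symm)
  exact indep_of_indep_of_le_left
    (indep_of_indep_of_le_right h (MeasurableSpace.comap_pi_le f b))
    (MeasurableSpace.comap_pi_le f a)

open JacksonEvent
open scoped ENNReal

variable {d : ℕ}

theorem jacksonPath_succ (x : Fin d → ℕ) (ξ : ℕ → JacksonEvent d) (t : ℕ) :
    jacksonPath x ξ (t + 1) = jacksonPath (step x (ξ 0)) (fun s => ξ (s + 1)) t := by
  induction t with
  | zero => rfl
  | succ t ih =>
    rw [jacksonPath, ih]; rfl

theorem firstEntry_eq_some {A : Set (Fin d → ℕ)} {q : ℕ → (Fin d → ℕ)} {t : ℕ}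
    (ht : q t ∈ A ∧ ∀ s, 1 ≤ s → s ≤ t → q s ≠ 0)
    (hmin : ∀ t' < t, ¬ (q t' ∈ A ∧ ∀ s, 1 ≤ s → s ≤ t' → q s ≠ 0)) :
    firstEntry A q = some (q t) := by
  classical
  have h := (Nat.find_eq_iff ⟨t, ht⟩).2 ⟨ht, hmin⟩
  rw [firstEntry, dif_pos ⟨t, ht⟩]
  refine congrArg (fun t => some (q t)) ?_
  convert h

theorem firstEntry_of_mem {A : Set (Fin d → ℕ)} {x : Fin d → ℕ} (hx : x ∈ A)
    (ξ : ℕ → JacksonEvent d) : firstEntry A (jacksonPath x ξ) = some x :=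
  firstEntry_eq_some (t := 0) ⟨hx, fun s h1 h2 => by omega⟩ fun s h => by omega

theorem firstEntry_of_notMem {A : Set (Fin d → ℕ)} {x : Fin d → ℕ} (hx : x ∉ A)
    {ξ : ℕ → JacksonEvent d} (h0 : step x (ξ 0) ≠ 0) :
    firstEntry A (jacksonPath x ξ) =
      firstEntry A (jacksonPath (step x (ξ 0)) fun s => ξ (s + 1)) := by
  classical
  have hiff : ∀ t, (jacksonPath x ξ (t + 1) ∈ A ∧
      ∀ s, 1 ≤ s → s ≤ t + 1 → jacksonPath x ξ s ≠ 0) ↔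
      (jacksonPath (step x (ξ 0)) (fun s => ξ (s + 1)) t ∈ A ∧
        ∀ s, 1 ≤ s → s ≤ t → jacksonPath (step x (ξ 0)) (fun s => ξ (s + 1)) s ≠ 0) := by
    intro t
    simp only [← jacksonPath_succ]
    refine and_congr_right fun _ => ⟨fun h s h1 h2 => h (s + 1) (by omega) (by omega),
      fun h s h1 h2 => ?_⟩
    rcases s with _ | s
    · omega
    · rcases Nat.eq_zero_or_pos s with rfl | hs
      · exact h0
      · exact h s hs (by omega)
  by_cases h : ∃ t, jacksonPath (step x (ξ 0)) (fun s => ξ (s + 1)) t ∈ A ∧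
        ∀ s, 1 ≤ s → s ≤ t → jacksonPath (step x (ξ 0)) (fun s => ξ (s + 1)) s ≠ 0
  · rw [firstEntry_eq_some (Nat.find_spec h) fun t' ht' => Nat.find_min h ht',
      firstEntry_eq_some ((hiff _).2 (Nat.find_spec h)), jacksonPath_succ]
    intro t' ht'
    rcases t' with _ | t'
    · exact fun hc => hx hc.1
    · rw [hiff]; exact Nat.find_min h (by omega)
  · have h1 : ¬ ∃ t, jacksonPath x ξ t ∈ A ∧ ∀ s, 1 ≤ s → s ≤ t → jacksonPath x ξ s ≠ 0 := by
      rintro ⟨t, ht⟩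
      rcases t with _ | t
      · exact hx ht.1
      · exact h ⟨t, (hiff t).1 ht⟩
    rw [firstEntry, firstEntry, dif_neg h1, dif_neg h]

theorem mem_of_firstEntry {A : Set (Fin d → ℕ)} {q : ℕ → (Fin d → ℕ)} {z : Fin d → ℕ}
    (h : firstEntry A q = some z) : z ∈ A := by
  classical
  rw [firstEntry] at h
  split_ifs at h with h1
  obtain rfl := Option.some_injective _ h
  convert (Nat.find_spec h1).1

open Classical in
/-- The value of `f` at the first entry of a trajectory into `A`, if this happens within `k` steps
and before hitting the origin. -/
def pathEntry (A : Set (Fin d → ℕ)) (f : (Fin d → ℕ) → ℝ≥0∞) :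
    ℕ → (Fin d → ℕ) → (ℕ → JacksonEvent d) → ℝ≥0∞
  | 0, x, _ => if x ∈ A then f x else 0
  | k + 1, x, ξ => if x ∈ A then f x else
      if step x (ξ 0) = 0 then 0 else pathEntry A f k (step x (ξ 0)) fun s => ξ (s + 1)

/-- The step-limited version is recursive in the first event, so measurability and expectations
follow by induction and pass to the monotone limit. -/
theorem iSup_pathEntry (A : Set (Fin d → ℕ)) (f : (Fin d → ℕ) → ℝ≥0∞) (x : Fin d → ℕ)
    (ξ : ℕ → JacksonEvent d) :
    ⨆ k, pathEntry A f k x ξ = (firstEntry A (jacksonPath x ξ)).elim 0 f := by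
  classical
  refine le_antisymm (iSup_le fun k => ?_) ?_
  · induction k generalizing x ξ with
    | zero =>
      rw [pathEntry]
      split_ifs with hx
      · rw [firstEntry_of_mem hx]; rfl
      · exact zero_le
    | succ k ih =>
      rw [pathEntry]
      split_ifs with hx h0
      · rw [firstEntry_of_mem hx]; rfl
      · exact zero_le
      · rw [firstEntry_of_notMem hx h0]; exact ih _ _
  · have key : ∀ t x ξ, (jacksonPath x ξ t ∈ A ∧ ∀ s, 1 ≤ s → s ≤ t → jacksonPath x ξ s ≠ 0) →
        (firstEntry A (jacksonPath x ξ)).elim 0 f ≤ pathEntry A f t x ξ := by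
      intro t
      induction t with
      | zero =>
        intro x ξ h
        have hx : x ∈ A := h.1
        rw [firstEntry_of_mem hx, pathEntry, if_pos hx]; rfl
      | succ t ih =>
        intro x ξ h
        rw [pathEntry]
        have h0 : step x (ξ 0) ≠ 0 := h.2 1 le_rfl (by omega)
        split_ifs with hx
        · rw [firstEntry_of_mem hx]; rfl
        · rw [firstEntry_of_notMem hx h0]
          refine ih _ _ ⟨by rw [← jacksonPath_succ]; exact h.1, fun s h1 h2 => ?_⟩
          rw [← jacksonPath_succ]; exact h.2 (s + 1) (by omega) (by omega)
    by_cases h : ∃ t, jacksonPath x ξ t ∈ A ∧ ∀ s, 1 ≤ s → s ≤ t → jacksonPath x ξ s ≠ 0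
    · obtain ⟨t, ht⟩ := h
      exact (key t x ξ ht).trans (le_iSup (fun k => pathEntry A f k x ξ) t)
    · rw [firstEntry, dif_neg h]; exact zero_le

theorem pathEntry_mono (A : Set (Fin d → ℕ)) (f : (Fin d → ℕ) → ℝ≥0∞) :
    Monotone fun k => pathEntry A f k := by
  refine monotone_nat_of_le_succ fun k => ?_
  induction k with
  | zero =>
    intro x ξ
    simp only [pathEntry]
    split_ifs <;> simp
  | succ k ih =>
    intro x ξ
    rw [pathEntry, pathEntry]
    split_ifs
    · exact le_rfl
    · exact le_rfl
    · exact ih _ _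

-- Each summand is a function of the first event times a function of the shifted sequence, the form
-- to which independence applies.
open Classical in
theorem pathEntry_succ_of_notMem {A : Set (Fin d → ℕ)} (f : (Fin d → ℕ) → ℝ≥0∞) {x : Fin d → ℕ}
    (hx : x ∉ A) (k : ℕ) (ξ : ℕ → JacksonEvent d) :
    pathEntry A f (k + 1) x ξ = ∑ e, (if ξ 0 = e then 1 else 0) *
      (if step x e = 0 then 0 else pathEntry A f k (step x e) fun s => ξ (s + 1)) := by
  rw [Finset.sum_eq_single (ξ 0)]
  · rw [if_pos rfl, one_mul, pathEntry, if_neg hx]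
  · intro e _ he
    rw [if_neg he.symm, zero_mul]
  · exact fun h => absurd (Finset.mem_univ _) h

theorem measurable_shift : Measurable fun (ξ : ℕ → JacksonEvent d) (s : ℕ) => ξ (s + 1) :=
  measurable_pi_lambda _ fun s => measurable_pi_apply (s + 1)

theorem measurable_indicator_event (e : JacksonEvent d) [DecidableEq (JacksonEvent d)] :
    Measurable fun e' : JacksonEvent d => if e' = e then (1 : ℝ≥0∞) else 0 :=
  Measurable.of_discrete

theorem measurable_pathEntry (A : Set (Fin d → ℕ)) (f : (Fin d → ℕ) → ℝ≥0∞) (k : ℕ)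
    (x : Fin d → ℕ) : Measurable (pathEntry A f k x) := by
  classical
  induction k generalizing x with
  | zero => exact measurable_const
  | succ k ih =>
    by_cases hx : x ∈ A
    · have : pathEntry A f (k + 1) x = fun _ => f x := by
        funext ξ; rw [pathEntry, if_pos hx]
      rw [this]; exact measurable_const
    · have : pathEntry A f (k + 1) x = _ := funext (pathEntry_succ_of_notMem f hx k)
      rw [this]
      refine Finset.measurable_fun_sum _ fun e _ => Measurable.mul ?_ ?_
      · exact (measurable_indicator_event e).comp (measurable_pi_apply 0)
      · split_ifs
        · exact measurable_const
        · exact (ih _).comp measurable_shift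

theorem measurable_firstEntry (A : Set (Fin d → ℕ)) (f : (Fin d → ℕ) → ℝ≥0∞) (x : Fin d → ℕ) :
    Measurable fun ξ => (firstEntry A (jacksonPath x ξ)).elim 0 f := by
  simp only [← iSup_pathEntry]
  exact Measurable.iSup fun k => measurable_pathEntry A f k x

section law

variable {Ω : Type*} [MeasurableSpace Ω] {μ : Measure Ω} (J : JacksonNetwork d)

theorem lintegral_pathEntry {Y : ℕ → Ω → JacksonEvent d} (hmeas : ∀ k, Measurable (Y k))
    (hlaw : ∀ k e, μ {ω | Y k ω = e} = ENNReal.ofReal (J.eventProb e)) (hindep : iIndepFun Y μ)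
    (A : Set (Fin d → ℕ)) (f : (Fin d → ℕ) → ℝ≥0∞) (k : ℕ) (x : Fin d → ℕ) :
    ∫⁻ ω, pathEntry A f k x (fun t => Y t ω) ∂μ = J.entryIter A f k x := by
  classical
  have := hindep.isProbabilityMeasure
  induction k generalizing x Y with
  | zero => simp [pathEntry, JacksonNetwork.entryIter]
  | succ k ih =>
    rw [JacksonNetwork.entryIter]
    split_ifs with hx
    · simp [pathEntry, hx]
    · simp only [pathEntry_succ_of_notMem f hx]
      have hms : Measurable fun ω (t : ℕ) => Y (t + 1) ω :=
        measurable_pi_lambda _ fun t => hmeas _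
      have hm1 : ∀ e, Measurable fun ω => if Y 0 ω = e then (1 : ℝ≥0∞) else 0 := fun e =>
        (measurable_indicator_event e).comp (hmeas 0)
      have hm2 : ∀ e, Measurable fun ω => if step x e = 0 then 0 else
          pathEntry A f k (step x e) fun s => Y (s + 1) ω := fun e => by
        split_ifs
        · exact measurable_const
        · exact (measurable_pathEntry A f k (step x e)).comp hms
      have hm3 : ∀ e, Measurable fun ω => (if Y 0 ω = e then (1 : ℝ≥0∞) else 0) *
          (if step x e = 0 then 0 else pathEntry A f k (step x e) fun s => Y (s + 1) ω) :=
        fun e => (hm1 e).mul (hm2 e)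
      rw [lintegral_finsetSum _ fun e _ => hm3 e]
      refine Finset.sum_congr rfl fun e _ => ?_
      have hind : IndepFun (fun ω => if Y 0 ω = e then (1 : ℝ≥0∞) else 0)
          (fun ω => if step x e = 0 then 0 else
            pathEntry A f k (step x e) fun s => Y (s + 1) ω) μ := by
        have h := hindep.indepFun_of_disjoint_range hmeas (fun _ : Unit => 0)
          (fun t : ℕ => t + 1) (fun _ t => by simp)
        refine h.comp (φ := fun η : Unit → JacksonEvent d => if η () = e then (1 : ℝ≥0∞) else 0)
          (ψ := fun ξ : ℕ → JacksonEvent d => if step x e = 0 then 0 else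
            pathEntry A f k (step x e) ξ) ?_ ?_
        · exact (measurable_indicator_event e).comp (measurable_pi_apply ())
        · split_ifs
          · exact measurable_const
          · exact measurable_pathEntry A f k (step x e)
      rw [lintegral_mul_eq_lintegral_mul_lintegral_of_indepFun'' (hm1 e).aemeasurable
        (hm2 e).aemeasurable hind]
      congr 1
      · rw [← hlaw 0 e]
        have : (fun ω => if Y 0 ω = e then (1 : ℝ≥0∞) else 0) =
            {ω | Y 0 ω = e}.indicator fun _ => 1 := by
          funext ω; simp [Set.indicator_apply]
        have hset : MeasurableSet {ω | Y 0 ω = e} := hmeas 0 (measurableSet_singleton e)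
        rw [this, lintegral_indicator_const hset, one_mul]
      · split_ifs
        · simp
        · exact ih (fun t => hmeas (t + 1)) (fun t => hlaw (t + 1))
            (hindep.precomp (add_left_injective 1)) _

theorem lintegral_firstEntry {Y : ℕ → Ω → JacksonEvent d} (hmeas : ∀ k, Measurable (Y k))
    (hlaw : ∀ k e, μ {ω | Y k ω = e} = ENNReal.ofReal (J.eventProb e)) (hindep : iIndepFun Y μ)
    (A : Set (Fin d → ℕ)) (f : (Fin d → ℕ) → ℝ≥0∞) (x : Fin d → ℕ) :
    ∫⁻ ω, (firstEntry A (jacksonPath x fun t => Y t ω)).elim 0 f ∂μ = J.entryVal A f x := by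
  simp only [← iSup_pathEntry]
  rw [lintegral_iSup]
  · simp only [lintegral_pathEntry J hmeas hlaw hindep]; rfl
  · exact fun k => (measurable_pathEntry A f k x).comp (measurable_pi_lambda _ hmeas)
  · exact fun k l hkl ω => pathEntry_mono A f hkl x _

end law

/-! ### Expected number of final particles. -/

section split

variable {r : ℕ}

/-- Summing over the possible entrance states makes the starting points of the children
deterministic, so that they are independent of the parent's path. -/
theorem splitCount_succ (C : ℕ → Set (Fin d → ℕ)) (k : ℕ) (x : Fin d → ℕ)
    (ξ : List (Fin r) → ℕ → JacksonEvent d) :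
    (splitCount C (k + 1) x ξ : ℝ≥0∞) = ∑' z : Fin d → ℕ,
      (firstEntry (C k) (jacksonPath x (ξ []))).elim 0 (fun y => if y = z then 1 else 0) *
        ∑ c : Fin r, (splitCount C k z (fun u => ξ (c :: u)) : ℝ≥0∞) := by
  rw [splitCount]
  rcases h : firstEntry (C k) (jacksonPath x (ξ [])) with _ | z
  · simp
  · rw [tsum_eq_single z]
    · simp
    · intro y hy; simp [hy.symm]

theorem measurable_splitCount (C : ℕ → Set (Fin d → ℕ)) (k : ℕ) (x : Fin d → ℕ) :
    Measurable fun ξ : List (Fin r) → ℕ → JacksonEvent d => (splitCount C k x ξ : ℝ≥0∞) := by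
  induction k generalizing x with
  | zero => simp [splitCount]
  | succ k ih =>
    simp only [splitCount_succ]
    refine Measurable.tsum fun z => Measurable.mul ?_ ?_
    · exact (measurable_firstEntry (C k) _ x).comp (measurable_pi_apply [])
    · refine Finset.measurable_fun_sum _ fun c _ => (ih z).comp ?_
      exact measurable_pi_lambda _ fun u => measurable_pi_apply (c :: u)

variable {Ω : Type*} [MeasurableSpace Ω] {μ : Measure Ω} (J : JacksonNetwork d)

/-- The expected number of final particles is the number of splittings along a path, times the
probability that a single path reaches the target set. -/
theorem lintegral_splitCount {C : ℕ → Set (Fin d → ℕ)} (hC : ∀ k, C 0 ⊆ C k)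
    {Y : List (Fin r) → ℕ → Ω → JacksonEvent d} (hmeas : ∀ u k, Measurable (Y u k))
    (hlaw : ∀ u k e, μ {ω | Y u k ω = e} = ENNReal.ofReal (J.eventProb e))
    (hindep : iIndepFun (fun p : List (Fin r) × ℕ => Y p.1 p.2) μ) (k : ℕ) {x : Fin d → ℕ}
    (hx : x ∈ C k) :
    ∫⁻ ω, (splitCount C k x (fun u t => Y u t ω) : ℝ≥0∞) ∂μ = r ^ k * J.hit (C 0) x := by
  have := hindep.isProbabilityMeasure
  induction k generalizing x Y with
  | zero => simp [splitCount, JacksonNetwork.hit_of_mem hx]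
  | succ k ih =>
    set A := C k with hA
    set N : (Fin d → ℕ) → Ω → ℝ≥0∞ := fun z ω =>
      (firstEntry A (jacksonPath x fun t => Y [] t ω)).elim 0 (fun y => if y = z then 1 else 0)
      with hN
    have hY0 : Measurable fun ω (t : ℕ) => Y [] t ω := measurable_pi_lambda _ fun t => hmeas _ _
    have hNm : ∀ z, Measurable (N z) := fun z => (measurable_firstEntry A _ x).comp hY0
    have hYc : ∀ c, Measurable fun ω u t => Y (c :: u) t ω := fun c =>
      measurable_pi_lambda _ fun u => measurable_pi_lambda _ fun t => hmeas _ _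
    have hXm : ∀ z c, Measurable fun ω =>
        (splitCount C k z (fun u t => Y (c :: u) t ω) : ℝ≥0∞) := fun z c =>
      (measurable_splitCount C k z).comp (hYc c)
    -- The parent uses the label `[]` and the child `c` only labels starting with `c`, hence
    -- independence. Induction gives each child `r ^ k` times the hitting probability, and summing
    -- over the `r` children raises the power; states outside `C k` are never entrance states.
    have hterm : ∀ z, ∫⁻ ω, N z ω * ∑ c : Fin r,
        (splitCount C k z (fun u t => Y (c :: u) t ω) : ℝ≥0∞) ∂μ =
        ∫⁻ ω, N z ω * (r ^ (k + 1) * J.hit (C 0) z) ∂μ := by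
      intro z
      by_cases hz : z ∈ A
      · have hNX : ∀ c, Measurable fun ω => N z ω *
            (splitCount C k z (fun u t => Y (c :: u) t ω) : ℝ≥0∞) := fun c =>
          (hNm z).mul (hXm z c)
        simp only [Finset.mul_sum]
        rw [lintegral_finsetSum _ fun c _ => hNX c,
          lintegral_mul_const _ (hNm z)]
        have hc : ∀ c : Fin r, ∫⁻ ω, N z ω *
            (splitCount C k z (fun u t => Y (c :: u) t ω) : ℝ≥0∞) ∂μ =
            (∫⁻ ω, N z ω ∂μ) * (r ^ k * J.hit (C 0) z) := by
          intro c
          have hind := hindep.indepFun_of_disjoint_range (fun p => hmeas p.1 p.2)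
            (fun t : ℕ => (([] : List (Fin r)), t))
            (fun p : List (Fin r) × ℕ => (c :: p.1, p.2)) (fun t p => by simp)
          have hind2 := hind.comp
            (φ := fun ξ : ℕ → JacksonEvent d => (firstEntry A (jacksonPath x ξ)).elim (0 : ℝ≥0∞)
              (fun y => if y = z then 1 else 0))
            (ψ := fun η : List (Fin r) × ℕ → JacksonEvent d =>
              (splitCount C k z (fun u t => η (u, t)) : ℝ≥0∞))
            (measurable_firstEntry A _ x) ((measurable_splitCount C k z).comp
              (measurable_pi_lambda _ fun u => measurable_pi_lambda _ fun t =>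
                measurable_pi_apply (u, t)))
          rw [lintegral_mul_eq_lintegral_mul_lintegral_of_indepFun'' (hNm z).aemeasurable
            (hXm z c).aemeasurable hind2]
          congr 1
          refine ih (Y := fun u => Y (c :: u)) (fun u => hmeas _) (fun u => hlaw _) ?_ hz
          refine hindep.precomp (g := fun p : List (Fin r) × ℕ => (c :: p.1, p.2)) ?_
          rintro ⟨u, t⟩ ⟨v, s⟩ h
          simpa using h
        simp only [hc, Finset.sum_const, Finset.card_univ, Fintype.card_fin, nsmul_eq_mul]
        rw [pow_succ]; ring
      · have h0 : ∀ ω, N z ω = 0 := fun ω => by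
          simp only [hN]
          rcases h : firstEntry A (jacksonPath x fun t => Y [] t ω) with _ | y
          · rfl
          · have hy := mem_of_firstEntry h
            simp only [Option.elim]
            rw [if_neg]
            rintro rfl; exact hz hy
        simp [h0]
    have hval : ∀ ω, ∑' z, N z ω * (r ^ (k + 1) * J.hit (C 0) z) =
        r ^ (k + 1) * (firstEntry A (jacksonPath x fun t => Y [] t ω)).elim 0 (J.hit (C 0)) := by
      intro ω
      simp only [hN]
      rcases firstEntry A (jacksonPath x fun t => Y [] t ω) with _ | y
      · simp
      · rw [tsum_eq_single y]
        · simp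
        · intro z hz; simp [hz.symm]
    simp only [splitCount_succ]
    have hNS : ∀ z, Measurable fun ω => N z ω * ∑ c : Fin r,
        (splitCount C k z (fun u t => Y (c :: u) t ω) : ℝ≥0∞) := fun z =>
      (hNm z).mul (Finset.measurable_fun_sum _ fun c _ => hXm z c)
    change ∫⁻ ω, ∑' z, N z ω * ∑ c : Fin r,
      (splitCount C k z (fun u t => Y (c :: u) t ω) : ℝ≥0∞) ∂μ = _
    rw [lintegral_tsum fun z => (hNS z).aemeasurable, tsum_congr hterm, ← lintegral_tsum fun z => ((hNm z).mul_const _).aemeasurable]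
    simp only [hval]
    have hfe : Measurable fun ω =>
        (firstEntry A (jacksonPath x fun t => Y [] t ω)).elim 0 (J.hit (C 0)) :=
      (measurable_firstEntry A _ x).comp hY0
    rw [lintegral_const_mul _ hfe,
      lintegral_firstEntry J (hmeas []) (hlaw []) (hindep.precomp
        (g := fun t : ℕ => (([] : List (Fin r)), t)) fun _ _ h => by simpa using h),
      JacksonNetwork.entryVal_hit (hC k)]

end split
end

/-! ### Levels, the subsolution and the conclusion. -/

noncomputable section

namespace JacksonNetwork

open scoped ENNReal

variable {d : ℕ} (J : JacksonNetwork d)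

theorem levelSet_zero (S : Finset (Fin d)) (hS : S.Nonempty) (Δ : ℝ) (r n : ℕ) :
    J.levelSet S hS Δ r n 0 = target S n := by
  ext x; simp [levelSet, target]

theorem levelSet_zero_subset (S : Finset (Fin d)) (hS : S.Nonempty) (Δ : ℝ) (r n k : ℕ) :
    J.levelSet S hS Δ r n 0 ⊆ J.levelSet S hS Δ r n k := by
  rw [levelSet_zero]; exact fun x hx => Or.inl hx

/-- The scaled value `n W(x / n)` of the subsolution. -/
def scaledSub (S : Finset (Fin d)) (hS : S.Nonempty) (n : ℕ) (x : Fin d → ℕ) : ℝ :=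
  ∑ i, Real.log (J.rho i) * x i - n * Real.log (J.rhoStar S hS)

variable {J}

/-- The factor `Δ / n` occurs on both sides of the level condition and cancels, so the level size
has no influence on the sets. -/
theorem mem_levelSet_iff {S : Finset (Fin d)} {hS : S.Nonempty} {Δ : ℝ} (hΔ : 0 < Δ) {r : ℕ}
    (hr : 1 < r) {n : ℕ} {x : Fin d → ℕ} (hx : ∑ i ∈ S, x i < n) (j : ℕ) :
    x ∈ J.levelSet S hS Δ r n j ↔ 1 ≤ j ∧ J.scaledSub S hS n x ≤ j * Real.log r := by
  have hn : (0 : ℝ) < n := by exact_mod_cast (Nat.zero_le _).trans_lt hx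
  have hlog : 0 < Real.log r := Real.log_pos (by exact_mod_cast hr)
  have h1 : J.importance S hS Δ r (fun i => (x i : ℝ) / n) =
      Δ / n * (J.scaledSub S hS n x / Real.log r) := by
    have h2 : ∑ i, Real.log (J.rho i) * ((x i : ℝ) / n) =
        (∑ i, Real.log (J.rho i) * x i) / n := by
      rw [Finset.sum_div]
      exact Finset.sum_congr rfl fun i _ => (mul_div_assoc _ _ _).symm
    rw [importance, subsolution, scaledSub, h2]
    field_simp
  have h3 : Δ * j / n = Δ / n * j := by ring
  have h4 : ¬ n ≤ ∑ i ∈ S, x i := by omega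
  rw [levelSet, Set.mem_ofPred_eq, h1, h3, mul_le_mul_iff_right₀ (div_pos hΔ hn),
    div_le_iff₀ hlog]
  simp [h4]

/-- The splitting factor to the power of the initial level is comparable to the exponential of the
scaled subsolution. -/
theorem initialLevel_bounds {S : Finset (Fin d)} {hS : S.Nonempty} {Δ : ℝ} (hΔ : 0 < Δ) {r : ℕ}
    (hr : 1 < r) {n : ℕ} {x : Fin d → ℕ} (hx : ∑ i ∈ S, x i < n)
    (hs : 0 ≤ J.scaledSub S hS n x) :
    x ∈ J.levelSet S hS Δ r n (J.initialLevel S hS Δ r n x) ∧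
      Real.exp (J.scaledSub S hS n x) ≤ (r : ℝ) ^ J.initialLevel S hS Δ r n x ∧
      (r : ℝ) ^ J.initialLevel S hS Δ r n x ≤ r * Real.exp (J.scaledSub S hS n x) := by
  have hmem := mem_levelSet_iff (J := J) (hS := hS) hΔ hr hx
  have hlog : 0 < Real.log r := Real.log_pos (by exact_mod_cast hr)
  have hr0 : (0 : ℝ) < r := by positivity
  have hpow : ∀ j : ℕ, (r : ℝ) ^ j = Real.exp (j * Real.log r) := fun j => by
    rw [Real.exp_nat_mul, Real.exp_log hr0]
  set s := J.scaledSub S hS n x with hsdef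
  have hne : {j | x ∈ J.levelSet S hS Δ r n j}.Nonempty := by
    refine ⟨⌈s / Real.log r⌉₊ + 1, (hmem _).2 ⟨by omega, ?_⟩⟩
    rw [← div_le_iff₀ hlog]
    push_cast
    linarith [Nat.le_ceil (s / Real.log r)]
  have hin : x ∈ J.levelSet S hS Δ r n (J.initialLevel S hS Δ r n x) := Nat.sInf_mem hne
  have hmin : ∀ j < J.initialLevel S hS Δ r n x, x ∉ J.levelSet S hS Δ r n j := fun j hj =>
    Nat.notMem_of_lt_sInf (s := {j | x ∈ J.levelSet S hS Δ r n j}) hj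
  refine ⟨hin, ?_⟩
  obtain ⟨h1, h2⟩ := (hmem _).1 hin
  rcases hl : J.initialLevel S hS Δ r n x with _ | m
  · omega
  · rw [hl] at h2 hmin
    refine ⟨by rw [hpow]; exact Real.exp_le_exp.2 h2, ?_⟩
    rw [pow_succ, mul_comm]
    refine mul_le_mul_of_nonneg_left ?_ hr0.le
    rw [hpow]
    refine Real.exp_le_exp.2 ?_
    -- Off the target the least possible level is one, even where the subsolution would allow less;
    -- there the upper bound rests on `hs`. At higher levels it comes from minimality.
    rcases Nat.eq_zero_or_pos m with rfl | hm
    · simpa using hs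
    · have h3 := hmin m (by omega)
      rw [hmem] at h3
      by_contra hcon
      exact h3 ⟨hm, (not_le.1 hcon).le⟩

theorem integral_terminalCount {r : ℕ} {Ω : Type*} [MeasurableSpace Ω] {μ : Measure Ω}
    {Y : List (Fin r) → ℕ → Ω → JacksonEvent d} (hmeas : ∀ u k, Measurable (Y u k))
    (hlaw : ∀ u k e, μ {ω | Y u k ω = e} = ENNReal.ofReal (J.eventProb e))
    (hindep : iIndepFun (fun p : List (Fin r) × ℕ => Y p.1 p.2) μ)
    (S : Finset (Fin d)) (hS : S.Nonempty) (Δ : ℝ) (n : ℕ) (x : Fin d → ℕ)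
    (hx : x ∈ J.levelSet S hS Δ r n (J.initialLevel S hS Δ r n x)) :
    ∫ ω, (J.terminalCount S hS Δ n x (fun u k => Y u k ω) : ℝ) ∂μ =
      (r : ℝ) ^ J.initialLevel S hS Δ r n x * (J.hit (target S n) x).toReal := by
  have hY : Measurable fun ω u t => Y u t ω :=
    measurable_pi_lambda _ fun u => measurable_pi_lambda _ fun t => hmeas u t
  have hm : Measurable fun ω =>
      (J.terminalCount S hS Δ n x (fun u k => Y u k ω) : ℝ≥0∞) :=
    (measurable_splitCount (J.levelSet S hS Δ r n) _ x).comp hY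
  have h1 : ∀ ω, (J.terminalCount S hS Δ n x (fun u k => Y u k ω) : ℝ) =
      (J.terminalCount S hS Δ n x (fun u k => Y u k ω) : ℝ≥0∞).toReal := fun ω => by simp
  simp only [h1]
  rw [integral_toReal hm.aemeasurable (Eventually.of_forall fun ω => by simp)]
  have h2 := lintegral_splitCount J (levelSet_zero_subset J S hS Δ r n) hmeas hlaw hindep _ hx
  rw [levelSet_zero] at h2
  rw [show (∫⁻ ω, (J.terminalCount S hS Δ n x (fun u k => Y u k ω) : ℝ≥0∞) ∂μ) = _ from h2]
  simp

end JacksonNetwork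

end
theorem proposition4 {d : ℕ} (J : JacksonNetwork d)
    (hopen : J.IsOpenNetwork) (hstable : J.IsStable)
    (S : Finset (Fin d)) (hS : S.Nonempty)
    (Δ : ℝ) (hΔ : 0 < Δ) (hΔ1 : Δ ≤ 1) (r : ℕ) (hr : 1 < r)
    (x : Fin d → ℕ)
    {Ω : Type*} [MeasurableSpace Ω] (μ : Measure Ω) [IsProbabilityMeasure μ]
    (Y : List (Fin r) → ℕ → Ω → JacksonEvent d)
    (hmeas : ∀ u k, Measurable (Y u k))
    (hlaw : ∀ u k e, μ {ω | Y u k ω = e} = ENNReal.ofReal (J.eventProb e))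
    (hindep : iIndepFun (fun p : List (Fin r) × ℕ => Y p.1 p.2) μ) :
    (fun n : ℕ => ∫ ω, (J.terminalCount S hS Δ n x (fun u k => Y u k ω) : ℝ) ∂μ)
      =Θ[atTop] (fun n : ℕ => (n : ℝ) ^ (J.beta S hS - 1)) := by
  obtain ⟨c, C, hc, hC, hbounds⟩ := JacksonNetwork.hit_target_bounds hopen hstable S hS x
  set ρ := J.rhoStar S hS with hρ
  obtain ⟨i₀, -, hi₀⟩ := Finset.exists_mem_eq_sup' hS J.rho
  change ρ = J.rho i₀ at hi₀
  have hρ0 : 0 < ρ := hi₀ ▸ JacksonNetwork.rho_pos hopen hstable i₀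
  have hρ1 : ρ < 1 := hi₀ ▸ JacksonNetwork.rho_lt_one hopen hstable i₀
  have hlogρ : Real.log ρ < 0 := Real.log_neg hρ0 hρ1
  set K := ∑ i, Real.log (J.rho i) * (x i : ℝ) with hK
  have hr0 : (0 : ℝ) < r := by positivity
  have hlarge : ∀ᶠ n : ℕ in atTop, 0 ≤ J.scaledSub S hS n x := by
    have h1 : Tendsto (fun n : ℕ => (n : ℝ) * -Real.log ρ) atTop atTop :=
      tendsto_natCast_atTop_atTop.atTop_mul_const (neg_pos.2 hlogρ)
    filter_upwards [h1.eventually_ge_atTop (-K)] with n hn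
    rw [JacksonNetwork.scaledSub]
    linarith
  -- The growth of the splitting factor cancels the exponential decay of the hitting probability
  -- exactly; only a constant depending on `x` and the power of `n` remain.
  have hexp : ∀ n : ℕ, Real.exp (J.scaledSub S hS n x) * ρ ^ n = Real.exp K := fun n => by
    rw [JacksonNetwork.scaledSub, ← hρ, ← hK, Real.exp_sub, Real.exp_nat_mul, Real.exp_log hρ0,
      div_mul_cancel₀ _ (pow_pos hρ0 n).ne']
  have hmain : ∀ᶠ n : ℕ in atTop,
      c * Real.exp K * (n : ℝ) ^ (J.beta S hS - 1) ≤
        ∫ ω, (J.terminalCount S hS Δ n x (fun u k => Y u k ω) : ℝ) ∂μ ∧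
      ∫ ω, (J.terminalCount S hS Δ n x (fun u k => Y u k ω) : ℝ) ∂μ ≤
        C * r * Real.exp K * (n : ℝ) ^ (J.beta S hS - 1) := by
    filter_upwards [hbounds, hlarge, eventually_gt_atTop (∑ i ∈ S, x i)] with n hb hs hn
    obtain ⟨hmem, hlow, hup⟩ := JacksonNetwork.initialLevel_bounds (J := J) (hS := hS) hΔ hr hn hs
    rw [JacksonNetwork.integral_terminalCount hmeas hlaw hindep S hS Δ n x hmem]
    have hE := Real.exp_pos (J.scaledSub S hS n x)
    have hh : 0 ≤ (J.hit (JacksonNetwork.target S n) x).toReal := ENNReal.toReal_nonneg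
    have hn0 : 0 ≤ (n : ℝ) ^ (J.beta S hS - 1) := by positivity
    constructor
    · calc c * Real.exp K * (n : ℝ) ^ (J.beta S hS - 1) =
            Real.exp (J.scaledSub S hS n x) * (c * (n : ℝ) ^ (J.beta S hS - 1) * ρ ^ n) := by
            rw [← hexp n]; ring
        _ ≤ _ := mul_le_mul hlow hb.1 (by positivity) (by positivity)
    · calc _ ≤ (r * Real.exp (J.scaledSub S hS n x)) *
            (C * (n : ℝ) ^ (J.beta S hS - 1) * ρ ^ n) :=
            mul_le_mul hup hb.2 hh (by positivity)
        _ = _ := by rw [← hexp n]; ring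
  have hpos : ∀ n : ℕ, ‖(n : ℝ) ^ (J.beta S hS - 1)‖ = (n : ℝ) ^ (J.beta S hS - 1) := fun n =>
    Real.norm_of_nonneg (by positivity)
  have hint : ∀ n : ℕ, ‖∫ ω, (J.terminalCount S hS Δ n x (fun u k => Y u k ω) : ℝ) ∂μ‖ =
      ∫ ω, (J.terminalCount S hS Δ n x (fun u k => Y u k ω) : ℝ) ∂μ := fun n =>
    Real.norm_of_nonneg (integral_nonneg fun ω => Nat.cast_nonneg _)
  constructor
  · refine IsBigO.of_bound (C * r * Real.exp K) ?_
    filter_upwards [hmain] with n hn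
    rw [hpos, hint]; exact hn.2
  · refine IsBigO.of_bound (c * Real.exp K)⁻¹ ?_
    filter_upwards [hmain] with n hn
    rw [hpos, hint, inv_mul_eq_div, le_div_iff₀ (by positivity), mul_comm]
    exact hn.1
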